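/- Let $k$ be a field of characteristic different from $2$ and $3$. There is a nonzero polynomial $P$ with coefficients in $k$ in the $60$ coordinates of $k^4\otimes\operatorname{Sym}_2k^5$ (that is, a nonempty Zariski open subset $\{P\neq0\}$ of the space of tensors, defined over $k$) such that for every algebraically closed field $K\supseteq k$ and every $\mathcal A=(A_0,A_1,A_2,A_3)\in K^4\otimes\operatorname{Sym}_2K^5$ with $P(\mathcal A)\neq 0$ the following holds. Write $A(x)=x_0A_0+x_1A_1+x_2A_2+x_3A_3$; let $X=Z(\det A(x))\subset\mathbb P^3_K$ be the associated quintic symmetroid; let $\varphi\colon X\dashrightarrow\mathbb P^4_K$, $x\mapsto\ker A(x)$, be the kernel map, defined where the kernel is one-dimensional; let $\mathfrak C=\{y\in\mathbb P^4_K: y^TA_iy=0,\ i=0,\dots,3\}$ be the Cayley variety; and let $\psi\colon\mathbb P^4_K\dashrightarrow\widehat{\mathbb P}^3_K$, $y\mapsto[y^TA_0y:\dots:y^TA_3y]$, be the map to the dual space, defined off $\mathfrak C$. The contact points of a plane $H\subset\mathbb P^3_K$ with $X$ are the singular points of $X\cap H$. The plane $H$ is called a distinguished tritangent plane of $\mathcal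 A$ if it has exactly three contact points $x_1,x_2,x_3$, these are smooth points of $X$, and $\varphi(x_1),\varphi(x_2),\varphi(x_3)$ are collinear in $\mathbb P^4_K$. Then: 1. $\mathfrak C$ consists of exactly $16$ points, and there are exactly $120$ secant lines of $\mathfrak C$ (lines joining two distinct points of $\mathfrak C$); 2. there are exactly $120$ distinguished tritangent planes of $\mathcal A$; 3. a plane $H$ is a distinguished tritangent plane of $\mathcal A$ if and only if there is a secant line $\ell$ of $\mathfrak C$ such that $\psi$ contracts $\ell$ to the point $[H]$, i.e. $\psi(\ell\setminus\mathfrak C)=\{[H]\}$. -/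

import Mathlib

open scoped LinearAlgebra.Projectivization

noncomputable section

namespace QuinticSymmetroid

/-- A tensor in `K⁴ ⊗ Sym₂ K⁵`: four symmetric `5 × 5` matrices, recorded by their
`4 · 15 = 60` independent entries. -/
abbrev Tensor (K : Type*) := Fin 4 → Sym2 (Fin 5) → K

/-- The projective 3-space containing the symmetroid. -/
abbrev P3 (K : Type*) [Field K] := ℙ K (Fin 4 → K)

/-- The dual projective 3-space. The point `[h₀ : h₁ : h₂ : h₃]` is the plane
`h₀ x₀ + h₁ x₁ + h₂ x₂ + h₃ x₃ = 0`. -/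
abbrev DualP3 (K : Type*) [Field K] := ℙ K (Fin 4 → K)

/-- The projective 4-space containing the Cayley variety. -/
abbrev P4 (K : Type*) [Field K] := ℙ K (Fin 5 → K)

variable {K : Type*} [Field K]

/-- The `i`-th slice `A_i`, a symmetric `5 × 5` matrix. -/
def slice (A : Tensor K) (i : Fin 4) : Matrix (Fin 5) (Fin 5) K :=
  Matrix.of fun j l => A i s(j, l)

/-- The contraction `A(x, ·, ·) = x₀ A₀ + x₁ A₁ + x₂ A₂ + x₃ A₃`. -/
def contract (A : Tensor K) (x : Fin 4 → K) : Matrix (Fin 5) (Fin 5) K :=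
  ∑ i, x i • slice A i

/-- The quintic form `det (x₀ A₀ + ⋯ + x₃ A₃)` in the variables `x₀, …, x₃`. -/
def detForm (A : Tensor K) : MvPolynomial (Fin 4) K :=
  Matrix.det (∑ i : Fin 4, (MvPolynomial.X i : MvPolynomial (Fin 4) K) •
    (slice A i).map (MvPolynomial.C (σ := Fin 4)))

/-- The quintic symmetroid `X = Z(det A(x, ·, ·)) ⊆ ℙ³`. -/
def symmetroid (A : Tensor K) : Set (P3 K) :=
  {x | MvPolynomial.eval x.rep (detForm A) = 0}

/-- The gradient of the defining form of `X` at (a representative of) `x`. -/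
def gradient (A : Tensor K) (x : P3 K) : Fin 4 → K :=
  fun i => MvPolynomial.eval x.rep (MvPolynomial.pderiv i (detForm A))

/-- `x` is a smooth point of `X`. -/
def IsSmoothPoint (A : Tensor K) (x : P3 K) : Prop :=
  x ∈ symmetroid A ∧ gradient A x ≠ 0

/-- The points of the plane `h`. -/
def plane (h : DualP3 K) : Set (P3 K) :=
  {x | h.rep ⬝ᵥ x.rep = 0}

/-- The contact points of the plane `h` with `X`: the singular points of `X ∩ h`, i.e. the points
of `X ∩ h` where the differential of the defining form of `X` vanishes along `h`. They are the
smooth points of `X` with tangent plane `h`, together with the singular points of `X` on `h`. -/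
def contactPoints (A : Tensor K) (h : DualP3 K) : Set (P3 K) :=
  {x | x ∈ symmetroid A ∧ x ∈ plane h ∧
    ∀ v : Fin 4 → K, h.rep ⬝ᵥ v = 0 → gradient A x ⬝ᵥ v = 0}

/-- The graph of the (rational) kernel map `φ : X ⇢ ℙ⁴`, `x ↦ ker A(x, ·, ·)`, which is defined
where the kernel is one-dimensional. -/
def IsKernelImage (A : Tensor K) (x : P3 K) (y : P4 K) : Prop :=
  LinearMap.ker (contract A x.rep).mulVecLin = y.submodule

/-- A plane is a tritangent plane of `X` if it has exactly three (distinct) contact points. -/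
def IsTritangent (A : Tensor K) (h : DualP3 K) : Prop :=
  (contactPoints A h).ncard = 3

/-- A line in `ℙ⁴`, given by its two-dimensional cone in `K⁵`. -/
def IsLine (L : Submodule K (Fin 5 → K)) : Prop :=
  Module.finrank K L = 2

/-- A tritangent plane is distinguished if its three contact points are smooth points of `X` and
their images under the kernel map are collinear. -/
def IsDistinguishedTritangent (A : Tensor K) (h : DualP3 K) : Prop :=
  IsTritangent A h ∧ (∀ x ∈ contactPoints A h, IsSmoothPoint A x) ∧
    ∃ L : Submodule K (Fin 5 → K), IsLine L ∧
      ∀ x ∈ contactPoints A h, ∃ y : P4 K, IsKernelImage A x y ∧ y.submodule ≤ L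

/-- The vector `A(·, y, y) = (q₀(y), …, q₃(y))` of the values of the four quadratic forms. -/
def quadrics (A : Tensor K) (y : Fin 5 → K) : Fin 4 → K :=
  fun i => y ⬝ᵥ (slice A i).mulVec y

/-- The set of points of the Cayley variety, the common zeros of the four quadrics. -/
def cayleyVariety (A : Tensor K) : Set (P4 K) :=
  {y | quadrics A y.rep = 0}

/-- The secant lines of the Cayley variety: the lines through two distinct points of it. -/
def secantLines (A : Tensor K) : Set (Submodule K (Fin 5 → K)) :=
  {L | ∃ p ∈ cayleyVariety A, ∃ q ∈ cayleyVariety A, p ≠ q ∧ L = p.submodule ⊔ q.submodule}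

/-- The image of the line `L` under the rational map `ψ : ℙ⁴ ⇢ ℙ³ᵛ`, `y ↦ A(·, y, y)`, which is
defined off the Cayley variety. -/
def psiImage (A : Tensor K) (L : Submodule K (Fin 5 → K)) : Set (DualP3 K) :=
  {h | ∃ y : P4 K, y.submodule ≤ L ∧
    ∃ hy : quadrics A y.rep ≠ 0, h = Projectivization.mk K (quadrics A y.rep) hy}

end QuinticSymmetroid

end

open MvPolynomial

universe u v w

/-! Let p, q be distinct points of the Cayley variety. At sp + tq the four quadrics take the value
2st·A(·,p,q), so ψ contracts the secant to the plane H = [A(·,p,q)], provided this vector is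
nonzero. It is nonzero if no member of the web is singular at a Cayley point: the vectors A_i p are
then independent, and the vectors orthogonal to all of them form the line K p
(`IsGeneral.polar_ne_zero`).

The plane H parametrises the net of quadrics A(x) containing the whole secant. In a frame starting
with p, q these have the block form (0 N; Nᵗ S), with N(x) of size 2×3. By Jacobi's formula the
gradient of det A at x, for A(x)y = 0, is a multiple of (q₀(y), …, q₃(y)), and a nonzero one in
corank one (`exists_gradient_eq_smul_quadrics`). A member is singular at a point w of the secant
when w N(x) = 0; this is a binary cubic condition on w, whose three roots give three contact points.
Any other singular member has its kernel off the secant, and contact would make that kernel a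
singular base point of the net. `IsTameNet` rules out the degenerate cases
(`IsPairFrame.exists_contact`).

Conversely, three smooth contact points have distinct kernels, since otherwise a whole line would
consist of contact points. If the kernels are collinear, the quadrics restrict to their line as a
fixed vector times a binary quadratic form, the third kernel controlling the mixed coefficient. Its
roots are distinct by `IsGeneral.polar_ne_zero`, so the line is a secant
(`IsGeneral.mem_secantLines`). A plane determines its contact points, their kernels and hence the
secant; no three Cayley points are collinear, so 16 points give 120 secants and 120 planes.

It remains to see that the conditions hold off a hypersurface. If one failed off every hypersurface,
the counterexamples, one for each nonzero polynomial, would specialise together to a counterexample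
with algebraically independent entries (`exists_generic_specialization`). There tameness is a
parameter count: a tensor with two Cayley points has 60 coordinates, among them the 36 coefficients
of the net, which are therefore independent, whereas a bad net lies in a field generated by 35
elements. Reducedness and the bound 16 follow by reducing along a valuation to the web y_i² - y_4².
For the existence of 16 points, the sign vectors are lifted to a formal deformation of that web, and
Chevalley's theorem transfers the solutions. -/

/-! ### Transcendence degree, generic specialisation, extension of homomorphisms -/

/-- E is the fraction field of the subalgebra generated by z, hence algebraic over it. Bounds on the
transcendence degree take a generating family in this form. -/
theorem isAlgebraic_adjoin_range {k F κ : Type*} [Field k] [Field F] [Algebra k F]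
    {E : IntermediateField k F} (z : κ → E)
    (hE : E ≤ IntermediateField.adjoin k (Set.range fun i => (z i : F))) :
    Algebra.IsAlgebraic (Algebra.adjoin k (Set.range z)) E := by
  have htop : IntermediateField.adjoin k (Set.range z) = ⊤ := by
    apply IntermediateField.map_injective E.val
    rw [IntermediateField.adjoin_map, ← Set.range_comp, ← AlgHom.fieldRange_eq_map,
      IntermediateField.fieldRange_val]
    refine le_antisymm ?_ hE
    rw [IntermediateField.adjoin_le_iff]
    rintro _ ⟨i, rfl⟩
    exact (z i).2
  rw [← IntermediateField.isAlgebraic_adjoin_iff_top]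
  refine ⟨fun x => ?_⟩
  have hx : x ∈ IntermediateField.adjoin k (Set.range z) := by rw [htop]; trivial
  exact isAlgebraic_algebraMap (⟨x, hx⟩ : IntermediateField.adjoin k (Set.range z))

/-- A finite family of the same size as an algebraically independent one contained in the field
it generates is algebraically independent. -/
theorem algebraicIndependent_of_mem_adjoin {k F ι κ : Type*} [Field k] [Field F] [Algebra k F]
    [Fintype ι] [Fintype κ] {a : ι → F} (ha : AlgebraicIndependent k a) (z : κ → F)
    (hc : Fintype.card κ ≤ Fintype.card ι)
    (h : ∀ i, a i ∈ IntermediateField.adjoin k (Set.range z)) : AlgebraicIndependent k z := by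
  set E := IntermediateField.adjoin k (Set.range z) with hE
  let z' : κ → E := fun i => ⟨z i, IntermediateField.subset_adjoin _ _ ⟨i, rfl⟩⟩
  let a' : ι → E := fun i => ⟨a i, h i⟩
  have ha' : AlgebraicIndependent k a' := AlgebraicIndependent.of_comp E.val ha
  have := isAlgebraic_adjoin_range z' (le_of_eq hE)
  have hle := ha'.lift_cardinalMk_le_trdeg
  -- The transcendence degree of E is at least #ι ≥ #κ, while E is algebraic over the algebra
  -- generated by z. Hence z has no redundant member.
  have : IsTranscendenceBasis k z' := by
    apply Algebra.IsAlgebraic.isTranscendenceBasis_of_lift_le_trdeg_of_finite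
    rw [Cardinal.mk_fintype, Cardinal.lift_natCast] at hle ⊢
    refine le_trans (Nat.cast_le.2 hc) ?_
    exact Cardinal.nat_le_lift_iff.2 (Cardinal.nat_le_lift_iff.1 hle)
  exact this.1.map' (f := E.val) E.val.injective

/-- A field generated by `s` contains at most `#s` algebraically independent elements. -/
theorem card_le_of_mem_adjoin {k F ι : Type*} [Field k] [Field F] [Algebra k F] [Fintype ι]
    {a : ι → F} (ha : AlgebraicIndependent k a) (s : Finset F)
    (h : ∀ i, a i ∈ IntermediateField.adjoin k (s : Set F)) : Fintype.card ι ≤ s.card := by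
  set E := IntermediateField.adjoin k (s : Set F) with hE
  let z' : s → E := fun i => ⟨i, IntermediateField.subset_adjoin _ _ i.2⟩
  let a' : ι → E := fun i => ⟨a i, h i⟩
  have ha' : AlgebraicIndependent k a' := AlgebraicIndependent.of_comp E.val ha
  have := isAlgebraic_adjoin_range z' (by simp [z', E])
  have hle := ha'.lift_cardinalMk_le_trdeg
  have h1 := Algebra.IsAlgebraic.trdeg_le_cardinalMk k (Set.range z')
  rw [Cardinal.mk_fintype, Cardinal.lift_natCast, Cardinal.nat_le_lift_iff] at hle
  have h2 := hle.trans (h1.trans Cardinal.mk_range_le)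
  simpa using h2

/-- If every nonzero polynomial `P` is nonzero at a point `a P`, these points have a common
generic specialisation: a ring homomorphism from the product of the fields to an algebraically
closed field that makes the coordinates algebraically independent. -/
theorem exists_generic_specialization {k : Type u} {ι : Type v} [Field k]
    (K : {P : MvPolynomial ι k // P ≠ 0} → Type w) [∀ P, Field (K P)] [∀ P, Algebra k (K P)]
    (a : ∀ P, ι → K P) (ha : ∀ P, aeval (a P) P.1 ≠ 0) :
    ∃ (F : Type (max u v w)) (_ : Field F) (_ : IsAlgClosed F) (_ : Algebra k F)
      (θ : (∀ P, K P) →+* F), AlgebraicIndependent k fun i => θ fun P => a P i := by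
  classical
  let b : ι → ∀ P, K P := fun i P => a P i
  have hb : ∀ (P : MvPolynomial ι k) Q, (aeval b P) Q = aeval (a Q) P := by
    intro P Q
    have : (Pi.evalAlgHom k K Q).comp (aeval b) = aeval (a Q) := by
      ext i; simp [b]
    exact DFunLike.congr_fun this P
  let M : Submonoid (∀ P, K P) := (nonZeroDivisors (MvPolynomial ι k)).map (aeval b)
  -- Zero is not in `M`, since the image of P is nonzero in the factor indexed by P itself. Modulo a
  -- prime disjoint from `M` every nonzero polynomial stays nonzero.
  obtain ⟨I, hI, -, hM⟩ := Ideal.exists_le_prime_disjoint (⊥ : Ideal (∀ P, K P)) M (by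
    rw [Set.disjoint_left]
    rintro x hx ⟨P, hP, rfl⟩
    have hP0 : P ≠ 0 := nonZeroDivisors.ne_zero hP
    have hx : aeval b P = 0 := hx
    exact ha ⟨P, hP0⟩ (by rw [← hb, hx]; rfl))
  let F := AlgebraicClosure (FractionRing ((∀ P, K P) ⧸ I))
  let θ : (∀ P, K P) →ₐ[k] F := (IsScalarTower.toAlgHom k ((∀ P, K P) ⧸ I) F).comp
    (Ideal.Quotient.mkₐ k I)
  refine ⟨F, inferInstance, inferInstance, inferInstance, θ.toRingHom, ?_⟩
  rw [algebraicIndependent_iff]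
  intro P hP
  by_contra hP0
  have h1 : aeval (fun i => θ (b i)) P = θ (aeval b P) := by
    rw [← AlgHom.comp_apply, comp_aeval]
  have h2 : θ (aeval b P) = 0 := by rw [← h1]; exact hP
  have hinj : Function.Injective (algebraMap ((∀ P, K P) ⧸ I) F) := by
    rw [IsScalarTower.algebraMap_eq _ (FractionRing ((∀ P, K P) ⧸ I))]
    exact (RingHom.injective (algebraMap (FractionRing ((∀ P, K P) ⧸ I)) F)).comp
      (IsFractionRing.injective ((∀ P, K P) ⧸ I) (FractionRing ((∀ P, K P) ⧸ I)))
  have h3 : Ideal.Quotient.mk I (aeval b P) = 0 := hinj (by rw [map_zero]; exact h2)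
  rw [Ideal.Quotient.eq_zero_iff_mem] at h3
  exact Set.disjoint_left.1 hM h3 ⟨P, mem_nonZeroDivisors_of_ne_zero hP0, rfl⟩

/-- Nullstellensatz: the quotient by a maximal ideal is finite over κ, so it embeds in K. -/
theorem nonempty_algHom_of_finiteType (κ T K : Type*) [Field κ] [CommRing T] [Nontrivial T]
    [Algebra κ T] [Algebra.FiniteType κ T] [Field K] [IsAlgClosed K] [Algebra κ K] :
    Nonempty (T →ₐ[κ] K) := by
  obtain ⟨m, hm⟩ := Ideal.exists_maximal T
  let _ := Ideal.Quotient.field m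
  have : Module.Finite κ (T ⧸ m) := finite_of_finite_type_of_isJacobsonRing _ _
  let g : (T ⧸ m) →ₐ[κ] K := IsAlgClosed.lift
  exact ⟨g.comp (Ideal.Quotient.mkₐ κ m)⟩

open TensorProduct in
/-- Homomorphisms to an algebraically closed field extend to finitely generated domains, away
from a hypersurface. -/
theorem exists_ne_zero_forall_exists_extension {R S : Type*} [CommRing R] [IsDomain R]
    [IsNoetherianRing R] [CommRing S] [Nontrivial S] [NoZeroDivisors S] [Algebra R S]
    [Algebra.FiniteType R S] (hinj : Function.Injective (algebraMap R S)) :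
    ∃ f : R, f ≠ 0 ∧ ∀ (K : Type*) [Field K] [IsAlgClosed K] [Algebra R K],
      algebraMap R K f ≠ 0 → Nonempty (S →ₐ[R] K) := by
  have : IsDomain S := IsDomain.mk
  have hfp : (algebraMap R S).FinitePresentation :=
    RingHom.finitePresentation_algebraMap.2 (Algebra.FinitePresentation.of_finiteType.1 ‹_›)
  -- Chevalley: the image of Spec S is constructible. It contains the generic point because R embeds
  -- in S.
  obtain ⟨D, hD⟩ := PrimeSpectrum.exists_constructibleSetData_iff.2
    (PrimeSpectrum.isConstructible_range_comap hfp)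
  have hbot : (⊥ : PrimeSpectrum R) ∈ D.toSet := by
    rw [hD]
    refine ⟨⊥, ?_⟩
    ext x
    simp [PrimeSpectrum.comap_asIdeal, Ideal.mem_comap, map_eq_zero_iff _ hinj]
  simp only [PrimeSpectrum.ConstructibleSetData.toSet, Set.mem_iUnion] at hbot
  obtain ⟨C, hC, hbot⟩ := hbot
  simp only [PrimeSpectrum.BasicConstructibleSetData.toSet, Set.mem_sdiff,
    PrimeSpectrum.mem_zeroLocus] at hbot
  -- The equations of a basic piece through the generic point are all zero, so the piece is the
  -- basic open set of `C.f`.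
  refine ⟨C.f, by simpa using hbot.2, ?_⟩
  intro K _ _ _ hK
  obtain ⟨p, hpK⟩ : ∃ p : PrimeSpectrum R, p.asIdeal = RingHom.ker (algebraMap R K) :=
    ⟨⟨RingHom.ker (algebraMap R K), RingHom.ker_isPrime _⟩, rfl⟩
  have hp : p ∈ Set.range (PrimeSpectrum.comap (algebraMap R S)) := by
    rw [← hD]
    simp only [PrimeSpectrum.ConstructibleSetData.toSet, Set.mem_iUnion]
    refine ⟨C, hC, ?_⟩
    simp only [PrimeSpectrum.BasicConstructibleSetData.toSet, Set.mem_sdiff,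
      PrimeSpectrum.mem_zeroLocus]
    refine ⟨?_, ?_⟩
    · rintro x hx
      have : x = 0 := by simpa using hbot.1 hx
      rw [this]; exact zero_mem _
    · simpa [hpK] using hK
  have := (PrimeSpectrum.nontrivial_iff_mem_rangeComap p).2 hp
  let κ := p.asIdeal.ResidueField
  let e : κ →+* K := Ideal.ResidueField.lift p.asIdeal (algebraMap R K) hpK.le (by
    intro x hx
    exact isUnit_iff_ne_zero.2 fun h => hx (hpK ▸ h))
  let _ : Algebra κ K := e.toAlgebra
  obtain ⟨g⟩ := nonempty_algHom_of_finiteType κ (κ ⊗[R] S) K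
  have : IsScalarTower R κ K := IsScalarTower.of_algebraMap_eq fun r =>
    (Ideal.ResidueField.lift_algebraMap ..).symm
  exact ⟨(g.restrictScalars R).comp Algebra.TensorProduct.includeRight⟩

namespace QuinticSymmetroid

/-! ### Nets of quadrics through a line: tameness by parameter count -/

section Net

variable {F : Type*} [Field F]

/-- The determinant of the matrix whose `i`-th column is the row `f i` of `N i`. -/
def mixedDet {R : Type*} [CommRing R] (N : Fin 3 → Fin 2 → Fin 3 → R) (f : Fin 3 → Fin 2) : R :=
  Matrix.det (Matrix.of fun j i => N i (f i) j)

/-- The cubic `det (t R₀ + R₁)`, where `R_γ` has the columns `N i γ`. -/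
def netCubic {R : Type*} [CommRing R] (N : Fin 3 → Fin 2 → Fin 3 → R) : Cubic R where
  a := mixedDet N ![0, 0, 0]
  b := mixedDet N ![1, 0, 0] + mixedDet N ![0, 1, 0] + mixedDet N ![0, 0, 1]
  c := mixedDet N ![0, 1, 1] + mixedDet N ![1, 0, 1] + mixedDet N ![1, 1, 0]
  d := mixedDet N ![1, 1, 1]

/-- Vanishes if and only if the cubic has a root at infinity or a multiple root. -/
def netDisc {R : Type*} [CommRing R] (N : Fin 3 → Fin 2 → Fin 3 → R) : R :=
  (netCubic N).a * (netCubic N).discr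

theorem map_netDisc {R R' : Type*} [CommRing R] [CommRing R'] (θ : R →+* R')
    (N : Fin 3 → Fin 2 → Fin 3 → R) :
    θ (netDisc N) = netDisc fun i γ j => θ (N i γ j) := by
  have h : ∀ f, θ (mixedDet N f) = mixedDet (fun i γ j => θ (N i γ j)) f := fun f => by
    rw [mixedDet, RingHom.map_det]
    rfl
  simp only [netDisc, netCubic, Cubic.discr, map_mul, map_add, map_sub, map_pow, h]
  simp only [map_ofNat]

theorem det_eq_netCubic {R : Type*} [CommRing R] (N : Fin 3 → Fin 2 → Fin 3 → R) (t : R) :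
    Matrix.det (Matrix.of fun j i => t * N i 0 j + N i 1 j) =
      (netCubic N).a * t ^ 3 + (netCubic N).b * t ^ 2 + (netCubic N).c * t + (netCubic N).d := by
  simp only [netCubic, mixedDet, Matrix.det_fin_three, Matrix.of_apply]
  simp
  ring

/-- A net of quadrics `2 w N_i v + v S_i v` containing the line `v = 0` is *tame* if its singular
members on the line are three in number and of corank one, and no quadric of the net is singular at
a base point off the line. -/
structure IsTameNet (N : Fin 3 → Fin 2 → Fin 3 → F) (S : Fin 3 → Sym2 (Fin 3) → F) : Prop where
  disc_ne_zero : netDisc N ≠ 0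
  eq_zero_of_singular_on_line : ∀ (x v : Fin 3 → F) (w w' : Fin 2 → F), x ≠ 0 → w ≠ 0 →
    (∀ j, ∑ γ, w γ * ∑ i, x i * N i γ j = 0) → (∀ γ, ∑ j, v j * ∑ i, x i * N i γ j = 0) →
    (∀ j, ∑ γ, w' γ * ∑ i, x i * N i γ j + ∑ l, v l * ∑ i, x i * S i s(j, l) = 0) → v = 0
  eq_zero_of_singular : ∀ (x v : Fin 3 → F) (w : Fin 2 → F), x ≠ 0 →
    (∀ γ, ∑ j, v j * ∑ i, x i * N i γ j = 0) →
    (∀ j, ∑ γ, w γ * ∑ i, x i * N i γ j + ∑ l, v l * ∑ i, x i * S i s(j, l) = 0) →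
    (∀ i, 2 * ∑ γ, w γ * ∑ j, v j * N i γ j + ∑ j, v j * ∑ l, v l * S i s(j, l) = 0) → v = 0

/-- A linear relation with coefficient one at c recovers f c from the rest, so each relation saves
one generator in the parameter counts. -/
theorem mem_of_sum_mul_mem {k : Type*} [Field k] [Algebra k F] {ι : Type*} [Fintype ι]
    [DecidableEq ι] (E : IntermediateField k F) {x f : ι → F} {c : ι} (hx : x c = 1)
    (hE : ∀ i, i ≠ c → x i ∈ E) (hf : ∀ i, i ≠ c → f i ∈ E) (hs : ∑ i, x i * f i ∈ E) :
    f c ∈ E := by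
  rw [← Finset.add_sum_erase _ _ (Finset.mem_univ c), hx, one_mul] at hs
  have h2 : ∑ i ∈ Finset.univ.erase c, x i * f i ∈ E :=
    sum_mem fun i hi =>
      mul_mem (hE i (Finset.ne_of_mem_erase hi)) (hf i (Finset.ne_of_mem_erase hi))
  simpa using sub_mem hs h2

theorem fin_two_sum {M : Type*} [AddCommMonoid M] (f : Fin 2 → M) (α : Fin 2) :
    ∑ γ, f γ = f α + f (α + 1) := by
  fin_cases α
  · simp
  · simp [add_comm]

variable {k : Type*} [Field k] [Algebra k F] {N : Fin 3 → Fin 2 → Fin 3 → F}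
  {S : Fin 3 → Sym2 (Fin 3) → F}

/-- The 36 coefficients of a net of quadrics through a line. -/
def netCoeffs (N : Fin 3 → Fin 2 → Fin 3 → F) (S : Fin 3 → Sym2 (Fin 3) → F) :
    (Fin 3 × Fin 2 × Fin 3) ⊕ (Fin 3 × Sym2 (Fin 3)) → F :=
  Sum.elim (fun s => N s.1 s.2.1 s.2.2) fun s => S s.1 s.2

theorem netDisc_ne_zero (h2 : (2 : k) ≠ 0) (h : AlgebraicIndependent k (netCoeffs N S)) :
    netDisc N ≠ 0 := by
  let X : Fin 3 → Fin 2 → Fin 3 →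
      MvPolynomial ((Fin 3 × Fin 2 × Fin 3) ⊕ (Fin 3 × Sym2 (Fin 3))) k :=
    fun i γ j => MvPolynomial.X (Sum.inl (i, γ, j))
  have h1 : aeval (netCoeffs N S) (netDisc X) = netDisc N := by
    have := map_netDisc (aeval (R := k) (netCoeffs N S)).toRingHom X
    refine Eq.trans this ?_
    congr 1
    ext i γ j
    simp [X, netCoeffs]
  have h3 : netDisc X ≠ 0 := by
    intro h0
    -- For this net t R₀ + R₁ = diag(t, t + 1, t - 1), with determinant t³ - t of discriminant 4.
    let W : Fin 3 → Fin 2 → Fin 3 → k :=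
      ![![![1, 0, 0], ![0, 0, 0]], ![![0, 1, 0], ![0, 1, 0]], ![![0, 0, 1], ![0, 0, -1]]]
    have := map_netDisc
      (aeval (R := k) (Sum.elim (fun s => W s.1 s.2.1 s.2.2) fun _ => 0)).toRingHom X
    rw [h0, map_zero] at this
    have h4 : netDisc W = 0 := by
      refine Eq.trans ?_ this.symm
      congr 1
      ext i γ j
      simp [X]
    have h5 : netDisc W = 2 * 2 := by
      simp [netDisc, netCubic, Cubic.discr, mixedDet, Matrix.det_fin_three, W]
      norm_num
    rw [h5] at h4
    exact (mul_ne_zero h2 h2) h4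
  rw [← h1]
  intro h0
  exact h3 (h.eq_zero_of_aeval_eq_zero _ h0)

-- Parameter count. Put n_γ = ∑ x_i N_{iγ}. The equations express n_α through n_{α+1}, make v
-- orthogonal to n_{α+1}, and give Sv as a multiple of n_{α+1}. They recover 3 + 1 + 3 = 7 of the 36
-- coefficients from the other 29 and six parameters: two each for the normalised x and v, then
-- w_{α+1} and μ. Thus 35 elements would generate a field containing 36 independent ones.
open Classical in
theorem not_singular_on_line (h : AlgebraicIndependent k (netCoeffs N S))
    {x v : Fin 3 → F} {w w' : Fin 2 → F} {a c : Fin 3} {α : Fin 2}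
    (hx : x c = 1) (hv : v a = 1) (hw : w α = 1)
    (h1 : ∀ j, ∑ γ, w γ * ∑ i, x i * N i γ j = 0) (h3 : ∀ γ, ∑ j, v j * ∑ i, x i * N i γ j = 0)
    (h4 : ∀ j, ∑ γ, w' γ * ∑ i, x i * N i γ j + ∑ l, v l * ∑ i, x i * S i s(j, l) = 0) :
    False := by
  -- Since n_α = -w_{α+1} n_{α+1}, the vector w' enters only through ∑ w'_γ n_γ = μ n_{α+1}.
  set μ := w' (α + 1) - w' α * w (α + 1) with hμ
  let IN : Finset (Fin 3 × Fin 2 × Fin 3) := Finset.univ.filter fun s =>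
    ¬ (s.1 = c ∧ s.2.1 = α) ∧ ¬ (s.1 = c ∧ s.2.1 = α + 1 ∧ s.2.2 = a)
  let IS : Finset (Fin 3 × Sym2 (Fin 3)) := Finset.univ.filter fun s => ¬ (s.1 = c ∧ a ∈ s.2)
  let s : Finset F := (Finset.univ.erase c).image x ∪ ((Finset.univ.erase a).image v ∪
    ({w (α + 1), μ} ∪ (IN.image (fun s => N s.1 s.2.1 s.2.2) ∪ IS.image (fun s => S s.1 s.2))))
  have hcard : s.card ≤ 2 + (2 + (2 + (14 + 15))) := by
    refine (Finset.card_union_le _ _).trans (add_le_add (Finset.card_image_le.trans (by simp)) ?_)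
    refine (Finset.card_union_le _ _).trans (add_le_add (Finset.card_image_le.trans (by simp)) ?_)
    refine (Finset.card_union_le _ _).trans (add_le_add Finset.card_le_two ?_)
    refine (Finset.card_union_le _ _).trans (add_le_add (Finset.card_image_le.trans ?_)
      (Finset.card_image_le.trans ?_))
    · clear * -
      simp only [IN]
      revert α a c
      decide +revert
    · clear * -
      simp only [IS]
      revert a c
      decide +revert
  set E := IntermediateField.adjoin k (s : Set F) with hE
  have hsE : ∀ y ∈ s, y ∈ E := fun y hy => IntermediateField.subset_adjoin _ _ hy
  have hxE : ∀ i, x i ∈ E := fun i => by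
    by_cases hi : i = c
    · rw [hi, hx]; exact one_mem E
    · exact hsE _ (by
        simp only [s, Finset.mem_union, Finset.mem_image]
        exact Or.inl ⟨i, by simp [hi], rfl⟩)
  have hvE : ∀ i, v i ∈ E := fun i => by
    by_cases hi : i = a
    · rw [hi, hv]; exact one_mem E
    · exact hsE _ (by
        simp only [s, Finset.mem_union, Finset.mem_image]
        exact Or.inr (Or.inl ⟨i, by simp [hi], rfl⟩))
  have hwE : w (α + 1) ∈ E := hsE _ (by simp [s])
  have hμE : μ ∈ E := hsE _ (by simp [s])
  have hNE : ∀ i γ j, ¬ (i = c ∧ γ = α) → ¬ (i = c ∧ γ = α + 1 ∧ j = a) → N i γ j ∈ E := by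
    intro i γ j h h'
    refine hsE _ ?_
    simp only [s, Finset.mem_union, Finset.mem_image]
    right; right; right; left
    refine ⟨(i, γ, j), ?_, rfl⟩
    simp only [IN, Finset.mem_filter, Finset.mem_univ, true_and]
    exact ⟨h, h'⟩
  have hSE : ∀ i σ, ¬ (i = c ∧ a ∈ σ) → S i σ ∈ E := by
    intro i σ h
    refine hsE _ ?_
    simp only [s, Finset.mem_union, Finset.mem_image]
    right; right; right; right
    exact ⟨(i, σ), by simp only [IS, Finset.mem_filter, Finset.mem_univ, true_and]; exact h, rfl⟩
  have hα : α + 1 ≠ α := by fin_cases α <;> decide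
  have hn : ∀ j, ∑ i, x i * N i (α + 1) j ∈ E := by
    have hb : ∀ j, j ≠ a → ∑ i, x i * N i (α + 1) j ∈ E := fun j hj =>
      sum_mem fun i _ => mul_mem (hxE i) (hNE _ _ _ (by tauto) (by tauto))
    intro j
    by_cases hj : j = a
    · subst hj
      refine mem_of_sum_mul_mem E (f := fun j => ∑ i, x i * N i (α + 1) j) hv (fun i _ => hvE i)
        hb ?_
      rw [h3]; exact zero_mem E
    · exact hb j hj
  have hnα : ∀ j, ∑ i, x i * N i α j = - (w (α + 1) * ∑ i, x i * N i (α + 1) j) := by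
    intro j
    have := h1 j
    rw [fin_two_sum _ α, hw, one_mul] at this
    exact eq_neg_of_add_eq_zero_left this
  have hN : ∀ i γ j, N i γ j ∈ E := by
    intro i γ j
    have hsum : ∑ i, x i * N i γ j ∈ E := by
      by_cases hγ : γ = α
      · rw [hγ, hnα]; exact neg_mem (mul_mem hwE (hn j))
      · have : γ = α + 1 := by revert hγ; clear * -; revert γ α; decide
        rw [this]; exact hn j
    by_cases hi : i = c
    · subst hi
      exact mem_of_sum_mul_mem E (f := fun i => N i γ j) hx (fun i _ => hxE i)
        (fun i hi => hNE _ _ _ (by tauto) (by tauto)) hsum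
    · exact hNE _ _ _ (by tauto) (by tauto)
  have h5 : ∀ j, ∑ l, v l * ∑ i, x i * S i s(j, l) ∈ E := by
    intro j
    have := h4 j
    rw [fin_two_sum _ α, hnα] at this
    have h6 : ∑ l, v l * ∑ i, x i * S i s(j, l) = - (μ * ∑ i, x i * N i (α + 1) j) := by
      rw [hμ]; linear_combination this
    rw [h6]; exact neg_mem (mul_mem hμE (hn j))
  have hS' : ∀ j, j ≠ a → S c s(j, a) ∈ E := by
    intro j hj
    refine mem_of_sum_mul_mem E (f := fun i => S i s(j, a)) hx (fun i _ => hxE i)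
      (fun i hi => hSE _ _ (by tauto)) ?_
    refine mem_of_sum_mul_mem E (f := fun l => ∑ i, x i * S i s(j, l)) hv (fun i _ => hvE i) ?_
      (h5 j)
    intro l hl
    refine sum_mem fun i _ => mul_mem (hxE i) (hSE _ _ ?_)
    simp [Ne.symm hj, Ne.symm hl]
  have hSa : S c s(a, a) ∈ E := by
    refine mem_of_sum_mul_mem E (f := fun i => S i s(a, a)) hx (fun i _ => hxE i)
      (fun i hi => hSE _ _ (by tauto)) ?_
    refine mem_of_sum_mul_mem E (f := fun l => ∑ i, x i * S i s(a, l)) hv (fun i _ => hvE i) ?_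
      (h5 a)
    intro l hl
    refine sum_mem fun i _ => mul_mem (hxE i) ?_
    by_cases hi : i = c
    · subst hi
      rw [Sym2.eq_swap]; exact hS' l hl
    · exact hSE _ _ (by tauto)
  have hS : ∀ i σ, S i σ ∈ E := by
    intro i σ
    by_cases hi : i = c ∧ a ∈ σ
    · obtain ⟨rfl, ha⟩ := hi
      obtain ⟨j, rfl⟩ := ha
      by_cases hj : j = a
      · subst hj; exact hSa
      · rw [Sym2.eq_swap]; exact hS' j hj
    · exact hSE _ _ hi
  have := card_le_of_mem_adjoin h s (by
    rintro (⟨i, γ, j⟩ | ⟨i, σ⟩)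
    · exact hN i γ j
    · exact hS i σ)
  have hc : Fintype.card ((Fin 3 × Fin 2 × Fin 3) ⊕ (Fin 3 × Sym2 (Fin 3))) = 36 := by decide
  omega
-- Six parameters for x, v, w against 2 + 2 + 3 = 7 coefficients: the first equations recover N_c at
-- the index a, the second S_c(j, a) for j ≠ a, and the third S_i(a, a) for every i. The second
-- equation at j = a follows from all the others by Euler's relation, so it saves nothing further.
open Classical in
theorem not_singular_off_line (h : AlgebraicIndependent k (netCoeffs N S))
    {x v : Fin 3 → F} {w : Fin 2 → F} {a c : Fin 3}
    (hx : x c = 1) (hv : v a = 1)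
    (h3 : ∀ γ, ∑ j, v j * ∑ i, x i * N i γ j = 0)
    (h4 : ∀ j, ∑ γ, w γ * ∑ i, x i * N i γ j + ∑ l, v l * ∑ i, x i * S i s(j, l) = 0)
    (h5 : ∀ i, 2 * ∑ γ, w γ * ∑ j, v j * N i γ j + ∑ j, v j * ∑ l, v l * S i s(j, l) = 0) :
    False := by
  let IN : Finset (Fin 3 × Fin 2 × Fin 3) := Finset.univ.filter fun s =>
    ¬ (s.1 = c ∧ s.2.2 = a)
  let IS : Finset (Fin 3 × Sym2 (Fin 3)) := Finset.univ.filter fun s =>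
    ¬ (s.1 = c ∧ a ∈ s.2) ∧ s.2 ≠ s(a, a)
  let s : Finset F := (Finset.univ.erase c).image x ∪ ((Finset.univ.erase a).image v ∪
    (Finset.univ.image w ∪ (IN.image (fun s => N s.1 s.2.1 s.2.2) ∪ IS.image (fun s => S s.1 s.2))))
  have hcard : s.card ≤ 2 + (2 + (2 + (16 + 13))) := by
    refine (Finset.card_union_le _ _).trans (add_le_add (Finset.card_image_le.trans (by simp)) ?_)
    refine (Finset.card_union_le _ _).trans (add_le_add (Finset.card_image_le.trans (by simp)) ?_)
    refine (Finset.card_union_le _ _).trans (add_le_add (Finset.card_image_le.trans (by simp)) ?_)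
    refine (Finset.card_union_le _ _).trans (add_le_add (Finset.card_image_le.trans ?_)
      (Finset.card_image_le.trans ?_))
    · clear * -
      simp only [IN]
      revert a c
      decide +revert
    · clear * -
      simp only [IS]
      revert a c
      decide +revert
  set E := IntermediateField.adjoin k (s : Set F) with hE
  have hsE : ∀ y ∈ s, y ∈ E := fun y hy => IntermediateField.subset_adjoin _ _ hy
  have hxE : ∀ i, x i ∈ E := fun i => by
    by_cases hi : i = c
    · rw [hi, hx]; exact one_mem E
    · exact hsE _ (by
        simp only [s, Finset.mem_union, Finset.mem_image]
        exact Or.inl ⟨i, by simp [hi], rfl⟩)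
  have hvE : ∀ i, v i ∈ E := fun i => by
    by_cases hi : i = a
    · rw [hi, hv]; exact one_mem E
    · exact hsE _ (by
        simp only [s, Finset.mem_union, Finset.mem_image]
        exact Or.inr (Or.inl ⟨i, by simp [hi], rfl⟩))
  have hwE : ∀ i, w i ∈ E := fun i => hsE _ (by
    simp only [s, Finset.mem_union, Finset.mem_image]
    right; right; left; exact ⟨i, by simp, rfl⟩)
  have hNE : ∀ i γ j, ¬ (i = c ∧ j = a) → N i γ j ∈ E := by
    intro i γ j h
    refine hsE _ ?_
    simp only [s, Finset.mem_union, Finset.mem_image]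
    right; right; right; left
    exact ⟨(i, γ, j), by simp only [IN, Finset.mem_filter, Finset.mem_univ, true_and]; exact h, rfl⟩
  have hSE : ∀ i σ, ¬ (i = c ∧ a ∈ σ) → σ ≠ s(a, a) → S i σ ∈ E := by
    intro i σ h h'
    refine hsE _ ?_
    simp only [s, Finset.mem_union, Finset.mem_image]
    right; right; right; right
    exact ⟨(i, σ), by simp only [IS, Finset.mem_filter, Finset.mem_univ, true_and]; exact ⟨h, h'⟩,
      rfl⟩
  have hN : ∀ i γ j, N i γ j ∈ E := by
    intro i γ j
    by_cases hi : i = c ∧ j = a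
    · obtain ⟨rfl, rfl⟩ := hi
      refine mem_of_sum_mul_mem E (f := fun i => N i γ j) hx (fun i _ => hxE i)
        (fun i hi => hNE _ _ _ (by tauto)) ?_
      refine mem_of_sum_mul_mem E (f := fun j => ∑ i, x i * N i γ j) hv (fun i _ => hvE i)
        (fun l hl => sum_mem fun i _ => mul_mem (hxE i) (hNE _ _ _ (by tauto))) ?_
      rw [h3]; exact zero_mem E
    · exact hNE _ _ _ hi
  have hS' : ∀ i j, j ≠ a → S i s(j, a) ∈ E := by
    intro i j hj
    have hne : s(j, a) ≠ s(a, a) := by simp [hj]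
    by_cases hi : i = c
    · subst hi
      refine mem_of_sum_mul_mem E (f := fun i => S i s(j, a)) hx (fun i _ => hxE i)
        (fun i hi => hSE _ _ (by tauto) hne) ?_
      refine mem_of_sum_mul_mem E (f := fun l => ∑ i, x i * S i s(j, l)) hv (fun i _ => hvE i) ?_ ?_
      · intro l hl
        refine sum_mem fun i _ => mul_mem (hxE i) (hSE _ _ ?_ ?_)
        · simp [Ne.symm hj, Ne.symm hl]
        · simp [hj]
      · rw [eq_neg_of_add_eq_zero_right (h4 j)]
        exact neg_mem (sum_mem fun γ _ => mul_mem (hwE γ)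
          (sum_mem fun i _ => mul_mem (hxE i) (hN i γ j)))
    · exact hSE _ _ (by tauto) hne
  have hSj : ∀ i j l, j ≠ a → S i s(j, l) ∈ E := by
    intro i j l hj
    by_cases hl : l = a
    · subst hl; exact hS' i j hj
    · refine hSE _ _ ?_ ?_
      · simp [Ne.symm hj, Ne.symm hl]
      · simp [hj]
  have hSa : ∀ i, S i s(a, a) ∈ E := by
    intro i
    refine mem_of_sum_mul_mem E (f := fun l => S i s(a, l)) hv (fun i _ => hvE i)
      (fun l hl => by rw [Sym2.eq_swap]; exact hSj i l a hl) ?_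
    refine mem_of_sum_mul_mem E (f := fun j => ∑ l, v l * S i s(j, l)) hv (fun i _ => hvE i)
      (fun j hj => sum_mem fun l _ => mul_mem (hvE l) (hSj i j l hj)) ?_
    rw [eq_neg_of_add_eq_zero_right (h5 i)]
    exact neg_mem (mul_mem (ofNat_mem E 2) (sum_mem fun γ _ => mul_mem (hwE γ)
      (sum_mem fun j _ => mul_mem (hvE j) (hN i γ j))))
  have hS : ∀ i σ, S i σ ∈ E := by
    intro i σ
    induction σ with
    | h j l =>
      by_cases hj : j = a
      · by_cases hl : l = a
        · subst hj; subst hl; exact hSa i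
        · rw [Sym2.eq_swap]; exact hSj i l j hl
      · exact hSj i j l hj
  have := card_le_of_mem_adjoin h s (by
    rintro (⟨i, γ, j⟩ | ⟨i, σ⟩)
    · exact hN i γ j
    · exact hS i σ)
  have hc : Fintype.card ((Fin 3 × Fin 2 × Fin 3) ⊕ (Fin 3 × Sym2 (Fin 3))) = 36 := by decide
  omega

/-- A net of quadrics with algebraically independent coefficients is tame. -/
theorem isTameNet_of_algebraicIndependent (h2 : (2 : k) ≠ 0)
    (h : AlgebraicIndependent k (netCoeffs N S)) : IsTameNet N S where
  disc_ne_zero := netDisc_ne_zero h2 h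
  eq_zero_of_singular_on_line := by
    intro x v w w' hx hw h1 h3 h4
    by_contra hv
    obtain ⟨c, hc⟩ := Function.ne_iff.1 hx
    obtain ⟨a, ha⟩ := Function.ne_iff.1 hv
    obtain ⟨α, hα⟩ := Function.ne_iff.1 hw
    simp only [Pi.zero_apply] at hc ha hα
    refine not_singular_on_line h (x := fun i => (x c)⁻¹ * x i) (v := fun i => (v a)⁻¹ * v i)
      (w := fun i => (w α)⁻¹ * w i) (w' := fun i => (v a)⁻¹ * w' i)
      (inv_mul_cancel₀ hc) (inv_mul_cancel₀ ha) (inv_mul_cancel₀ hα) ?_ ?_ ?_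
    · intro j
      rw [← mul_zero ((w α)⁻¹ * (x c)⁻¹), ← h1 j]
      simp only [Finset.mul_sum]
      exact Finset.sum_congr rfl fun _ _ => Finset.sum_congr rfl fun _ _ => by ring
    · intro γ
      rw [← mul_zero ((v a)⁻¹ * (x c)⁻¹), ← h3 γ]
      simp only [Finset.mul_sum]
      exact Finset.sum_congr rfl fun _ _ => Finset.sum_congr rfl fun _ _ => by ring
    · intro j
      rw [← mul_zero ((v a)⁻¹ * (x c)⁻¹), ← h4 j, mul_add]
      simp only [Finset.mul_sum]
      congr 1 <;>
      exact Finset.sum_congr rfl fun _ _ => Finset.sum_congr rfl fun _ _ => by ring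
  eq_zero_of_singular := by
    intro x v w hx h3 h4 h5
    by_contra hv
    obtain ⟨c, hc⟩ := Function.ne_iff.1 hx
    obtain ⟨a, ha⟩ := Function.ne_iff.1 hv
    simp only [Pi.zero_apply] at hc ha
    refine not_singular_off_line h (x := fun i => (x c)⁻¹ * x i) (v := fun i => (v a)⁻¹ * v i)
      (w := fun i => (v a)⁻¹ * w i) (inv_mul_cancel₀ hc) (inv_mul_cancel₀ ha) ?_ ?_ ?_
    · intro γ
      rw [← mul_zero ((v a)⁻¹ * (x c)⁻¹), ← h3 γ]
      simp only [Finset.mul_sum]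
      exact Finset.sum_congr rfl fun _ _ => Finset.sum_congr rfl fun _ _ => by ring
    · intro j
      rw [← mul_zero ((v a)⁻¹ * (x c)⁻¹), ← h4 j, mul_add]
      simp only [Finset.mul_sum]
      congr 1 <;>
      exact Finset.sum_congr rfl fun _ _ => Finset.sum_congr rfl fun _ _ => by ring
    · intro i
      rw [← mul_zero ((v a)⁻¹ * (v a)⁻¹), ← h5 i, mul_add]
      simp only [Finset.mul_sum]
      congr 1 <;>
      exact Finset.sum_congr rfl fun _ _ => Finset.sum_congr rfl fun _ _ => by ring

end Net

/-! ### Frames adapted to two points of the Cayley variety -/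

section Frame

variable {K : Type*} [Field K]

/-- The vector `A(·, y, z)` of the values of the four bilinear forms. -/
def polar (A : Tensor K) (y z : Fin 5 → K) : Fin 4 → K :=
  fun i => y ⬝ᵥ (slice A i).mulVec z

/-- The vectors `p`, `q` and the last three vectors of the permuted standard basis. -/
def frameVec (p q : Fin 5 → K) (σ : Equiv.Perm (Fin 5)) : Fin (2 + 3) → Fin 5 → K :=
  Fin.append ![p, q] fun j : Fin 3 => Pi.single (σ (Fin.natAdd 2 j)) 1

/-- The matrix with the columns `frameVec p q σ`. -/
def frame (p q : Fin 5 → K) (σ : Equiv.Perm (Fin 5)) : Matrix (Fin 5) (Fin 5) K :=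
  Matrix.of fun l m => frameVec p q σ m l

/-- Generators of the net of quadrics in a hyperplane of the web `A`. -/
def redSlice (A : Tensor K) (τ : Equiv.Perm (Fin 4)) (r : Fin 3 → K) (i : Fin 3) :
    Matrix (Fin 5) (Fin 5) K :=
  slice A (τ i.castSucc) - r i • slice A (τ 3)

/-- The mixed coefficients of the net in the frame. -/
def netN (A : Tensor K) (p q : Fin 5 → K) (σ : Equiv.Perm (Fin 5)) (τ : Equiv.Perm (Fin 4))
    (r : Fin 3 → K) : Fin 3 → Fin 2 → Fin 3 → K :=
  fun i γ j => ∑ l, ![p, q] γ l *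
    (A (τ i.castSucc) s(l, σ (Fin.natAdd 2 j)) - r i * A (τ 3) s(l, σ (Fin.natAdd 2 j)))

/-- The coefficients of the net in the last three vectors of the frame. -/
def netS (A : Tensor K) (σ : Equiv.Perm (Fin 5)) (τ : Equiv.Perm (Fin 4)) (r : Fin 3 → K) :
    Fin 3 → Sym2 (Fin 3) → K :=
  fun i s => A (τ i.castSucc) (s.map fun j => σ (Fin.natAdd 2 j)) -
    r i * A (τ 3) (s.map fun j => σ (Fin.natAdd 2 j))

theorem slice_isSymm {K : Type*} (A : Tensor K) (i : Fin 4) : (slice A i).IsSymm := by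
  ext j l
  simp [slice, Sym2.eq_swap]

theorem redSlice_isSymm (A : Tensor K) (τ : Equiv.Perm (Fin 4)) (r : Fin 3 → K) (i : Fin 3) :
    (redSlice A τ r i).IsSymm :=
  (slice_isSymm A _).sub ((slice_isSymm A _).smul _)

theorem transpose_mul_mul_frame (M : Matrix (Fin 5) (Fin 5) K) (p q : Fin 5 → K)
    (σ : Equiv.Perm (Fin 5)) (m m' : Fin 5) :
    ((frame p q σ).transpose * M * frame p q σ) m m' =
      frameVec p q σ m ⬝ᵥ M.mulVec (frameVec p q σ m') := by
  rw [Matrix.mul_assoc, Matrix.mul_apply_eq_vecMul]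
  simp [Matrix.mul_apply, dotProduct, Matrix.mulVec, frame, Matrix.vecMul]

theorem frame_conj_apply_left_right (A : Tensor K) (p q : Fin 5 → K) (σ : Equiv.Perm (Fin 5))
    (τ : Equiv.Perm (Fin 4)) (r : Fin 3 → K) (i : Fin 3) (γ : Fin 2) (j : Fin 3) :
    ((frame p q σ).transpose * redSlice A τ r i * frame p q σ) (Fin.castAdd 3 γ) (Fin.natAdd 2 j) =
      netN A p q σ τ r i γ j := by
  rw [transpose_mul_mul_frame, frameVec, Fin.append_left, Fin.append_right]
  simp [dotProduct, netN, redSlice, slice]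

theorem frame_conj_apply_right_right (A : Tensor K) (p q : Fin 5 → K) (σ : Equiv.Perm (Fin 5))
    (τ : Equiv.Perm (Fin 4)) (r : Fin 3 → K) (i : Fin 3) (j l : Fin 3) :
    ((frame p q σ).transpose * redSlice A τ r i * frame p q σ) (Fin.natAdd 2 j) (Fin.natAdd 2 l) =
      netS A σ τ r i s(j, l) := by
  rw [transpose_mul_mul_frame, frameVec, Fin.append_right, Fin.append_right]
  simp [netS, redSlice, slice]

theorem frame_conj_symm {M : Matrix (Fin 5) (Fin 5) K} (hM : M.IsSymm) (p q : Fin 5 → K)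
    (σ : Equiv.Perm (Fin 5)) :
    ((frame p q σ).transpose * M * frame p q σ).IsSymm := by
  rw [Matrix.IsSymm, Matrix.transpose_mul, Matrix.transpose_mul, hM, Matrix.transpose_transpose,
    Matrix.mul_assoc]

theorem polar_comm (A : Tensor K) (y y' : Fin 5 → K) : polar A y y' = polar A y' y := by
  ext i
  rw [polar, polar, Matrix.dotProduct_mulVec, dotProduct_comm, ← Matrix.mulVec_transpose,
    slice_isSymm]

/-- The points p and q are isotropic for every slice, and r is chosen so that the mixed term at (p,
q) cancels. Every quadric of the net therefore contains the secant. -/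
theorem frame_conj_apply_left_left {A : Tensor K} {p q : Fin 5 → K} (σ : Equiv.Perm (Fin 5))
    {τ : Equiv.Perm (Fin 4)} {r : Fin 3 → K} (hp : quadrics A p = 0) (hq : quadrics A q = 0)
    (hr : ∀ i : Fin 3, r i * polar A p q (τ 3) = polar A p q (τ i.castSucc)) (i : Fin 3)
    (γ δ : Fin 2) :
    ((frame p q σ).transpose * redSlice A τ r i * frame p q σ) (Fin.castAdd 3 γ) (Fin.castAdd 3 δ) =
      0 := by
  rw [transpose_mul_mul_frame, frameVec, Fin.append_left, Fin.append_left, redSlice,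
    Matrix.sub_mulVec, Matrix.smul_mulVec, dotProduct_sub, dotProduct_smul]
  change polar A _ _ _ - r i • polar A _ _ _ = 0
  have h1 : polar A p p = 0 := hp
  have h2 : polar A q q = 0 := hq
  fin_cases γ <;> fin_cases δ <;> simp [h1, h2, ← hr, polar_comm A q p]

/-- The last three columns vanish in the rows σ 0 and σ 1, so the minor in these rows kills the
first two coordinates of a kernel vector; the other rows then kill the rest. -/
theorem frame_det_ne_zero {p q : Fin 5 → K} {σ : Equiv.Perm (Fin 5)}
    (h : p (σ 0) * q (σ 1) - p (σ 1) * q (σ 0) ≠ 0) : (frame p q σ).det ≠ 0 := by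
  intro h0
  obtain ⟨u, hu, hu0⟩ := Matrix.exists_mulVec_eq_zero_iff.2 h0
  have key : ∀ l, p l * u 0 + q l * u 1 + ∑ j : Fin 3,
      (Pi.single (σ (Fin.natAdd 2 j)) 1 : Fin 5 → K) l * u (Fin.natAdd 2 j) = 0 := by
    intro l
    have := congrFun hu0 l
    simp only [Matrix.mulVec, dotProduct, frame, Matrix.of_apply, frameVec] at this
    have h5 := Fin.sum_univ_add (a := 2) (b := 3) fun m : Fin (2 + 3) =>
      (Fin.append ![p, q] fun j : Fin 3 => Pi.single (σ (Fin.natAdd 2 j)) (1 : K)) m l * u m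
    rw [Fin.sum_univ_two] at h5
    simp only [Fin.append_left, Fin.append_right] at h5
    exact h5.symm.trans this
  have k0 : p (σ 0) * u 0 + q (σ 0) * u 1 = 0 := by
    have := key (σ 0)
    rwa [Finset.sum_eq_zero, add_zero] at this
    intro j _
    rw [Pi.single_eq_of_ne, zero_mul]
    rw [Ne, σ.injective.eq_iff]
    revert j; decide
  have k1 : p (σ 1) * u 0 + q (σ 1) * u 1 = 0 := by
    have := key (σ 1)
    rwa [Finset.sum_eq_zero, add_zero] at this
    intro j _
    rw [Pi.single_eq_of_ne, zero_mul]
    rw [Ne, σ.injective.eq_iff]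
    revert j; decide
  have u0 : u 0 = 0 := by
    have : (p (σ 0) * q (σ 1) - p (σ 1) * q (σ 0)) * u 0 = 0 := by
      linear_combination q (σ 1) * k0 - q (σ 0) * k1
    exact (mul_eq_zero.1 this).resolve_left h
  have u1 : u 1 = 0 := by
    have : (p (σ 0) * q (σ 1) - p (σ 1) * q (σ 0)) * u 1 = 0 := by
      linear_combination p (σ 0) * k1 - p (σ 1) * k0
    exact (mul_eq_zero.1 this).resolve_left h
  apply hu
  have k2 : ∀ j : Fin 3, u (Fin.natAdd 2 j) = 0 := by
    intro j
    have := key (σ (Fin.natAdd 2 j))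
    rw [u0, u1, mul_zero, mul_zero, add_zero, zero_add, Finset.sum_eq_single j] at this
    · simpa using this
    · intro l _ hl
      rw [Pi.single_eq_of_ne, zero_mul]
      rw [Ne, σ.injective.eq_iff]
      exact fun h => hl (Fin.natAdd_injective _ _ h).symm
    · simp
  ext m
  refine Fin.addCases (m := 2) (n := 3) (motive := fun m => u m = 0) ?_ k2 m
  intro γ
  fin_cases γ
  · exact u0
  · exact u1

theorem det_mem {k F n : Type*} [Field k] [Field F] [Algebra k F] [Fintype n] [DecidableEq n]
    (E : IntermediateField k F) {G : Matrix n n F} (hG : ∀ i j, G i j ∈ E) : G.det ∈ E := by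
  rw [Matrix.det_apply]
  exact sum_mem fun σ _ => zsmul_mem (prod_mem fun i _ => hG _ _) _

theorem inv_apply_mem {k F n : Type*} [Field k] [Field F] [Algebra k F] [Fintype n] [DecidableEq n]
    (E : IntermediateField k F) {G : Matrix n n F} (hG : ∀ i j, G i j ∈ E) (i j : n) :
    G⁻¹ i j ∈ E := by
  rw [Matrix.inv_def, Matrix.smul_apply, Ring.inverse_eq_inv', smul_eq_mul]
  refine mul_mem (inv_mem (det_mem E hG)) ?_
  rw [Matrix.adjugate_apply]
  refine det_mem E fun a b => ?_
  by_cases h : a = j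
  · subst h
    rw [Matrix.updateRow_self]
    by_cases h' : b = i
    · subst h'; simp
    · simp [Pi.single_eq_of_ne h']
  · rw [Matrix.updateRow_ne h]; exact hG a b

theorem mul_apply_mem {k F n : Type*} [Field k] [Field F] [Algebra k F] [Fintype n]
    (E : IntermediateField k F) {G H : Matrix n n F} (hG : ∀ i j, G i j ∈ E)
    (hH : ∀ i j, H i j ∈ E) (i j : n) : (G * H) i j ∈ E := by
  rw [Matrix.mul_apply]
  exact sum_mem fun l _ => mul_mem (hG _ _) (hH _ _)

theorem mem_of_conj_mem {k F n : Type*} [Field k] [Field F] [Algebra k F] [Fintype n]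
    [DecidableEq n] (E : IntermediateField k F) {G M : Matrix n n F} (hG : ∀ i j, G i j ∈ E)
    (hdet : G.det ≠ 0) (hM : ∀ i j, (G.transpose * M * G) i j ∈ E) (i j : n) : M i j ∈ E := by
  have hu : IsUnit G.det := isUnit_iff_ne_zero.2 hdet
  have : M = G⁻¹.transpose * (G.transpose * M * G) * G⁻¹ := by
    rw [Matrix.mul_assoc G.transpose, ← Matrix.mul_assoc G⁻¹.transpose, ← Matrix.transpose_mul,
      Matrix.mul_nonsing_inv _ hu, Matrix.transpose_one, Matrix.one_mul,
      Matrix.mul_nonsing_inv_cancel_right _ _ hu]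
  rw [this]
  exact mul_apply_mem E (mul_apply_mem E (fun i j => inv_apply_mem E hG j i) hM)
    (inv_apply_mem E hG) i j

/-- The coordinates of a tensor together with two points of its Cayley variety, in a frame. -/
noncomputable def pairCoords (A : Tensor K) (p q : Fin 5 → K) (a b : Fin 5) (σ : Equiv.Perm (Fin 5))
    (τ : Equiv.Perm (Fin 4)) (r : Fin 3 → K) :
    (({j : Fin 5 // j ≠ a} ⊕ {j : Fin 5 // j ≠ b}) ⊕ (Fin 3 ⊕
      {s : Sym2 (Fin 5) // s ≠ s(0, 0) ∧ s ≠ s(1, 1)})) ⊕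
      ((Fin 3 × Fin 2 × Fin 3) ⊕ (Fin 3 × Sym2 (Fin 3))) → K :=
  Sum.elim (Sum.elim (Sum.elim (fun j => p j) fun j => q j) (Sum.elim r fun s =>
    ((frame p q σ).transpose * slice A (τ 3) * frame p q σ) s.1.out.1 s.1.out.2))
    (netCoeffs (netN A p q σ τ r) (netS A σ τ r))

/-- Over a generic tensor, the net attached to any pair of points of the Cayley variety has
algebraically independent coefficients. -/
theorem algebraicIndependent_netCoeffs {k F : Type*} [Field k] [Field F] [Algebra k F]
    {A : Tensor F} (hA : AlgebraicIndependent k fun s : Fin 4 × Sym2 (Fin 5) => A s.1 s.2)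
    {p q : Fin 5 → F} {a b : Fin 5} {σ : Equiv.Perm (Fin 5)} {τ : Equiv.Perm (Fin 4)}
    {r : Fin 3 → F} (hp : quadrics A p = 0) (hq : quadrics A q = 0) (ha : p a = 1) (hb : q b = 1)
    (hpq : p (σ 0) * q (σ 1) - p (σ 1) * q (σ 0) ≠ 0)
    (hr : ∀ i : Fin 3, r i * polar A p q (τ 3) = polar A p q (τ i.castSucc)) :
    AlgebraicIndependent k (netCoeffs (netN A p q σ τ r) (netS A σ τ r)) := by
  suffices h : AlgebraicIndependent k (pairCoords A p q a b σ τ r) from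
    h.comp Sum.inr Sum.inr_injective
  apply algebraicIndependent_of_mem_adjoin hA
  -- Coordinates of p and q: 4 + 4; ratios: 3; entries of the last slice: 13; coefficients of the
  -- net: 18 + 18. The total is 60, the number of entries of A.
  · clear * -
    have h5 : ∀ c : Fin 5, Fintype.card {j : Fin 5 // j ≠ c} = 4 := by decide
    have h6 : Fintype.card {s : Sym2 (Fin 5) // s ≠ s(0, 0) ∧ s ≠ s(1, 1)} = 13 := by decide
    have h7 : Fintype.card (Sym2 (Fin 3)) = 6 := by decide
    have h8 : Fintype.card (Sym2 (Fin 5)) = 15 := by decide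
    simp only [Fintype.card_sum, Fintype.card_prod, Fintype.card_fin, h5, h6, h7, h8]
    norm_num
  set E := IntermediateField.adjoin k (Set.range (pairCoords A p q a b σ τ r))
  have hE : ∀ i, pairCoords A p q a b σ τ r i ∈ E := fun i =>
    IntermediateField.subset_adjoin _ _ ⟨i, rfl⟩
  have hpE : ∀ j, p j ∈ E := fun j => by
    by_cases hj : j = a
    · rw [hj, ha]; exact one_mem E
    · exact hE (Sum.inl (Sum.inl (Sum.inl ⟨j, hj⟩)))
  have hqE : ∀ j, q j ∈ E := fun j => by
    by_cases hj : j = b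
    · rw [hj, hb]; exact one_mem E
    · exact hE (Sum.inl (Sum.inl (Sum.inr ⟨j, hj⟩)))
  have hrE : ∀ j, r j ∈ E := fun j => hE (Sum.inl (Sum.inr (Sum.inl j)))
  have hNE : ∀ i γ j, netN A p q σ τ r i γ j ∈ E := fun i γ j => hE (Sum.inr (Sum.inl (i, γ, j)))
  have hSE : ∀ i s, netS A σ τ r i s ∈ E := fun i s => hE (Sum.inr (Sum.inr (i, s)))
  have hG : ∀ l m, frame p q σ l m ∈ E := by
    intro l m
    refine Fin.addCases (m := 2) (n := 3) (motive := fun m => frame p q σ l m ∈ E) ?_ ?_ m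
    · intro γ
      simp only [frame, frameVec, Matrix.of_apply]
      rw [Fin.append_left]
      fin_cases γ
      · exact hpE l
      · exact hqE l
    · intro j
      simp only [frame, frameVec, Matrix.of_apply]
      rw [Fin.append_right]
      by_cases h : l = σ (Fin.natAdd 2 j)
      · rw [h, Pi.single_eq_same]; exact one_mem E
      · rw [Pi.single_eq_of_ne h]; exact zero_mem E
  have hdet := frame_det_ne_zero hpq
  have h3 : ∀ l m, slice A (τ 3) l m ∈ E := by
    apply mem_of_conj_mem E hG hdet
    have hsymm := frame_conj_symm (slice_isSymm A (τ 3)) p q σ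
    -- The two entries of the conjugated slice missing from `pairCoords` vanish because p and q lie
    -- on the quadric.
    have h00 : ((frame p q σ).transpose * slice A (τ 3) * frame p q σ) 0 0 = 0 := by
      rw [transpose_mul_mul_frame]
      exact congrFun hp (τ 3)
    have h11 : ((frame p q σ).transpose * slice A (τ 3) * frame p q σ) 1 1 = 0 := by
      rw [transpose_mul_mul_frame]
      exact congrFun hq (τ 3)
    intro m m'
    by_cases h0 : s(m, m') = s(0, 0)
    · obtain ⟨rfl, rfl⟩ : m = 0 ∧ m' = 0 := by simpa using h0
      rw [h00]; exact zero_mem E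
    by_cases h1 : s(m, m') = s(1, 1)
    · obtain ⟨rfl, rfl⟩ : m = 1 ∧ m' = 1 := by simpa using h1
      rw [h11]; exact zero_mem E
    have := hE (Sum.inl (Sum.inr (Sum.inr ⟨s(m, m'), h0, h1⟩)))
    simp only [pairCoords, Sum.elim_inl, Sum.elim_inr] at this
    have hout : s((s(m, m')).out.1, (s(m, m')).out.2) = s(m, m') := Quot.out_eq _
    rcases Sym2.eq_iff.1 hout with ⟨e1, e2⟩ | ⟨e1, e2⟩
    · rwa [e1, e2] at this
    · rw [e1, e2] at this
      rwa [← hsymm.apply]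
  have hred : ∀ i l m, redSlice A τ r i l m ∈ E := by
    intro i
    apply mem_of_conj_mem E hG hdet
    intro m m'
    refine Fin.addCases (m := 2) (n := 3) (motive := fun m => ((frame p q σ).transpose *
      redSlice A τ r i * frame p q σ) m m' ∈ E) ?_ ?_ m
    · intro γ
      refine Fin.addCases (m := 2) (n := 3) (motive := fun m' => ((frame p q σ).transpose *
        redSlice A τ r i * frame p q σ) (Fin.castAdd 3 γ) m' ∈ E) ?_ ?_ m'
      · intro δ
        rw [frame_conj_apply_left_left σ hp hq hr]; exact zero_mem E
      · intro j
        rw [frame_conj_apply_left_right]; exact hNE i γ j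
    · intro j
      refine Fin.addCases (m := 2) (n := 3) (motive := fun m' => ((frame p q σ).transpose *
        redSlice A τ r i * frame p q σ) (Fin.natAdd 2 j) m' ∈ E) ?_ ?_ m'
      · intro δ
        rw [← (frame_conj_symm (redSlice_isSymm A τ r i) p q σ).apply,
          frame_conj_apply_left_right]; exact hNE i δ j
      · intro l
        rw [frame_conj_apply_right_right]; exact hSE i _
  have hall : ∀ i l m, slice A (τ i) l m ∈ E := by
    intro i l m
    refine Fin.lastCases (motive := fun i => slice A (τ i) l m ∈ E) (h3 l m) ?_ i
    intro i
    have : slice A (τ i.castSucc) l m = redSlice A τ r i l m + r i * slice A (τ 3) l m := by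
      simp [redSlice]
    rw [this]
    exact add_mem (hred i l m) (mul_mem (hrE i) (h3 l m))
  rintro ⟨i, s⟩
  induction s with
  | h l m =>
    have := hall (τ.symm i) l m
    rwa [Equiv.apply_symm_apply] at this

end Frame

/-! ### Specialisation along a valuation ring -/

section Place

variable {k F : Type*} [Field k] [Field F] [Algebra k F]

/-- A valuation ring of `F` with a residue homomorphism sending algebraically independent
elements to prescribed values. -/
theorem exists_place {ι : Type*} {a : ι → F} (ha : AlgebraicIndependent k a) (a₀ : ι → k) :
    ∃ (O : ValuationSubring F) (ρ₀ : k →+* IsLocalRing.ResidueField O) (a' : ι → O),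
      (∀ i, (a' i : F) = a i) ∧ ∀ i, IsLocalRing.residue O (a' i) = ρ₀ (a₀ i) := by
  -- Independence makes evaluation at a₀ well defined on the algebra generated by a. The valuation
  -- ring is chosen so that the kernel of this evaluation consists of nonunits.
  let φ : Algebra.adjoin k (Set.range a) →ₐ[k] k :=
    (aeval a₀).comp (ha.aevalEquiv.symm : Algebra.adjoin k (Set.range a) →ₐ[k] MvPolynomial ι k)
  obtain ⟨O, hO, hI⟩ := Ideal.image_subset_nonunits_valuationSubring
    (A := (Algebra.adjoin k (Set.range a)).toSubring) (RingHom.ker φ.toRingHom)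
    (RingHom.ker_ne_top _)
  let jO : k →+* O := (Subring.inclusion hO).comp
    (algebraMap k (Algebra.adjoin k (Set.range a)))
  let a' : ι → O := fun i => Subring.inclusion hO ⟨a i, Algebra.subset_adjoin ⟨i, rfl⟩⟩
  refine ⟨O, (IsLocalRing.residue O).comp jO, a', fun i => rfl, fun i => ?_⟩
  rw [RingHom.comp_apply, ← sub_eq_zero, ← map_sub, IsLocalRing.residue_eq_zero_iff]
  have hφ : φ ⟨a i, Algebra.subset_adjoin ⟨i, rfl⟩⟩ = a₀ i := by
    have : ha.aevalEquiv (X i) = ⟨a i, Algebra.subset_adjoin ⟨i, rfl⟩⟩ := by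
      ext; simp
    rw [← this]
    simp [φ]
  have hmem := hI ⟨(⟨a i, Algebra.subset_adjoin ⟨i, rfl⟩⟩ : Algebra.adjoin k (Set.range a)) -
      algebraMap k (Algebra.adjoin k (Set.range a)) (a₀ i), by
    change φ _ = 0
    rw [map_sub, hφ, AlgHom.commutes, Algebra.algebraMap_self, RingHom.id_apply, sub_self], rfl⟩
  have := ValuationSubring.coe_mem_nonunits_iff (A := O) (a := a' i - jO (a₀ i))
  exact this.1 hmem

/-- A nonzero vector can be scaled to a primitive vector over a valuation ring. -/
theorem exists_primitive_smul (O : ValuationSubring F) {n : ℕ} {v : Fin n → F} (hv : v ≠ 0) :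
    ∃ c : F, c ≠ 0 ∧ ∃ v' : Fin n → O, (∀ i, (v' i : F) = c * v i) ∧ ∃ j, v' j = 1 := by
  obtain ⟨j₀, hj₀⟩ := Function.ne_iff.1 hv
  have : Nonempty (Fin n) := ⟨j₀⟩
  -- Division by a coordinate of maximal valuation makes all coordinates integral and this one equal
  -- to 1.
  obtain ⟨j, hj⟩ := Finite.exists_max fun i => O.valuation (v i)
  have hvj : v j ≠ 0 := by
    intro h
    have := hj j₀
    rw [h, map_zero, le_zero_iff, map_eq_zero] at this
    exact hj₀ this
  have hmem : ∀ i, (v j)⁻¹ * v i ∈ O := fun i => by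
    rw [← O.valuation_le_one_iff, map_mul, map_inv₀]
    rw [inv_mul_le_iff₀ (zero_lt_iff.2 ((map_ne_zero _).2 hvj)), mul_one]
    exact hj i
  refine ⟨(v j)⁻¹, inv_ne_zero hvj, fun i => ⟨_, hmem i⟩, fun i => rfl, j, ?_⟩
  exact Subtype.ext (inv_mul_cancel₀ hvj)

end Place

/-! ### Reduction to the web y_i² - y_4²: reducedness and the bound 16 -/

section Fermat

/-- The web of quadrics spanned by `y_i² - y_4²`. -/
def fermatTensor (k : Type*) [Field k] : Tensor k := fun i s =>
  if s = s(i.castSucc, i.castSucc) then 1 else if s = s(4, 4) then -1 else 0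

theorem sum_fermatTensor {k R : Type*} [Field k] [CommRing R] (φ : k →+* R) (i : Fin 4)
    (l : Fin 5) (y : Fin 5 → R) :
    ∑ m, φ (fermatTensor k i s(l, m)) * y m =
      (if l = i.castSucc then y l else 0) - if l = 4 then y l else 0 := by
  have : ∀ m, φ (fermatTensor k i s(l, m)) = (if l = i.castSucc ∧ m = l then 1 else 0) -
      (if l = 4 ∧ m = l then 1 else 0) := by
    intro m
    have h1 : (s(l, m) = s(i.castSucc, i.castSucc)) ↔ (l = i.castSucc ∧ m = l) := by
      simp only [Sym2.eq_iff]
      constructor <;> [rintro (⟨rfl, rfl⟩ | ⟨rfl, rfl⟩); rintro ⟨rfl, rfl⟩] <;> simp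
    have h2 : (s(l, m) = s(4, 4)) ↔ (l = 4 ∧ m = l) := by
      simp only [Sym2.eq_iff]
      constructor <;> [rintro (⟨rfl, rfl⟩ | ⟨rfl, rfl⟩); rintro ⟨rfl, rfl⟩] <;> simp
    have h3 : i.castSucc ≠ 4 := Fin.castSucc_ne_last i
    simp only [fermatTensor, h1, h2]
    split_ifs with h h' h'
    · exact absurd (h.1.symm.trans h'.1) h3
    · simp
    · simp
    · simp
  simp only [this, sub_mul, Finset.sum_sub_distrib, ite_mul, one_mul, zero_mul]
  congr 1
  · split_ifs with h <;> simp [h]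
  · split_ifs with h <;> simp [h]

variable {k F : Type*} [Field k] [Field F] {A : Tensor F}

theorem polar_apply {K : Type*} [Field K] (A : Tensor K) (y y' : Fin 5 → K) (i : Fin 4) :
    polar A y y' i = ∑ l, y l * ∑ m, A i s(l, m) * y' m := rfl

theorem contract_mulVec_apply {K : Type*} [Field K] (A : Tensor K) (x : Fin 4 → K)
    (y : Fin 5 → K) (l : Fin 5) :
    (contract A x).mulVec y l = ∑ i, x i * ∑ m, A i s(l, m) * y m := by
  rw [contract, Matrix.sum_mulVec]
  simp [slice, Matrix.mulVec, dotProduct, Finset.mul_sum, mul_assoc]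

variable {O : ValuationSubring F} {ρ₀ : k →+* IsLocalRing.ResidueField O}
  {a' : Fin 4 × Sym2 (Fin 5) → O}

/-- In the residue field the i-th bilinear form becomes y_i y'_i - y_4 y'_4. -/
theorem residue_mul_eq_of_polar_eq_zero (ha' : ∀ i, (a' i : F) = A i.1 i.2)
    (hρ : ∀ i, IsLocalRing.residue O (a' i) = ρ₀ (fermatTensor k i.1 i.2)) {y y' : Fin 5 → O}
    (h : polar A (fun j => y j) (fun j => y' j) = 0) (i : Fin 4) :
    IsLocalRing.residue O (y i.castSucc) * IsLocalRing.residue O (y' i.castSucc) =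
      IsLocalRing.residue O (y 4) * IsLocalRing.residue O (y' 4) := by
  have h0 := congrFun h i
  have h1 : ∑ l, y l * ∑ m, a' (i, s(l, m)) * y' m = 0 := by
    apply Subtype.ext
    rw [polar_apply] at h0
    push_cast
    simpa only [ha', Pi.zero_apply] using h0
  have h2 := congrArg (IsLocalRing.residue O) h1
  simp only [map_sum, map_mul, map_zero, hρ] at h2
  simp only [sum_fermatTensor, mul_sub, Finset.sum_sub_distrib] at h2
  simpa [sub_eq_zero] using h2

theorem residue_mul_eq_zero_of_mulVec_eq_zero (ha' : ∀ i, (a' i : F) = A i.1 i.2)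
    (hρ : ∀ i, IsLocalRing.residue O (a' i) = ρ₀ (fermatTensor k i.1 i.2)) {x : Fin 4 → O}
    {y : Fin 5 → O} (h : (contract A (fun j => x j)).mulVec (fun j => y j) = 0) (i : Fin 4) :
    IsLocalRing.residue O (x i) * IsLocalRing.residue O (y i.castSucc) = 0 := by
  have h0 := congrFun h i.castSucc
  have h1 : ∑ i', x i' * ∑ m, a' (i', s(i.castSucc, m)) * y m = 0 := by
    apply Subtype.ext
    rw [contract_mulVec_apply] at h0
    push_cast
    simpa only [ha', Pi.zero_apply] using h0
  have h2 := congrArg (IsLocalRing.residue O) h1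
  simp only [map_sum, map_mul, map_zero, hρ] at h2
  have h3 : i.castSucc ≠ 4 := Fin.castSucc_ne_last i
  simpa [sum_fermatTensor, h3] using h2

theorem polar_smul_smul {K : Type*} [Field K] (A : Tensor K) (c d : K) (y y' : Fin 5 → K) :
    polar A (c • y) (d • y') = (c * d) • polar A y y' := by
  ext i
  simp [polar, Matrix.mulVec_smul, mul_assoc, mul_left_comm]

theorem contract_smul {K : Type*} [Field K] (A : Tensor K) (c : K) (x : Fin 4 → K) :
    contract A (c • x) = c • contract A x := by
  simp [contract, Finset.smul_sum, mul_smul]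

/-- For a primitive representative y_i² = y_4² in the residue field. If y_4 reduced to zero, every
coordinate would, so y_4 is a unit. -/
theorem exists_unimodular_smul (ha' : ∀ i, (a' i : F) = A i.1 i.2)
    (hρ : ∀ i, IsLocalRing.residue O (a' i) = ρ₀ (fermatTensor k i.1 i.2)) {p : Fin 5 → F}
    (hp0 : p ≠ 0) (hp : quadrics A p = 0) :
    ∃ c : F, c ≠ 0 ∧ ∃ v : Fin 5 → O, (∀ i, (v i : F) = c * p i) ∧ v 4 = 1 := by
  obtain ⟨c, hc, v, hv, j, hj⟩ := exists_primitive_smul O hp0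
  have hvp : (fun j => (v j : F)) = c • p := funext hv
  have hpol : polar A (fun j => (v j : F)) (fun j => v j) = 0 := by
    rw [hvp, polar_smul_smul, show polar A p p = 0 from hp, smul_zero]
  have h1 := residue_mul_eq_of_polar_eq_zero ha' hρ hpol
  have h4 : IsLocalRing.residue O (v 4) ≠ 0 := by
    intro h0
    have h2 : IsLocalRing.residue O (v j) ≠ 0 := by rw [hj, map_one]; exact one_ne_zero
    induction j using Fin.lastCases with
    | last => exact h2 h0
    | cast i =>
      have := h1 i
      rw [h0, zero_mul] at this
      exact h2 (mul_self_eq_zero.1 this)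
  have hu : IsUnit (v 4) := (IsLocalRing.residue_ne_zero_iff_isUnit _).1 h4
  obtain ⟨u, hu⟩ := hu
  refine ⟨((u⁻¹ : Oˣ) : O) * c, mul_ne_zero ?_ hc, fun i => (u⁻¹ : Oˣ) * v i, fun i => ?_, ?_⟩
  · intro h
    exact (u⁻¹).ne_zero (Subtype.ext h)
  · push_cast; rw [hv, mul_assoc]
  · simp [← hu]

theorem castSucc_or_last (j : Fin 5) : j = 4 ∨ ∃ i : Fin 4, j = i.castSucc := by
  induction j using Fin.lastCases with
  | last => left; rfl
  | cast i => right; exact ⟨i, rfl⟩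

/-- The Cayley variety of a generic tensor is reduced. -/
theorem eq_zero_of_mulVec_eq_zero_of_generic [Algebra k F]
    (hA : AlgebraicIndependent k fun s : Fin 4 × Sym2 (Fin 5) => A s.1 s.2) {p : Fin 5 → F}
    (hp0 : p ≠ 0) (hp : quadrics A p = 0) {x : Fin 4 → F} (hx : (contract A x).mulVec p = 0) :
    x = 0 := by
  by_contra hx0
  obtain ⟨O, ρ₀, a', ha', hρ⟩ := exists_place hA fun s => fermatTensor k s.1 s.2
  obtain ⟨c, hc, v, hv, hv4⟩ := exists_unimodular_smul ha' hρ hp0 hp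
  obtain ⟨d, hd, z, hz, j, hj⟩ := exists_primitive_smul O hx0
  have hvp : (fun j => (v j : F)) = c • p := funext hv
  have hzx : (fun j => (z j : F)) = d • x := funext hz
  -- At the coordinate j with z_j = 1 the residues satisfy v_j² = v_4² = 1 and also z_j v_j = 0, a
  -- contradiction.
  have h1 := residue_mul_eq_of_polar_eq_zero ha' hρ (y := v) (y' := v) (by
    rw [hvp, polar_smul_smul, show polar A p p = 0 from hp, smul_zero]) j
  have h2 := residue_mul_eq_zero_of_mulVec_eq_zero ha' hρ (x := z) (y := v) (by
    rw [hvp, hzx, contract_smul, Matrix.smul_mulVec, Matrix.mulVec_smul, hx, smul_zero,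
      smul_zero]) j
  rw [hj, map_one, one_mul] at h2
  rw [h2, hv4, map_one] at h1
  simp at h1

/-- The Cayley variety of a generic tensor has at most 16 points. -/
theorem not_seventeen_of_generic [Algebra k F] (h2 : (2 : k) ≠ 0)
    (hA : AlgebraicIndependent k fun s : Fin 4 × Sym2 (Fin 5) => A s.1 s.2)
    {p : Fin 17 → Fin 5 → F} (hp0 : ∀ j, p j ≠ 0) (hp : ∀ j, quadrics A (p j) = 0)
    (hne : ∀ j l, j ≠ l → ∀ c : F, c • p j ≠ p l) : False := by
  classical
  obtain ⟨O, ρ₀, a', ha', hρ⟩ := exists_place hA fun s => fermatTensor k s.1 s.2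
  choose c hc v hv hv4 using fun j => exists_unimodular_smul ha' hρ (hp0 j) (hp j)
  have hvp : ∀ j, (fun i => (v j i : F)) = c j • p j := fun j => funext (hv j)
  have hpol : ∀ j, polar A (fun i => (v j i : F)) (fun i => v j i) = 0 := fun j => by
    rw [hvp, polar_smul_smul, show polar A (p j) (p j) = 0 from hp j, smul_zero]
  have hsq : ∀ j i, IsLocalRing.residue O (v j (Fin.castSucc i)) = 1 ∨
      IsLocalRing.residue O (v j (Fin.castSucc i)) = -1 := by
    intro j i
    have := residue_mul_eq_of_polar_eq_zero ha' hρ (hpol j) i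
    rw [hv4, map_one, one_mul] at this
    exact mul_self_eq_one_iff.1 this
  -- Each point reduces to one of 16 sign vectors, so two of the 17 have the same reduction.
  obtain ⟨j, l, hjl, hf⟩ := Fintype.exists_ne_map_eq_of_card_lt
    (fun j : Fin 17 => fun i : Fin 4 => decide (IsLocalRing.residue O (v j i.castSucc) = 1))
    (by simp)
  have heq : ∀ i, IsLocalRing.residue O (v j i) = IsLocalRing.residue O (v l i) := by
    intro i
    rcases castSucc_or_last i with rfl | ⟨i, rfl⟩
    · rw [hv4, hv4]
    · have h3 := congrFun hf i
      simp only [decide_eq_decide] at h3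
      rcases hsq j i with h4 | h4 <;> rcases hsq l i with h5 | h5
      · rw [h4, h5]
      · rw [h4, h3.1 h4]
      · rw [h5, h3.2 h5]
      · rw [h4, h5]
  have hd0 : (fun i => (v j i : F) - v l i) ≠ 0 := by
    intro h
    refine hne j l hjl ((c l)⁻¹ * c j) ?_
    have : c j • p j = c l • p l := by
      rw [← hvp, ← hvp]
      ext i
      exact sub_eq_zero.1 (congrFun h i)
    rw [mul_smul, this, smul_smul, inv_mul_cancel₀ (hc l), one_smul]
  -- Let d be the rescaled difference of the two colliding points. Then A(·, d, v_j + v_l) = 0 by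
  -- polarisation, and since d_4 = 0 the reduction reads ±2 d_i = 0 for every i, contradicting
  -- primitivity.
  obtain ⟨e, he, d, hd, m, hm⟩ := exists_primitive_smul O hd0
  have hd4 : d 4 = 0 := Subtype.ext (by rw [hd, hv4, hv4]; simp)
  have hpol2 : polar A (fun i => (d i : F)) (fun i => ((v j + v l) i : O)) = 0 := by
    have e1 : (fun i => (d i : F)) = e • ((fun i => (v j i : F)) - fun i => (v l i : F)) := by
      ext i; simp [hd]
    have e2 : (fun i => (((v j + v l) i : O) : F)) =
        (1 : F) • ((fun i => (v j i : F)) + fun i => (v l i : F)) := by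
      ext i; simp
    rw [e1, e2, polar_smul_smul]
    have e3 := hpol j
    have e4 := hpol l
    have e5 := polar_comm A (fun i => (v j i : F)) (fun i => (v l i : F))
    generalize (fun i => (v j i : F)) = y at *
    generalize (fun i => (v l i : F)) = y' at *
    have : polar A (y - y') (y + y') =
        polar A y y - polar A y' y' + (polar A y y' - polar A y' y) := by
      ext i
      simp only [polar, Matrix.mulVec_add, sub_dotProduct, dotProduct_add, Pi.add_apply,
        Pi.sub_apply]
      ring
    rw [this, e3, e4, e5]; simp
  have h2' : (2 : IsLocalRing.ResidueField O) ≠ 0 := by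
    have := (map_ne_zero ρ₀).2 h2
    rwa [map_ofNat] at this
  rcases castSucc_or_last m with rfl | ⟨i, rfl⟩
  · rw [hd4] at hm; exact zero_ne_one hm
  · have := residue_mul_eq_of_polar_eq_zero ha' hρ hpol2 i
    rw [hm, hd4, map_one, one_mul, map_zero, zero_mul, Pi.add_apply, map_add, heq, ← two_mul,
      mul_eq_zero] at this
    rcases this with h | h
    · exact h2' h
    · rcases hsq l i with h4 | h4 <;> rw [h4] at h <;> simp at h

end Fermat

/-! ### Sixteen points by formal deformation -/

section Hensel

open PowerSeries in
/-- A map that is contracting for the adic topology of a power series ring has a fixed point. -/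
theorem exists_fixedPoint_of_contracting {F ι : Type*} [Field F]
    (Φ : (ι → PowerSeries F) → ι → PowerSeries F)
    (hΦ : ∀ (m : ℕ) z z', (∀ i, (X : PowerSeries F) ^ m ∣ z i - z' i) →
      ∀ i, (X : PowerSeries F) ^ (m + 1) ∣ Φ z i - Φ z' i) : ∃ z, Φ z = z := by
  let u : ℕ → ι → PowerSeries F := fun n => Φ^[n] 0
  have hu : ∀ n, u (n + 1) = Φ (u n) := fun n => Function.iterate_succ_apply' _ _ _
  have h1 : ∀ n i, (X : PowerSeries F) ^ n ∣ u (n + 1) i - u n i := by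
    intro n
    induction n with
    | zero => simp
    | succ n ih => intro i; rw [hu (n + 1), hu n]; exact hΦ n _ _ (by simpa [hu] using ih) i
  have h2 : ∀ n m i, (X : PowerSeries F) ^ n ∣ u (n + m) i - u n i := by
    intro n m i
    induction m with
    | zero => simp
    | succ m ih =>
      have := dvd_add ((pow_dvd_pow (PowerSeries.X : PowerSeries F)
        (Nat.le_add_right n m)).trans (h1 (n + m) i)) ih
      simpa [add_assoc] using this
  -- The n-th coefficient is stable from the iterate n + 1 on, so this is the coefficientwise limit.
  let z : ι → PowerSeries F := fun i => PowerSeries.mk fun n => coeff n (u (n + 1) i)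
  have hz : ∀ n i, (X : PowerSeries F) ^ n ∣ z i - u n i := by
    intro n i
    rw [X_pow_dvd_iff]
    intro m hm
    obtain ⟨d, rfl⟩ := Nat.exists_eq_add_of_lt hm
    have := X_pow_dvd_iff.1 (h2 (m + 1) d i) m (Nat.lt_succ_self m)
    rw [show m + d + 1 = m + 1 + d by ring]
    rw [map_sub] at this ⊢
    simp only [z, coeff_mk]
    linear_combination -this
  refine ⟨z, funext fun i => ?_⟩
  rw [← sub_eq_zero]
  ext m
  have h3 := hΦ m z (u m) (hz m) i
  have h4 := hz (m + 1) i
  rw [hu] at h4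
  have h5 := dvd_sub h3 h4
  rw [sub_sub_sub_cancel_right] at h5
  simpa using X_pow_dvd_iff.1 h5 m (Nat.lt_succ_self m)

/-- A common zero of the deformed quadrics `y_i² - y_4² + X Q_i(y)` lifting a sign vector. -/
theorem exists_zero_of_signs {F : Type*} [Field F] (h2 : (2 : F) ≠ 0)
    (T : Fin 4 × Sym2 (Fin 5) → F) {ε : Fin 4 → F} (hε : ∀ i, ε i * ε i = 1) :
    ∃ y : Fin 5 → PowerSeries F, y 4 = 1 ∧
      (∀ i : Fin 4, PowerSeries.constantCoeff (y i.castSucc) = ε i) ∧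
      ∀ i : Fin 4, y i.castSucc * y i.castSucc - y 4 * y 4 +
        PowerSeries.X * ∑ l, y l * ∑ m, PowerSeries.C (T (i, s(l, m))) * y m = 0 := by
  let Y : (Fin 4 → PowerSeries F) → Fin 5 → PowerSeries F := fun z =>
    Fin.snoc (α := fun _ => PowerSeries F)
      (fun i : Fin 4 => PowerSeries.C (ε i) + PowerSeries.X * z i) 1
  have hY4 : ∀ z, Y z 4 = 1 := fun z => Fin.snoc_last (α := fun _ => PowerSeries F) _ _
  have hYi : ∀ z (i : Fin 4), Y z i.castSucc = PowerSeries.C (ε i) + PowerSeries.X * z i :=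
    fun z i => Fin.snoc_castSucc (α := fun _ => PowerSeries F) _ _ _
  let Q : Fin 4 → (Fin 5 → PowerSeries F) → PowerSeries F := fun i y =>
    ∑ l, y l * ∑ m, PowerSeries.C (T (i, s(l, m))) * y m
  -- With y_i = ε_i + X z_i the equation divided by X is 2 ε_i z_i + X z_i² + Q_i(y) = 0; as ε_i² =
  -- 1 it is solved for z_i by the factor -ε_i/2. The map contracts because y depends on z only
  -- through X z.
  obtain ⟨z, hz⟩ := exists_fixedPoint_of_contracting
    (fun z i => PowerSeries.C (-(ε i) / 2) * (PowerSeries.X * (z i * z i) + Q i (Y z))) (by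
      intro m z z' h i
      have hYY : ∀ l, (PowerSeries.X : PowerSeries F) ^ (m + 1) ∣ Y z l - Y z' l := by
        intro l
        rcases castSucc_or_last l with rfl | ⟨i, rfl⟩
        · simp [hY4]
        · rw [hYi, hYi, add_sub_add_left_eq_sub, ← mul_sub, pow_succ']
          exact mul_dvd_mul_left _ (h i)
      rw [← mul_sub]
      refine Dvd.dvd.mul_left ?_ _
      rw [add_sub_add_comm, ← mul_sub]
      refine dvd_add ?_ ?_
      · rw [pow_succ']
        refine mul_dvd_mul_left _ ?_
        rw [mul_self_sub_mul_self]
        exact Dvd.dvd.mul_left (h i) _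
      · rw [← Ideal.mem_span_singleton, ← Ideal.Quotient.eq]
        have : ∀ l,
            Ideal.Quotient.mk (Ideal.span {(PowerSeries.X : PowerSeries F) ^ (m + 1)}) (Y z l) =
            Ideal.Quotient.mk (Ideal.span {(PowerSeries.X : PowerSeries F) ^ (m + 1)}) (Y z' l) := by
          intro l
          rw [Ideal.Quotient.eq, Ideal.mem_span_singleton]
          exact hYY l
        simp only [Q, map_sum, map_mul, this])
  refine ⟨Y z, hY4 z, fun i => by simp [hYi], fun i => ?_⟩
  have h1 : PowerSeries.C (-(ε i) / 2) * (PowerSeries.X * (z i * z i) + Q i (Y z)) = z i :=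
    congrFun hz i
  rw [hYi, hY4]
  have e1 : PowerSeries.C (ε i) * PowerSeries.C (ε i) = (1 : PowerSeries F) := by
    rw [← map_mul, hε, map_one]
  have e2 : 2 * PowerSeries.C (ε i) * PowerSeries.C (-(ε i) / 2) = (-1 : PowerSeries F) := by
    have : (2 : PowerSeries F) = PowerSeries.C 2 := by rw [map_ofNat]
    rw [this, ← map_mul, ← map_mul, ← map_one PowerSeries.C, ← map_neg]
    congr 1
    field_simp
    rw [sq, hε]
  change _ + PowerSeries.X * Q i (Y z) = 0
  linear_combination e1 + (-2 * PowerSeries.C (ε i) * PowerSeries.X) * h1 +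
    PowerSeries.X * (PowerSeries.X * (z i * z i) + Q i (Y z)) * e2

/-- Translating and scaling the variables by a formal parameter keeps them independent. -/
theorem injective_aeval_C_add_X_mul_C {k ι F : Type*} [Field k] [Field F] [Algebra k F]
    (φ : MvPolynomial ι k →ₐ[k] F) (hφ : Function.Injective φ) (a₀ : ι → k) :
    Function.Injective (aeval (R := k) fun s : ι =>
      (PowerSeries.C (algebraMap k F (a₀ s)) + PowerSeries.X * PowerSeries.C (φ (X s)) :
        PowerSeries F)) := by
  let χ : MvPolynomial ι k →ₐ[k] Polynomial F := aeval fun s =>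
    Polynomial.C (algebraMap k F (a₀ s)) + Polynomial.X * Polynomial.C (φ (X s))
  have h1 : Function.Injective χ := by
    -- Setting the formal parameter to 1 turns χ into φ after a translation of the variables, which
    -- is injective.
    let e : Polynomial F →ₐ[k] F := (Polynomial.aeval (1 : F)).restrictScalars k
    have h2 : e.comp χ = φ.comp (aeval fun s => (C (a₀ s) + X s : MvPolynomial ι k)) := by
      ext s
      simp [e, χ, ← algebraMap_eq]
    have h3 : Function.Injective (aeval (R := k) fun s : ι =>
        (C (a₀ s) + X s : MvPolynomial ι k)) := by
      have : ((aeval (R := k) fun s : ι => (X s - C (a₀ s) : MvPolynomial ι k)).comp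
          (aeval (R := k) fun s : ι => (C (a₀ s) + X s : MvPolynomial ι k))) =
          AlgHom.id k _ := by
        ext s
        simp [algebraMap_eq]
      intro P Q h
      rw [← AlgHom.id_apply (R := k) P, ← this, AlgHom.comp_apply, h, ← AlgHom.comp_apply, this,
        AlgHom.id_apply]
    have h4 : Function.Injective (e.comp χ) := by
      rw [h2]
      exact hφ.comp h3
    exact fun P Q h => h4 (congrArg e h)
  let ψ : Polynomial F →ₐ[k] PowerSeries F :=
    (Polynomial.coeToPowerSeries.algHom F).restrictScalars k
  have hψ : Function.Injective ψ := by
    intro P Q h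
    simpa [ψ, Polynomial.coeToPowerSeries.algHom_apply] using h
  have h5 : (aeval (R := k) fun s : ι => (PowerSeries.C (algebraMap k F (a₀ s)) +
      PowerSeries.X * PowerSeries.C (φ (X s)) : PowerSeries F)) = ψ.comp χ := by
    ext1 s
    simp only [ψ, χ, AlgHom.comp_apply, aeval_X, AlgHom.restrictScalars_apply,
      Polynomial.coeToPowerSeries.algHom_apply, Algebra.algebraMap_self, PowerSeries.map_id,
      Polynomial.coe_add, Polynomial.coe_mul, Polynomial.coe_C, Polynomial.coe_X, id_eq]
  rw [h5]
  exact hψ.comp h1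

/-- The index set of the coordinates of a tensor. -/
abbrev TensorIndex := Fin 4 × Sym2 (Fin 5)

/-- The coordinates and the inverses of chosen differences generate a finitely generated domain over
the polynomial ring, to which evaluations at tensors extend off a hypersurface. The inverses keep
the image points distinct. -/
theorem exists_points_of_solution {k B J : Type*} [Field k] [CommRing B] [IsDomain B] [Finite J]
    [Algebra (MvPolynomial (TensorIndex) k) B]
    (hinj : Function.Injective (algebraMap (MvPolynomial (TensorIndex) k) B))
    (y : J → Fin 5 → B) (hy4 : ∀ e, y e 4 = 1)
    (hy : ∀ e i, ∑ l, y e l * ∑ m, algebraMap (MvPolynomial (TensorIndex) k) B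
      (X (i, s(l, m))) * y e m = 0)
    (hu : ∀ e e', e ≠ e' → ∃ i, IsUnit (y e i - y e' i)) :
    ∃ P : MvPolynomial (TensorIndex) k, P ≠ 0 ∧
      ∀ (K : Type*) [Field K] [IsAlgClosed K] [Algebra k K] (A : Tensor K),
        aeval (fun s : TensorIndex => A s.1 s.2) P ≠ 0 →
          ∃ y : J → Fin 5 → K, Function.Injective y ∧
            ∀ e, y e 4 = 1 ∧ quadrics A (y e) = 0 := by
  let G : J × Fin 5 ⊕ J × J × Fin 5 → B :=
    Sum.elim (fun t => y t.1 t.2) fun t => Ring.inverse (y t.1 t.2.2 - y t.2.1 t.2.2)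
  let S := Algebra.adjoin (MvPolynomial TensorIndex k) (Set.range G)
  have hft : Algebra.FiniteType (MvPolynomial TensorIndex k) S :=
    S.fg_iff_finiteType.1 ⟨(Set.finite_range G).toFinset, by simp [S]⟩
  have hSinj : Function.Injective (algebraMap (MvPolynomial TensorIndex k) S) := by
    intro a b hab
    exact hinj (congrArg (fun s : S => (s : B)) hab)
  obtain ⟨f, hf, H⟩ := exists_ne_zero_forall_exists_extension hSinj
  refine ⟨f, hf, fun K _ _ _ A hA => ?_⟩
  let _ : Algebra (MvPolynomial TensorIndex k) K :=
    (aeval (R := k) fun s : TensorIndex => A s.1 s.2).toRingHom.toAlgebra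
  obtain ⟨g⟩ := H K hA
  let yS : J → Fin 5 → S := fun e j =>
    ⟨y e j, Algebra.subset_adjoin ⟨Sum.inl (e, j), rfl⟩⟩
  refine ⟨fun e j => g (yS e j), ?_, fun e => ⟨?_, ?_⟩⟩
  · intro e e' hee
    by_contra hne
    obtain ⟨i, hi⟩ := hu e e' hne
    let u : S := ⟨Ring.inverse (y e i - y e' i),
      Algebra.subset_adjoin ⟨Sum.inr (e, e', i), rfl⟩⟩
    have h1 : (yS e i - yS e' i) * u = 1 :=
      Subtype.ext (Ring.mul_inverse_cancel _ hi)
    have h3 := congrArg g h1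
    rw [map_mul, map_sub, map_one, show g (yS e i) = g (yS e' i) from
      congrFun hee i, sub_self, zero_mul] at h3
    exact zero_ne_one h3
  · have : yS e 4 = 1 := Subtype.ext (hy4 e)
    simp only [this, map_one]
  · ext i
    have h1 : ∑ l, yS e l *
        ∑ m, algebraMap (MvPolynomial TensorIndex k) S (X (i, s(l, m))) * yS e m = 0 := by
      apply Subtype.ext
      push_cast
      exact hy e i
    have h3 := congrArg g h1
    simp only [map_sum, map_mul, map_zero, AlgHom.commutes] at h3
    have h4 : ∀ s, algebraMap (MvPolynomial TensorIndex k) K (X s) = A s.1 s.2 := fun s =>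
      aeval_X (R := k) (fun s : TensorIndex => A s.1 s.2) s
    simp only [h4] at h3
    exact h3

/-- The sign vectors are zeros of y_i² - y_4² and lift along a deformation in a generic direction.
Two lifts differ in some constant term by ±2, so that difference is a unit. -/
theorem exists_sixteen_points_of_injective {k F : Type*} [Field k] [Field F] [Algebra k F]
    (h2F : (2 : F) ≠ 0) (φ : MvPolynomial TensorIndex k →ₐ[k] F) (hφ : Function.Injective φ) :
    ∃ P : MvPolynomial (TensorIndex) k, P ≠ 0 ∧
      ∀ (K : Type*) [Field K] [IsAlgClosed K] [Algebra k K] (A : Tensor K),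
        aeval (fun s : TensorIndex => A s.1 s.2) P ≠ 0 →
          ∃ y : (Fin 4 → Bool) → Fin 5 → K, Function.Injective y ∧
            ∀ e, y e 4 = 1 ∧ quadrics A (y e) = 0 := by
  let T : TensorIndex → F := fun s => φ (X s)
  have hT := injective_aeval_C_add_X_mul_C φ hφ fun s => fermatTensor k s.1 s.2
  let sg : Bool → F := fun b => if b then 1 else -1
  have hsg : ∀ b, sg b * sg b = 1 := by intro b; cases b <;> simp only [sg] <;> norm_num
  choose y hy4 hy0 hy using fun e : Fin 4 → Bool =>
    exists_zero_of_signs h2F T (ε := fun i => sg (e i)) fun i => hsg _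
  let At : TensorIndex → PowerSeries F := fun s =>
    PowerSeries.C (algebraMap k F (fermatTensor k s.1 s.2)) + PowerSeries.X * PowerSeries.C (T s)
  let _ : Algebra (MvPolynomial (TensorIndex) k) (PowerSeries F) :=
    (aeval (R := k) At).toRingHom.toAlgebra
  have hX : ∀ s, algebraMap (MvPolynomial (TensorIndex) k) (PowerSeries F) (X s) =
    At s := fun s => aeval_X (R := k) At s
  refine exists_points_of_solution hT y hy4 ?_ ?_
  · intro e i
    simp only [hX]
    have h5 : ∀ l, ∑ m, At (i, s(l, m)) * y e m =
        ((if l = i.castSucc then y e l else 0) - if l = 4 then y e l else 0) +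
        PowerSeries.X * ∑ m, PowerSeries.C (T (i, s(l, m))) * y e m := by
      intro l
      rw [← sum_fermatTensor (PowerSeries.C.comp (algebraMap k F)) i l (y e), Finset.mul_sum,
        ← Finset.sum_add_distrib]
      exact Finset.sum_congr rfl fun m _ => by simp only [At, RingHom.comp_apply]; ring
    have h6 : ∑ l, y e l * ∑ m, At (i, s(l, m)) * y e m = y e i.castSucc * y e i.castSucc -
        y e 4 * y e 4 + PowerSeries.X * ∑ l, y e l *
          ∑ m, PowerSeries.C (T (i, s(l, m))) * y e m := by
      simp only [h5, mul_add, Finset.sum_add_distrib, mul_sub, Finset.sum_sub_distrib]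
      congr 1
      · simp
      · rw [Finset.mul_sum]
        exact Finset.sum_congr rfl fun l _ => by ring
    rw [h6]
    exact hy e i
  · intro e e' hne
    obtain ⟨i, hi⟩ := Function.ne_iff.1 hne
    refine ⟨i.castSucc, ?_⟩
    rw [PowerSeries.isUnit_iff_constantCoeff, map_sub, hy0, hy0, isUnit_iff_ne_zero]
    have h11 : (1 : F) + 1 ≠ 0 := by rwa [one_add_one_eq_two]
    have h11' : (-1 : F) - 1 ≠ 0 := by
      rw [← neg_add']; exact neg_ne_zero.2 h11
    cases h : e i <;> cases h' : e' i <;> simp_all [sg]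

/-- A general Cayley variety has at least 16 points. -/
theorem exists_sixteen_points (k : Type*) [Field k] (h2 : (2 : k) ≠ 0) :
    ∃ P : MvPolynomial (TensorIndex) k, P ≠ 0 ∧
      ∀ (K : Type*) [Field K] [IsAlgClosed K] [Algebra k K] (A : Tensor K),
        aeval (fun s : TensorIndex => A s.1 s.2) P ≠ 0 →
          ∃ y : (Fin 4 → Bool) → Fin 5 → K, Function.Injective y ∧
            ∀ e, y e 4 = 1 ∧ quadrics A (y e) = 0 := by
  have h2' := (map_ne_zero
    (algebraMap k (FractionRing (MvPolynomial (TensorIndex) k)))).2 h2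
  rw [map_ofNat] at h2'
  exact exists_sixteen_points_of_injective h2'
    (IsScalarTower.toAlgHom k (MvPolynomial TensorIndex k) _) (IsFractionRing.injective _ _)

end Hensel

/-! ### Homomorphisms from a product of fields -/

section Spread

/-- A pair of points of the Cayley variety, normalised so as to give a frame. -/
structure IsPairFrame {K : Type*} [Field K] (A : Tensor K) (p q : Fin 5 → K) (a b : Fin 5)
    (σ : Equiv.Perm (Fin 5)) (τ : Equiv.Perm (Fin 4)) (r : Fin 3 → K) : Prop where
  left : quadrics A p = 0
  right : quadrics A q = 0
  left_coord : p a = 1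
  right_coord : q b = 1
  minor : p (σ 0) * q (σ 1) - p (σ 1) * q (σ 0) ≠ 0
  ratio : ∀ i : Fin 3, r i * polar A p q (τ 3) = polar A p q (τ i.castSucc)

variable {I : Type*} {K : I → Type*} [∀ P, Field (K P)] {F : Type*} [Field F]
  (θ : (∀ P, K P) →+* F) (A : ∀ P, Tensor (K P))

theorem apply_ne_zero_of_forall {u : ∀ P, K P} (hu : ∀ P, u P ≠ 0) : θ u ≠ 0 := by
  have h1 : u * (fun P => (u P)⁻¹) = 1 := funext fun P => mul_inv_cancel₀ (hu P)
  intro h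
  have h2 := congrArg θ h1
  rw [map_mul, h, zero_mul, map_one] at h2
  exact zero_ne_one h2

/-- Single coordinates may vanish in some factors, but together they generate the unit ideal of the
product, so θ cannot kill them all. -/
theorem vec_ne_zero_of_forall {n : Type*} [Fintype n] {y : ∀ P, n → K P} (hy : ∀ P, y P ≠ 0) :
    (fun j => θ fun P => y P j) ≠ 0 := by
  classical
  choose j hj using fun P => Function.ne_iff.1 (hy P)
  have h1 : ∑ l : n, (fun P => if l = j P then (y P l)⁻¹ else 0) * (fun P => y P l) =
      (1 : ∀ P, K P) := by
    ext P
    simpa [Finset.sum_apply] using inv_mul_cancel₀ (hj P)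
  intro h
  have h2 := congrArg θ h1
  rw [map_sum, map_one] at h2
  rw [Finset.sum_eq_zero] at h2
  · exact zero_ne_one h2
  · intro l _
    rw [map_mul, show θ (fun P => y P l) = 0 from congrFun h l, mul_zero]

theorem polar_map (y y' : ∀ P, Fin 5 → K P) (i : Fin 4) :
    polar (fun i s => θ fun P => A P i s) (fun j => θ fun P => y P j)
      (fun j => θ fun P => y' P j) i = θ fun P => polar (A P) (y P) (y' P) i := by
  simp only [polar_apply, ← map_mul, ← map_sum]
  exact congrArg θ (funext fun P => by simp [Finset.sum_apply])

theorem contract_mulVec_map (x : ∀ P, Fin 4 → K P) (y : ∀ P, Fin 5 → K P) (l : Fin 5) :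
    (contract (fun i s => θ fun P => A P i s) (fun j => θ fun P => x P j)).mulVec
      (fun j => θ fun P => y P j) l = θ fun P => (contract (A P) (x P)).mulVec (y P) l := by
  simp only [contract_mulVec_apply, ← map_mul, ← map_sum]
  exact congrArg θ (funext fun P => by simp [Finset.sum_apply])

theorem quadrics_map_eq_zero {y : ∀ P, Fin 5 → K P} (h : ∀ P, quadrics (A P) (y P) = 0) :
    quadrics (fun i s => θ fun P => A P i s) (fun j => θ fun P => y P j) = 0 := by
  ext i
  refine (polar_map θ A y y i).trans ?_
  have : (fun P => polar (A P) (y P) (y P) i) = 0 := funext fun P => congrFun (h P) i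
  rw [this, map_zero, Pi.zero_apply]

variable {a b : Fin 5} {σ : Equiv.Perm (Fin 5)} {τ : Equiv.Perm (Fin 4)}

theorem IsPairFrame.map {p q : ∀ P, Fin 5 → K P} {r : ∀ P, Fin 3 → K P}
    (h : ∀ P, IsPairFrame (A P) (p P) (q P) a b σ τ (r P)) :
    IsPairFrame (fun i s => θ fun P => A P i s) (fun j => θ fun P => p P j)
      (fun j => θ fun P => q P j) a b σ τ (fun j => θ fun P => r P j) where
  left := quadrics_map_eq_zero θ A fun P => (h P).left
  right := quadrics_map_eq_zero θ A fun P => (h P).right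
  left_coord := by
    rw [← map_one θ]; congr 1; exact funext fun P => (h P).left_coord
  right_coord := by
    rw [← map_one θ]; congr 1; exact funext fun P => (h P).right_coord
  minor := by
    simp only [← map_mul, ← map_sub]
    exact apply_ne_zero_of_forall θ fun P => (h P).minor
  ratio := by
    intro i
    rw [polar_map, polar_map, ← map_mul]
    congr 1
    exact funext fun P => (h P).ratio i

theorem netN_map (p q : ∀ P, Fin 5 → K P) (r : ∀ P, Fin 3 → K P) (i : Fin 3) (γ : Fin 2)
    (j : Fin 3) :
    netN (fun i s => θ fun P => A P i s) (fun j => θ fun P => p P j)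
      (fun j => θ fun P => q P j) σ τ (fun j => θ fun P => r P j) i γ j =
      θ fun P => netN (A P) (p P) (q P) σ τ (r P) i γ j := by
  have h : ∀ l, ![fun j => θ fun P => p P j, fun j => θ fun P => q P j] γ l =
      θ fun P => ![p P, q P] γ l := by
    intro l; fin_cases γ <;> rfl
  simp only [netN, h, ← map_mul, ← map_sub, ← map_sum]
  exact congrArg θ (funext fun P => by simp [Finset.sum_apply])

theorem netS_map (r : ∀ P, Fin 3 → K P) (i : Fin 3) (s : Sym2 (Fin 3)) :
    netS (fun i s => θ fun P => A P i s) σ τ (fun j => θ fun P => r P j) i s =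
      θ fun P => netS (A P) σ τ (r P) i s := by
  simp only [netS, ← map_mul, ← map_sub]
  rfl

end Spread

/-! ### From generic tensors to tensors off a hypersurface -/

section General

variable (k : Type u) [Field k]

/-- Outside a hypersurface, the Cayley variety is reduced. -/
theorem exists_forall_reduced :
    ∃ P : MvPolynomial TensorIndex k, P ≠ 0 ∧
      ∀ (K : Type w) [Field K] [IsAlgClosed K] [Algebra k K] (A : Tensor K),
        aeval (fun s : TensorIndex => A s.1 s.2) P ≠ 0 →
          ∀ p : Fin 5 → K, p ≠ 0 → quadrics A p = 0 → ∀ x : Fin 4 → K,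
            (contract A x).mulVec p = 0 → x = 0 := by
  -- A failure for every P supplies one counterexample per P; their common specialisation is a
  -- counterexample with independent entries.
  by_contra! hbad
  choose K iF _ iA A hA p hp0 hp x hx hx0 using
    fun P : {P : MvPolynomial TensorIndex k // P ≠ 0} => hbad P.1 P.2
  obtain ⟨F, _, _, _, θ, hθ⟩ := exists_generic_specialization K (fun P s => A P s.1 s.2) hA
  refine vec_ne_zero_of_forall θ hx0 (eq_zero_of_mulVec_eq_zero_of_generic
    (A := fun i s => θ fun P => A P i s) hθ
    (vec_ne_zero_of_forall θ hp0) (quadrics_map_eq_zero θ A hp) ?_)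
  ext l
  refine (contract_mulVec_map θ A x p l).trans ?_
  have : (fun P => (contract (A P) (x P)).mulVec (p P) l) = 0 := funext fun P => congrFun (hx P) l
  rw [this, map_zero, Pi.zero_apply]

/-- Outside a hypersurface, the Cayley variety has at most 16 points. -/
theorem exists_forall_not_seventeen (h2 : (2 : k) ≠ 0) :
    ∃ P : MvPolynomial TensorIndex k, P ≠ 0 ∧
      ∀ (K : Type w) [Field K] [IsAlgClosed K] [Algebra k K] (A : Tensor K),
        aeval (fun s : TensorIndex => A s.1 s.2) P ≠ 0 →
          ∀ p : Fin 17 → Fin 5 → K, (∀ j, p j ≠ 0) → (∀ j, quadrics A (p j) = 0) →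
            ∃ j l, j ≠ l ∧ ∃ c : K, c • p j = p l := by
  by_contra! hbad
  choose K iF _ iA A hA p hp0 hp hne using
    fun P : {P : MvPolynomial TensorIndex k // P ≠ 0} => hbad P.1 P.2
  obtain ⟨F, _, _, _, θ, hθ⟩ := exists_generic_specialization K (fun P s => A P s.1 s.2) hA
  refine not_seventeen_of_generic (A := fun i s => θ fun P => A P i s) h2 hθ
    (p := fun j m => θ fun P => p P j m)
    (fun j => vec_ne_zero_of_forall θ fun P => hp0 P j)
    (fun j => quadrics_map_eq_zero θ A fun P => hp P j) ?_
  intro j l hjl c hc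
  -- Non-proportionality is the nonvanishing of the vector of 2×2 minors, a condition preserved by
  -- θ.
  refine vec_ne_zero_of_forall θ (y := fun P (m : Fin 5 × Fin 5) =>
    p P j m.1 * p P l m.2 - p P j m.2 * p P l m.1) ?_ ?_
  · intro P h0
    obtain ⟨m, hm⟩ := Function.ne_iff.1 (hp0 P j)
    refine hne P j l hjl (p P l m / p P j m) ?_
    ext m'
    have := congrFun h0 (m, m')
    simp only [Pi.zero_apply] at this hm
    rw [Pi.smul_apply, smul_eq_mul]
    field_simp
    linear_combination -this
  · ext m
    have h1 : ∀ m, θ (fun P => p P l m) = c * θ (fun P => p P j m) := fun m =>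
      (congrFun hc m).symm
    change θ ((fun P => p P j m.1) * (fun P => p P l m.2) -
      (fun P => p P j m.2) * (fun P => p P l m.1)) = 0
    rw [map_sub, map_mul, map_mul, h1, h1]
    ring

variable (a b : Fin 5) (σ : Equiv.Perm (Fin 5)) (τ : Equiv.Perm (Fin 4))

/-- Each clause of tameness is treated separately and for fixed indices of the frame, so that the
counterexamples have one shape and combine in the product. -/
theorem exists_forall_disc_ne_zero (h2 : (2 : k) ≠ 0) :
    ∃ P : MvPolynomial TensorIndex k, P ≠ 0 ∧
      ∀ (K : Type w) [Field K] [IsAlgClosed K] [Algebra k K] (A : Tensor K),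
        aeval (fun s : TensorIndex => A s.1 s.2) P ≠ 0 →
          ∀ (p q : Fin 5 → K) (r : Fin 3 → K), IsPairFrame A p q a b σ τ r →
            netDisc (netN A p q σ τ r) ≠ 0 := by
  by_contra! hbad
  choose K iF _ iA A hA p q r h h0 using
    fun P : {P : MvPolynomial TensorIndex k // P ≠ 0} => hbad P.1 P.2
  obtain ⟨F, _, _, _, θ, hθ⟩ := exists_generic_specialization K (fun P s => A P s.1 s.2) hA
  have hf := IsPairFrame.map θ A h
  refine (isTameNet_of_algebraicIndependent h2 (algebraicIndependent_netCoeffs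
    (A := fun i s => θ fun P => A P i s) hθ hf.left hf.right
    hf.left_coord hf.right_coord hf.minor hf.ratio)).disc_ne_zero ?_
  have h1 := map_netDisc θ fun i γ j P => netN (A P) (p P) (q P) σ τ (r P) i γ j
  have h3 : (netDisc fun i γ j P => netN (A P) (p P) (q P) σ τ (r P) i γ j) = 0 := by
    ext P
    have := map_netDisc (Pi.evalRingHom K P)
      fun i γ j P => netN (A P) (p P) (q P) σ τ (r P) i γ j
    exact this.trans (h0 P)
  rw [h3, map_zero] at h1
  rw [h1]
  congr 1
  ext i γ j
  exact netN_map θ A p q r i γ j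

theorem exists_forall_singular_on_line (h2 : (2 : k) ≠ 0) :
    ∃ P : MvPolynomial TensorIndex k, P ≠ 0 ∧
      ∀ (K : Type w) [Field K] [IsAlgClosed K] [Algebra k K] (A : Tensor K),
        aeval (fun s : TensorIndex => A s.1 s.2) P ≠ 0 →
          ∀ (p q : Fin 5 → K) (r : Fin 3 → K), IsPairFrame A p q a b σ τ r →
            ∀ (x v : Fin 3 → K) (w w' : Fin 2 → K), x ≠ 0 → w ≠ 0 →
              (∀ j, ∑ γ, w γ * ∑ i, x i * netN A p q σ τ r i γ j = 0) →
              (∀ γ, ∑ j, v j * ∑ i, x i * netN A p q σ τ r i γ j = 0) →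
              (∀ j, ∑ γ, w' γ * ∑ i, x i * netN A p q σ τ r i γ j +
                ∑ l, v l * ∑ i, x i * netS A σ τ r i s(j, l) = 0) → v = 0 := by
  by_contra! hbad
  choose K iF _ iA A hA p q r h x v w w' hx hw h1 h3 h4 hv using
    fun P : {P : MvPolynomial TensorIndex k // P ≠ 0} => hbad P.1 P.2
  obtain ⟨F, _, _, _, θ, hθ⟩ := exists_generic_specialization K (fun P s => A P s.1 s.2) hA
  have hf := IsPairFrame.map θ A h
  refine vec_ne_zero_of_forall θ hv ((isTameNet_of_algebraicIndependent h2
    (algebraicIndependent_netCoeffs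
    (A := fun i s => θ fun P => A P i s) hθ hf.left hf.right hf.left_coord hf.right_coord hf.minor
      hf.ratio)).eq_zero_of_singular_on_line (fun j => θ fun P => x P j) _
      (fun j => θ fun P => w P j) (fun j => θ fun P => w' P j)
      (vec_ne_zero_of_forall θ hx) (vec_ne_zero_of_forall θ hw) ?_ ?_ ?_)
  · intro j
    simp only [netN_map, ← map_mul, ← map_sum]
    rw [← map_zero θ]
    congr 1
    ext P
    simpa [Finset.sum_apply] using h1 P j
  · intro γ
    simp only [netN_map, ← map_mul, ← map_sum]
    rw [← map_zero θ]
    congr 1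
    ext P
    simpa [Finset.sum_apply] using h3 P γ
  · intro j
    simp only [netN_map, netS_map, ← map_mul, ← map_sum, ← map_add]
    rw [← map_zero θ]
    congr 1
    ext P
    simpa [Finset.sum_apply] using h4 P j

theorem exists_forall_singular (h2 : (2 : k) ≠ 0) :
    ∃ P : MvPolynomial TensorIndex k, P ≠ 0 ∧
      ∀ (K : Type w) [Field K] [IsAlgClosed K] [Algebra k K] (A : Tensor K),
        aeval (fun s : TensorIndex => A s.1 s.2) P ≠ 0 →
          ∀ (p q : Fin 5 → K) (r : Fin 3 → K), IsPairFrame A p q a b σ τ r →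
            ∀ (x v : Fin 3 → K) (w : Fin 2 → K), x ≠ 0 →
              (∀ γ, ∑ j, v j * ∑ i, x i * netN A p q σ τ r i γ j = 0) →
              (∀ j, ∑ γ, w γ * ∑ i, x i * netN A p q σ τ r i γ j +
                ∑ l, v l * ∑ i, x i * netS A σ τ r i s(j, l) = 0) →
              (∀ i, 2 * ∑ γ, w γ * ∑ j, v j * netN A p q σ τ r i γ j +
                ∑ j, v j * ∑ l, v l * netS A σ τ r i s(j, l) = 0) → v = 0 := by
  by_contra! hbad
  choose K iF _ iA A hA p q r h x v w hx h3 h4 h5 hv using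
    fun P : {P : MvPolynomial TensorIndex k // P ≠ 0} => hbad P.1 P.2
  obtain ⟨F, _, _, _, θ, hθ⟩ := exists_generic_specialization K (fun P s => A P s.1 s.2) hA
  have hf := IsPairFrame.map θ A h
  refine vec_ne_zero_of_forall θ hv ((isTameNet_of_algebraicIndependent h2
    (algebraicIndependent_netCoeffs
    (A := fun i s => θ fun P => A P i s) hθ hf.left hf.right hf.left_coord hf.right_coord hf.minor
      hf.ratio)).eq_zero_of_singular (fun j => θ fun P => x P j) _
      (fun j => θ fun P => w P j)
      (vec_ne_zero_of_forall θ hx) ?_ ?_ ?_)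
  · intro γ
    simp only [netN_map, ← map_mul, ← map_sum]
    rw [← map_zero θ]
    congr 1
    ext P
    simpa [Finset.sum_apply] using h3 P γ
  · intro j
    simp only [netN_map, netS_map, ← map_mul, ← map_sum, ← map_add]
    rw [← map_zero θ]
    congr 1
    ext P
    simpa [Finset.sum_apply] using h4 P j
  · intro i
    have h6 : (2 : F) = θ 2 := (map_ofNat θ 2).symm
    simp only [netN_map, netS_map, h6, ← map_mul, ← map_sum, ← map_add]
    rw [← map_zero θ]
    congr 1
    ext P
    simpa [Finset.sum_apply] using h5 P i

theorem exists_ne_zero_forall_aeval_ne_zero {k ι T : Type*} [Field k] [Finite T]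
    (P : T → MvPolynomial ι k) (hP : ∀ t, P t ≠ 0) :
    ∃ Q : MvPolynomial ι k, Q ≠ 0 ∧ ∀ (K : Type*) [Field K] [Algebra k K] (f : ι → K),
      aeval f Q ≠ 0 → ∀ t, aeval f (P t) ≠ 0 := by
  have := Fintype.ofFinite T
  refine ⟨∏ t, P t, Finset.prod_ne_zero_iff.2 fun t _ => hP t, ?_⟩
  intro K _ _ f hf t
  rw [map_prod, Finset.prod_ne_zero_iff] at hf
  exact hf t (Finset.mem_univ _)

/-- Outside a hypersurface, all nets attached to pairs of points of the Cayley variety are tame. -/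
theorem exists_forall_isTameNet (h2 : (2 : k) ≠ 0) :
    ∃ P : MvPolynomial TensorIndex k, P ≠ 0 ∧
      ∀ (K : Type w) [Field K] [IsAlgClosed K] [Algebra k K] (A : Tensor K),
        aeval (fun s : TensorIndex => A s.1 s.2) P ≠ 0 →
          ∀ (a b : Fin 5) (σ : Equiv.Perm (Fin 5)) (τ : Equiv.Perm (Fin 4))
            (p q : Fin 5 → K) (r : Fin 3 → K), IsPairFrame A p q a b σ τ r →
            IsTameNet (netN A p q σ τ r) (netS A σ τ r) := by
  choose P hP0 hP using fun t : Fin 5 × Fin 5 × Equiv.Perm (Fin 5) × Equiv.Perm (Fin 4) =>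
    exists_forall_disc_ne_zero.{u, w} k t.1 t.2.1 t.2.2.1 t.2.2.2 h2
  choose Q hQ0 hQ using fun t : Fin 5 × Fin 5 × Equiv.Perm (Fin 5) × Equiv.Perm (Fin 4) =>
    exists_forall_singular_on_line.{u, w} k t.1 t.2.1 t.2.2.1 t.2.2.2 h2
  choose R hR0 hR using fun t : Fin 5 × Fin 5 × Equiv.Perm (Fin 5) × Equiv.Perm (Fin 4) =>
    exists_forall_singular.{u, w} k t.1 t.2.1 t.2.2.1 t.2.2.2 h2
  -- There are finitely many choices of a, b, σ, τ, so one product polynomial serves them all.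
  obtain ⟨U, hU0, hU⟩ := exists_ne_zero_forall_aeval_ne_zero (fun t => P t * Q t * R t) fun t =>
    mul_ne_zero (mul_ne_zero (hP0 t) (hQ0 t)) (hR0 t)
  refine ⟨U, hU0, ?_⟩
  intro K _ _ _ A hA a b σ τ p q r h
  have hA := hU K _ hA (a, b, σ, τ)
  rw [map_mul, map_mul] at hA
  have h1 := left_ne_zero_of_mul (left_ne_zero_of_mul hA)
  have h3 := right_ne_zero_of_mul (left_ne_zero_of_mul hA)
  have h4 := right_ne_zero_of_mul hA
  exact ⟨hP _ K A h1 p q r h, hQ _ K A h3 p q r h, hR _ K A h4 p q r h⟩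

end General

/-! ### Jacobi's formula and adjugates of symmetric matrices -/

section LinearAlgebra

theorem derivation_prod {R B ι : Type*} [CommRing R] [CommRing B] [Algebra R B] [DecidableEq ι]
    (D : Derivation R B B) (s : Finset ι) (f : ι → B) :
    D (∏ i ∈ s, f i) = ∑ r ∈ s, D (f r) * ∏ i ∈ s.erase r, f i := by
  induction s using Finset.induction_on with
  | empty => simp
  | insert a s ha ih =>
    rw [Finset.prod_insert ha, D.leibniz, ih, Finset.sum_insert ha, Finset.erase_insert ha,
      smul_eq_mul, smul_eq_mul, add_comm, mul_comm, Finset.mul_sum]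
    congr 1
    refine Finset.sum_congr rfl fun r hr => ?_
    have h : a ≠ r := fun h => ha (h ▸ hr)
    rw [Finset.erase_insert_of_ne h, Finset.prod_insert fun h' => ha (Finset.mem_of_mem_erase h')]
    ring

/-- Jacobi's formula: the derivation acts on one column at a time in the Leibniz expansion. -/
theorem derivation_det {R B n : Type*} [CommRing R] [CommRing B] [Algebra R B] [DecidableEq n]
    [Fintype n] (D : Derivation R B B) (M : Matrix n n B) :
    D M.det = ∑ r, ∑ l, M.adjugate r l * D (M l r) := by
  have h (r : n) : ∑ l, M.adjugate r l * D (M l r) = (M.updateCol r fun l => D (M l r)).det := by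
    rw [← Matrix.cramer_apply, Matrix.cramer_eq_adjugate_mulVec]
    rfl
  simp only [h, Matrix.det_apply]
  rw [map_sum, Finset.sum_comm]
  refine Finset.sum_congr rfl fun s _ => ?_
  have h' : D (Equiv.Perm.sign s • ∏ i, M (s i) i) = Equiv.Perm.sign s • D (∏ i, M (s i) i) :=
    map_zsmul D ((Equiv.Perm.sign s : ℤˣ) : ℤ) _
  rw [h', derivation_prod, ← Finset.smul_sum]
  congr 1
  refine Finset.sum_congr rfl fun r _ => ?_
  rw [← Finset.mul_prod_erase _ _ (Finset.mem_univ r), Matrix.updateCol_self]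
  congr 1
  exact Finset.prod_congr rfl fun i hi => by rw [Matrix.updateCol_ne (Finset.ne_of_mem_erase hi)]

variable {K : Type*} [Field K]

/-- R has full column rank and one more row than columns, so its left kernel is a line. -/
theorem exists_smul_eq_of_mulVec_injective {m n : Type*} [Fintype m] [Fintype n] [DecidableEq m]
    [DecidableEq n] (R : Matrix m n K) (hc : Fintype.card m = Fintype.card n + 1)
    (hR : ∀ x, R.mulVec x = 0 → x = 0) {v v' : m → K} (hv : v ≠ 0) (h : Matrix.vecMul v R = 0)
    (h' : Matrix.vecMul v' R = 0) : ∃ c : K, c • v = v' := by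
  have hker : LinearMap.ker R.mulVecLin = ⊥ := by
    rw [LinearMap.ker_eq_bot']
    exact hR
  have h1 : R.rank = Fintype.card n := by
    have := LinearMap.finrank_range_add_finrank_ker R.mulVecLin
    rw [hker] at this
    simpa [Matrix.rank] using this
  have h2 := LinearMap.finrank_range_add_finrank_ker R.transpose.mulVecLin
  have h3 : Module.finrank K (LinearMap.range R.transpose.mulVecLin) = Fintype.card n := by
    rw [← h1, ← Matrix.rank_transpose]
    rfl
  rw [h3, Module.finrank_fintype_fun_eq_card, hc] at h2
  have h4 : Module.finrank K (LinearMap.ker R.transpose.mulVecLin) = 1 := by omega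
  have mem {u : m → K} (hu : Matrix.vecMul u R = 0) : u ∈ LinearMap.ker R.transpose.mulVecLin := by
    rwa [LinearMap.mem_ker, Matrix.mulVecLin_apply, Matrix.mulVec_transpose]
  obtain ⟨c, hc⟩ := (finrank_eq_one_iff_of_nonzero' (⟨v, mem h⟩ : LinearMap.ker _)
    (fun h0 => hv (congrArg Subtype.val h0))).1 h4 ⟨v', mem h'⟩
  exact ⟨c, congrArg Subtype.val hc⟩

theorem exists_eq_smul_of_forall_dotProduct {n : Type*} [Fintype n] [DecidableEq n] {h g : n → K}
    (h0 : h ≠ 0) (H : ∀ v, h ⬝ᵥ v = 0 → g ⬝ᵥ v = 0) : ∃ c : K, g = c • h := by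
  obtain ⟨i, hi⟩ := Function.ne_iff.1 h0
  refine ⟨g i / h i, funext fun j => ?_⟩
  have := H (h i • Pi.single j 1 - h j • Pi.single i 1) (by simp [mul_comm])
  simp only [dotProduct_sub, dotProduct_smul, dotProduct_single, mul_one, smul_eq_mul] at this
  have hi' : h i ≠ 0 := hi
  simp only [Pi.smul_apply, smul_eq_mul]
  field_simp
  linear_combination this

/-- An adjugate entry is the determinant after replacing row j by the i-th unit vector, and a kernel
of dimension at least two contains a nonzero vector with i-th coordinate zero. -/
theorem adjugate_eq_zero_of_not_proportional {n : Type*} [Fintype n] [DecidableEq n]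
    {M : Matrix n n K} {y y' : n → K} (hy : y ≠ 0) (h : M.mulVec y = 0) (h' : M.mulVec y' = 0)
    (hyy : ∀ c : K, c • y ≠ y') : M.adjugate = 0 := by
  ext i j
  rw [Matrix.adjugate_apply, Matrix.zero_apply, ← Matrix.exists_mulVec_eq_zero_iff]
  have key (v : n → K) (hv : v i = 0) (hM : M.mulVec v = 0) :
      (M.updateRow j (Pi.single i 1)).mulVec v = 0 := by
    ext l
    by_cases hl : l = j
    · subst hl
      simp [Matrix.mulVec, hv]
    · have := congrFun hM l
      simpa [Matrix.mulVec, Matrix.updateRow_ne hl] using this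
  by_cases hi : y i = 0
  · exact ⟨y, hy, key y hi h⟩
  · refine ⟨y' - (y' i / y i) • y, fun h0 => hyy _ (sub_eq_zero.1 h0).symm, key _ ?_ ?_⟩
    · simp [hi]
    · rw [Matrix.mulVec_sub, Matrix.mulVec_smul, h, h', smul_zero, sub_zero]

/-- Choose i with y i ≠ 0. If the adjugate vanished, each matrix with row j replaced by the i-th
unit vector would have a kernel vector v with v i = 0. Then v is not in the kernel line of M, so Mv
is a nonzero multiple of the j-th unit vector; M would be surjective, contradicting My = 0. -/
theorem adjugate_ne_zero_of_proportional {n : Type*} [Fintype n] [DecidableEq n]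
    {M : Matrix n n K} {y : n → K} (hy : y ≠ 0) (h : M.mulVec y = 0)
    (hyy : ∀ y', M.mulVec y' = 0 → ∃ c : K, c • y = y') : M.adjugate ≠ 0 := by
  intro h0
  obtain ⟨i, hi⟩ := Function.ne_iff.1 hy
  have key (j : n) : ∃ v, M.mulVec v = Pi.single j 1 := by
    have hj : M.adjugate i j = 0 := by rw [h0]; rfl
    rw [Matrix.adjugate_apply, ← Matrix.exists_mulVec_eq_zero_iff] at hj
    obtain ⟨v, hv, hM⟩ := hj
    have hvi : v i = 0 := by simpa [Matrix.mulVec] using congrFun hM j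
    have hl (l : n) (hl : l ≠ j) : M.mulVec v l = 0 := by
      simpa [Matrix.mulVec, Matrix.updateRow_ne hl] using congrFun hM l
    have hj : M.mulVec v j ≠ 0 := by
      intro hj
      obtain ⟨c, rfl⟩ := hyy v (funext fun l => by
        by_cases h : l = j
        · rw [h, hj]; rfl
        · rw [hl l h]; rfl)
      have : c * y i = 0 := hvi
      rw [(mul_eq_zero.1 this).resolve_right hi, zero_smul] at hv
      exact hv rfl
    refine ⟨(M.mulVec v j)⁻¹ • v, funext fun l => ?_⟩
    rw [Matrix.mulVec_smul]
    by_cases h : l = j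
    · subst h
      simp [hj]
    · simp [hl l h, h]
  have hs : Function.Surjective M.mulVecLin := by
    rw [← LinearMap.range_eq_top, eq_top_iff, ← (Pi.basisFun K n).span_eq, Submodule.span_le]
    rintro _ ⟨j, rfl⟩
    obtain ⟨v, hv⟩ := key j
    exact ⟨v, by simpa using hv⟩
  exact hy ((LinearMap.injective_iff_surjective.2 hs) (by simpa using h))

/-- In corank one the columns of the adjugate lie in the kernel and are multiples of y; symmetry
makes the factors proportional to y as well. In larger corank κ = 0. -/
theorem exists_adjugate_eq_smul_vecMulVec {n : Type*} [Fintype n] [DecidableEq n]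
    {M : Matrix n n K} (hM : M.IsSymm) {y : n → K} (hy : y ≠ 0) (h : M.mulVec y = 0) :
    ∃ κ : K, M.adjugate = κ • Matrix.vecMulVec y y := by
  by_cases hyy : ∃ y', M.mulVec y' = 0 ∧ ∀ c : K, c • y ≠ y'
  · obtain ⟨y', h', hc⟩ := hyy
    exact ⟨0, by rw [adjugate_eq_zero_of_not_proportional hy h h' hc, zero_smul]⟩
  push Not at hyy
  have hdet : M.det = 0 := Matrix.exists_mulVec_eq_zero_iff.1 ⟨y, hy, h⟩
  have hcol (j : n) : M.mulVec (fun i => M.adjugate i j) = 0 := by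
    ext l
    have := congrFun (congrFun (Matrix.mul_adjugate M) l) j
    rw [hdet, zero_smul] at this
    exact this
  choose z hz using fun j => hyy _ (hcol j)
  have hz' (i j : n) : M.adjugate i j = z j * y i := (congrFun (hz j) i).symm
  have hsymm : M.adjugate.transpose = M.adjugate := by
    rw [Matrix.adjugate_transpose, hM.eq]
  obtain ⟨i, hi⟩ := Function.ne_iff.1 hy
  have hi' : y i ≠ 0 := hi
  refine ⟨z i / y i, ?_⟩
  ext l j
  have h1 : z l * y i = z i * y l := by
    rw [← hz', ← hz']
    exact congrFun (congrFun hsymm l) i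
  have h2 : z j * y i = z i * y j := by
    rw [← hz', ← hz']
    exact congrFun (congrFun hsymm j) i
  rw [hz', Matrix.smul_apply, Matrix.vecMulVec_apply, smul_eq_mul]
  field_simp
  linear_combination y l * h2

end LinearAlgebra

/-! ### The gradient of the symmetroid through the kernel -/

section Gradient

variable {K : Type*} [Field K] {A : Tensor K}

theorem contract_isSymm (A : Tensor K) (x : Fin 4 → K) : (contract A x).IsSymm := by
  rw [Matrix.IsSymm, contract, Matrix.transpose_sum]
  exact Finset.sum_congr rfl fun i _ => by rw [Matrix.transpose_smul, (slice_isSymm A i).eq]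

theorem map_eval_eq_contract (A : Tensor K) (x : Fin 4 → K) :
    (∑ i : Fin 4, (X i : MvPolynomial (Fin 4) K) • (slice A i).map (C (σ := Fin 4))).map (eval x) =
      contract A x := by
  ext l m
  simp [contract, Matrix.sum_apply]

theorem eval_detForm (A : Tensor K) (x : Fin 4 → K) :
    eval x (detForm A) = (contract A x).det := by
  rw [detForm, RingHom.map_det, RingHom.mapMatrix_apply, map_eval_eq_contract]

theorem eval_pderiv_detForm (A : Tensor K) (x : Fin 4 → K) (i : Fin 4) :
    eval x (pderiv i (detForm A)) = ∑ r, ∑ l, (contract A x).adjugate r l * slice A i l r := by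
  rw [detForm, derivation_det, map_sum]
  refine Finset.sum_congr rfl fun r _ => ?_
  rw [map_sum]
  refine Finset.sum_congr rfl fun l _ => ?_
  rw [map_mul, ← map_eval_eq_contract, ← RingHom.mapMatrix_apply, ← RingHom.map_adjugate]
  congr 1
  simp [Matrix.sum_apply, pderiv_X, Pi.single_apply]

/-- By Jacobi's formula the i-th partial derivative is the trace of adj A(x) · A_i, and adj A(x) = κ
y yᵗ. -/
theorem exists_gradient_eq_smul_quadrics {x : P3 K} {y : Fin 5 → K} (hy : y ≠ 0)
    (h : (contract A x.rep).mulVec y = 0) :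
    ∃ κ : K, gradient A x = κ • quadrics A y ∧
      ((∀ y', (contract A x.rep).mulVec y' = 0 → ∃ c : K, c • y = y') → κ ≠ 0) := by
  obtain ⟨κ, hκ⟩ := exists_adjugate_eq_smul_vecMulVec (contract_isSymm A x.rep) hy h
  refine ⟨κ, funext fun i => ?_, ?_⟩
  · rw [gradient, eval_pderiv_detForm, hκ, Pi.smul_apply, quadrics, dotProduct, smul_eq_mul,
      Finset.mul_sum, Finset.sum_comm]
    refine Finset.sum_congr rfl fun l _ => ?_
    rw [Matrix.mulVec, dotProduct, Finset.mul_sum, Finset.mul_sum]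
    refine Finset.sum_congr rfl fun r _ => ?_
    rw [Matrix.smul_apply, Matrix.vecMulVec_apply, smul_eq_mul]
    ring
  · rintro H rfl
    exact adjugate_ne_zero_of_proportional hy h H (by rw [hκ, zero_smul])

theorem mem_symmetroid_iff {x : P3 K} :
    x ∈ symmetroid A ↔ ∃ y, y ≠ 0 ∧ (contract A x.rep).mulVec y = 0 := by
  rw [Matrix.exists_mulVec_eq_zero_iff, ← eval_detForm]
  rfl

end Gradient

/-! ### Members of a net singular at a point of the line -/

section Net

variable {F : Type*} [Field F]

/-- The three singular members of the net along the line, and their singular points. -/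
theorem exists_three_singular_members [IsAlgClosed F] {N : Fin 3 → Fin 2 → Fin 3 → F}
    (hN : netDisc N ≠ 0) :
    ∃ (ρ : Fin 3 → F) (t : Fin 3 → Fin 3 → F), (∀ m, t m ≠ 0) ∧
      (∀ m m' (c : F), c • t m = t m' → m = m') ∧
      (∀ m j, ∑ γ, (![ρ m, 1] : Fin 2 → F) γ * ∑ i, t m i * N i γ j = 0) ∧
      ∀ (t' : Fin 3 → F) (w : Fin 2 → F), t' ≠ 0 → w ≠ 0 →
        (∀ j, ∑ γ, w γ * ∑ i, t' i * N i γ j = 0) →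
          ∃ m, (∃ c : F, c • t m = t') ∧ ∃ d : F, d • ![ρ m, 1] = w := by
  have ha : (netCubic N).a ≠ 0 := left_ne_zero_of_mul hN
  obtain ⟨x, y, z, hroots⟩ := (Cubic.splits_iff_roots_eq_three (φ := RingHom.id F) ha).1
    (IsAlgClosed.splits _)
  obtain ⟨hxy, hxz, hyz⟩ := (Cubic.discr_ne_zero_iff_roots_ne ha hroots).1
    (right_ne_zero_of_mul hN)
  have hmap : Cubic.map (RingHom.id F) (netCubic N) = netCubic N := rfl
  rw [hmap] at hroots
  have hmem (s : F) : Matrix.det (Matrix.of fun j i => s * N i 0 j + N i 1 j) = 0 ↔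
      s = x ∨ s = y ∨ s = z := by
    rw [det_eq_netCubic, ← Cubic.mem_roots_iff (Cubic.ne_zero_of_a_ne_zero ha), hroots]
    simp
  have hinj : Function.Injective ![x, y, z] := by
    intro i j h
    fin_cases i <;> fin_cases j <;> simp_all
  have hrow (s : F) (t : Fin 3 → F) (j : Fin 3) :
      (Matrix.of fun j i => s * N i 0 j + N i 1 j).mulVec t j =
        s * ∑ i, t i * N i 0 j + ∑ i, t i * N i 1 j := by
    rw [Matrix.mulVec, dotProduct, Finset.mul_sum, ← Finset.sum_add_distrib]
    exact Finset.sum_congr rfl fun i _ => by rw [Matrix.of_apply]; ring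
  -- The leading coefficient of the cubic is det R₀, so no nonzero member is singular at the point w
  -- = (1, 0).
  have hinf (t : Fin 3 → F) (h : ∀ j, ∑ i, t i * N i 0 j = 0) : t = 0 := by
    by_contra ht
    refine ha ?_
    have : Matrix.det (Matrix.of fun j i => N i 0 j) = 0 :=
      Matrix.exists_mulVec_eq_zero_iff.1 ⟨t, ht, funext fun j => by
        rw [Pi.zero_apply, ← h j, Matrix.mulVec, dotProduct]
        exact Finset.sum_congr rfl fun i _ => mul_comm _ _⟩
    rw [← this, netCubic, mixedDet]
    congr 2
  have hex (m : Fin 3) : ∃ t : Fin 3 → F, t ≠ 0 ∧ ∀ j,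
      ![x, y, z] m * ∑ i, t i * N i 0 j + ∑ i, t i * N i 1 j = 0 := by
    obtain ⟨t, ht, h⟩ := Matrix.exists_mulVec_eq_zero_iff.2
      ((hmem (![x, y, z] m)).2 (by fin_cases m <;> simp))
    exact ⟨t, ht, fun j => by rw [← hrow, h]; rfl⟩
  choose t ht hker using hex
  have hprop (m m' : Fin 3) (c : F) (h : c • t m = t m') : m = m' := by
    by_contra hne
    refine ht m' (hinf _ fun j => ?_)
    have h1 := hker m j
    have h2 := hker m' j
    have h3 (γ : Fin 2) : ∑ i, t m' i * N i γ j = c * ∑ i, t m i * N i γ j := by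
      rw [Finset.mul_sum, ← h]
      exact Finset.sum_congr rfl fun i _ => by rw [Pi.smul_apply, smul_eq_mul, mul_assoc]
    have h4 : (![x, y, z] m - ![x, y, z] m') * ∑ i, t m' i * N i 0 j = 0 := by
      rw [h3 1] at h2
      rw [h3 0] at h2 ⊢
      linear_combination c * h1 - h2
    exact (mul_eq_zero.1 h4).resolve_left (sub_ne_zero.2 fun h => hne (hinj h))
  have huniq (m : Fin 3) (t' : Fin 3 → F)
      (h : ∀ j, ![x, y, z] m * ∑ i, t' i * N i 0 j + ∑ i, t' i * N i 1 j = 0) :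
      ∃ c : F, c • t m = t' := by
    -- The kernels of s R₀ + R₁ are eigenspaces of -R₀⁻¹R₁. Three distinct eigenvalues in dimension
    -- three make each of them a line.
    set R₀ : Matrix (Fin 3) (Fin 3) F := Matrix.of fun j i => N i 0 j with hR₀
    set R₁ : Matrix (Fin 3) (Fin 3) F := Matrix.of fun j i => N i 1 j with hR₁
    have hdet : R₀.det ≠ 0 := fun h0 => by
      obtain ⟨t, ht, h⟩ := Matrix.exists_mulVec_eq_zero_iff.2 h0
      refine ht (hinf t fun j => ?_)
      rw [← Pi.zero_apply (M := fun _ => F) j, ← h, Matrix.mulVec, dotProduct]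
      exact Finset.sum_congr rfl fun i _ => mul_comm _ _
    have heig (s : F) (t : Fin 3 → F)
        (h : ∀ j, s * ∑ i, t i * N i 0 j + ∑ i, t i * N i 1 j = 0) :
        Matrix.toLin' (-(R₀⁻¹ * R₁)) t = s • t := by
      have h1 : s • R₀.mulVec t + R₁.mulVec t = 0 := by
        ext j
        rw [Pi.zero_apply, ← h j]
        simp [Matrix.mulVec, dotProduct, hR₀, hR₁, mul_comm]
      have h2 : R₁.mulVec t = -(s • R₀.mulVec t) := (neg_eq_of_add_eq_zero_right h1).symm
      rw [Matrix.toLin'_apply, Matrix.neg_mulVec, ← Matrix.mulVec_mulVec, h2, Matrix.mulVec_neg,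
        neg_neg, Matrix.mulVec_smul, Matrix.mulVec_mulVec,
        Matrix.nonsing_inv_mul _ (isUnit_iff_ne_zero.2 hdet), Matrix.one_mulVec]
    have hli : LinearIndependent F t :=
      Module.End.eigenvectors_linearIndependent' (Matrix.toLin' (-(R₀⁻¹ * R₁))) ![x, y, z] hinj t
        fun l => ⟨Module.End.mem_eigenspace_iff.2 (heig _ _ (hker l)), ht l⟩
    let B := basisOfLinearIndependentOfCardEqFinrank hli (by simp)
    have hB (l : Fin 3) : B l = t l := by simp [B]
    have hsum : ∑ l, B.repr t' l • t l = t' := by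
      simpa only [hB] using B.sum_repr t'
    have h0 : ∑ l, (B.repr t' l * (![x, y, z] l - ![x, y, z] m)) • t l = 0 := by
      have h3 := heig _ _ h
      rw [← hsum, map_sum, Finset.smul_sum] at h3
      rw [← sub_eq_zero.2 h3, ← Finset.sum_sub_distrib]
      refine Finset.sum_congr rfl fun l _ => ?_
      rw [map_smul, heig _ _ (hker l), smul_smul, smul_smul, ← sub_smul]
      congr 1
      ring
    have hc := Fintype.linearIndependent_iff.1 hli _ h0
    refine ⟨B.repr t' m, ?_⟩
    refine Eq.trans (Finset.sum_eq_single (f := fun l => B.repr t' l • t l) m ?_ ?_).symm hsum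
    · intro l _ hl
      rw [(mul_eq_zero.1 (hc l)).resolve_right (sub_ne_zero.2 fun h => hl (hinj h)), zero_smul]
    · simp
  refine ⟨![x, y, z], t, ht, hprop, fun m j => ?_, fun t' w ht' hw h => ?_⟩
  · rw [Fin.sum_univ_two]
    simpa using hker m j
  · simp only [Fin.sum_univ_two] at h
    have hw1 : w 1 ≠ 0 := by
      intro h1
      have hw0 : w 0 ≠ 0 := fun h0 => hw (by ext γ; fin_cases γ <;> assumption)
      exact ht' (hinf t' fun j => by simpa [h1, hw0] using h j)
    have h' (j : Fin 3) : w 0 / w 1 * ∑ i, t' i * N i 0 j + ∑ i, t' i * N i 1 j = 0 := by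
      have := h j
      field_simp
      linear_combination this
    have hm : ∃ m, ![x, y, z] m = w 0 / w 1 := by
      have := (hmem (w 0 / w 1)).1 (Matrix.exists_mulVec_eq_zero_iff.1 ⟨t', ht', funext fun j => by
        rw [hrow, h' j]; rfl⟩)
      rcases this with h | h | h
      exacts [⟨0, h.symm⟩, ⟨1, h.symm⟩, ⟨2, h.symm⟩]
    obtain ⟨m, hm⟩ := hm
    rw [← hm] at h'
    refine ⟨m, huniq m t' h', w 1, ?_⟩
    rw [hm]
    ext γ
    fin_cases γ
    · simp [mul_div_cancel₀ _ hw1]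
    · simp

end Net

/-! ### Block form of the net in a frame -/

section PairFrame

variable {K : Type*} [Field K]

theorem frame_mulVec_append (p q : Fin 5 → K) (σ : Equiv.Perm (Fin 5)) (w : Fin 2 → K) :
    (frame p q σ).mulVec (Fin.append w (0 : Fin 3 → K)) = w 0 • p + w 1 • q := by
  ext l
  change ∑ m : Fin (2 + 3), frameVec p q σ m l * _ = _
  rw [Fin.sum_univ_add]
  simp only [frameVec, Fin.append_left, Fin.append_right, Fin.sum_univ_two]
  simp [mul_comm]

theorem conj_mulVec_append_left (M : Matrix (Fin (2 + 3)) (Fin (2 + 3)) K) (w : Fin 2 → K)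
    (v : Fin 3 → K) (m : Fin (2 + 3)) : M.mulVec (Fin.append w v) m =
      ∑ γ, w γ * M m (Fin.castAdd 3 γ) + ∑ j, v j * M m (Fin.natAdd 2 j) := by
  rw [Matrix.mulVec, dotProduct, Fin.sum_univ_add]
  simp only [Fin.append_left, Fin.append_right, mul_comm]

variable {A : Tensor K} {p q : Fin 5 → K} {a b : Fin 5} {σ : Equiv.Perm (Fin 5)}
  {τ : Equiv.Perm (Fin 4)} {r : Fin 3 → K}

theorem IsPairFrame.conj_left (hF : IsPairFrame A p q a b σ τ r) (i : Fin 3) (w : Fin 2 → K)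
    (v : Fin 3 → K) (γ : Fin 2) :
    ((frame p q σ).transpose * redSlice A τ r i * frame p q σ).mulVec (Fin.append w v)
      (Fin.castAdd 3 γ) = ∑ j, v j * netN A p q σ τ r i γ j := by
  refine (conj_mulVec_append_left _ w v _).trans ?_
  simp only [frame_conj_apply_left_right]
  rw [Finset.sum_eq_zero fun δ _ => ?_, zero_add]
  rw [frame_conj_apply_left_left σ hF.left hF.right hF.ratio, mul_zero]

theorem IsPairFrame.conj_right (i : Fin 3) (w : Fin 2 → K)
    (v : Fin 3 → K) (j : Fin 3) :
    ((frame p q σ).transpose * redSlice A τ r i * frame p q σ).mulVec (Fin.append w v)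
      (Fin.natAdd 2 j) = ∑ γ, w γ * netN A p q σ τ r i γ j +
        ∑ l, v l * netS A σ τ r i s(j, l) := by
  refine (conj_mulVec_append_left _ w v _).trans ?_
  simp only [frame_conj_apply_right_right]
  congr 1
  refine Finset.sum_congr rfl fun γ _ => ?_
  rw [← frame_conj_apply_left_right]
  congr 1
  exact congrFun (congrFun (frame_conj_symm (redSlice_isSymm A τ r i) p q σ) _) _

theorem exists_frame_coords (h : (frame p q σ).det ≠ 0) (y : Fin 5 → K) :
    ∃ (w : Fin 2 → K) (v : Fin 3 → K), (frame p q σ).mulVec (Fin.append w v) = y := by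
  let u : Fin (2 + 3) → K := (frame p q σ)⁻¹.mulVec y
  refine ⟨fun γ => u (Fin.castAdd 3 γ), fun j => u (Fin.natAdd 2 j), ?_⟩
  rw [Fin.append_castAdd_natAdd]
  change (frame p q σ).mulVec ((frame p q σ)⁻¹.mulVec y) = y
  rw [Matrix.mulVec_mulVec, Matrix.mul_nonsing_inv _ (isUnit_iff_ne_zero.2 h), Matrix.one_mulVec]

/-- Multiplication by the invertible transpose of the frame splits the kernel condition into the two
block rows of (0 N; Nᵗ S). -/
theorem IsPairFrame.mulVec_eq_zero_iff (hF : IsPairFrame A p q a b σ τ r) (t : Fin 3 → K)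
    (w : Fin 2 → K) (v : Fin 3 → K) :
    (∑ i, t i • redSlice A τ r i).mulVec ((frame p q σ).mulVec (Fin.append w v)) = 0 ↔
      (∀ γ, ∑ j, v j * ∑ i, t i * netN A p q σ τ r i γ j = 0) ∧
      ∀ j, ∑ γ, w γ * ∑ i, t i * netN A p q σ τ r i γ j +
        ∑ l, v l * ∑ i, t i * netS A σ τ r i s(j, l) = 0 := by
  have hdet : (frame p q σ).transpose.det ≠ 0 := by
    rw [Matrix.det_transpose]
    exact frame_det_ne_zero hF.minor
  have h1 : (∑ i, t i • redSlice A τ r i).mulVec ((frame p q σ).mulVec (Fin.append w v)) = 0 ↔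
      ∑ i, t i • ((frame p q σ).transpose * redSlice A τ r i * frame p q σ).mulVec
        (Fin.append w v) = 0 := by
    have h2 : ∑ i, t i • ((frame p q σ).transpose * redSlice A τ r i * frame p q σ).mulVec
        (Fin.append w v) = (frame p q σ).transpose.mulVec
          ((∑ i, t i • redSlice A τ r i).mulVec ((frame p q σ).mulVec (Fin.append w v))) := by
      rw [Matrix.sum_mulVec, Matrix.mulVec_sum]
      refine Finset.sum_congr rfl fun i _ => ?_
      rw [Matrix.smul_mulVec, Matrix.mulVec_smul, Matrix.mulVec_mulVec,
        Matrix.mulVec_mulVec]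
    rw [h2]
    refine ⟨fun h => by rw [h, Matrix.mulVec_zero], fun h => ?_⟩
    by_contra h0
    exact hdet (Matrix.exists_mulVec_eq_zero_iff.1 ⟨_, h0, h⟩)
  rw [h1]
  have hl (γ : Fin 2) : (∑ i, t i • ((frame p q σ).transpose * redSlice A τ r i *
      frame p q σ).mulVec (Fin.append w v)) (Fin.castAdd 3 γ) =
        ∑ j, v j * ∑ i, t i * netN A p q σ τ r i γ j := by
    simp only [Finset.sum_apply, Pi.smul_apply, hF.conj_left, smul_eq_mul, Finset.mul_sum]
    rw [Finset.sum_comm]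
    exact Finset.sum_congr rfl fun j _ => Finset.sum_congr rfl fun i _ => by ring
  have hr (j : Fin 3) : (∑ i, t i • ((frame p q σ).transpose * redSlice A τ r i *
      frame p q σ).mulVec (Fin.append w v)) (Fin.natAdd 2 j) =
        ∑ γ, w γ * ∑ i, t i * netN A p q σ τ r i γ j +
          ∑ l, v l * ∑ i, t i * netS A σ τ r i s(j, l) := by
    simp only [Finset.sum_apply, Pi.smul_apply, conj_right, smul_eq_mul, Finset.mul_sum, mul_add,
      Finset.sum_add_distrib]
    congr 1 <;> rw [Finset.sum_comm] <;>
    exact Finset.sum_congr rfl fun j _ => Finset.sum_congr rfl fun i _ => by ring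
  refine ⟨fun h => ⟨fun γ => ?_, fun j => ?_⟩, fun h => funext fun m => ?_⟩
  · rw [← hl, h]; rfl
  · rw [← hr, h]; rfl
  · change _ = (0 : K)
    induction m using Fin.addCases (m := 2) (n := 3) with
    | left γ => rw [hl, h.1]
    | right j => rw [hr, h.2]

theorem IsPairFrame.dotProduct_redSlice (hF : IsPairFrame A p q a b σ τ r) (i : Fin 3)
    (w : Fin 2 → K) (v : Fin 3 → K) :
    (frame p q σ).mulVec (Fin.append w v) ⬝ᵥ
      (redSlice A τ r i).mulVec ((frame p q σ).mulVec (Fin.append w v)) =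
      2 * ∑ γ, w γ * ∑ j, v j * netN A p q σ τ r i γ j +
        ∑ j, v j * ∑ l, v l * netS A σ τ r i s(j, l) := by
  have h : (frame p q σ).mulVec (Fin.append w v) ⬝ᵥ
      (redSlice A τ r i).mulVec ((frame p q σ).mulVec (Fin.append w v)) =
      Fin.append w v ⬝ᵥ ((frame p q σ).transpose * redSlice A τ r i * frame p q σ).mulVec
        (Fin.append w v) := by
    rw [← Matrix.mulVec_mulVec, ← Matrix.mulVec_mulVec, Matrix.dotProduct_mulVec _
      (frame p q σ).transpose, Matrix.vecMul_transpose]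
  rw [h]
  refine (Fin.sum_univ_add (a := 2) (b := 3) _).trans ?_
  simp only [Fin.append_left, Fin.append_right, hF.conj_left, conj_right, mul_add,
    Finset.sum_add_distrib]
  have h3 : ∑ j, v j * ∑ γ, w γ * netN A p q σ τ r i γ j =
      ∑ γ, w γ * ∑ j, v j * netN A p q σ τ r i γ j := by
    simp only [Finset.mul_sum]
    rw [Finset.sum_comm]
    exact Finset.sum_congr rfl fun j _ => Finset.sum_congr rfl fun i _ => by ring
  rw [h3]
  ring

end PairFrame

/-! ### Singular members in the plane of a secant -/

section PairFrame

variable {K : Type*} [Field K]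

theorem smul_append (c : K) (w : Fin 2 → K) (v : Fin 3 → K) :
    (c • Fin.append w v : Fin 5 → K) = Fin.append (c • w) (c • v) := by
  funext l
  change c * Fin.append w v l = _
  induction l using Fin.addCases (m := 2) (n := 3) <;> simp

theorem contract_eq_sum_redSlice (A : Tensor K) (τ : Equiv.Perm (Fin 4)) (r : Fin 3 → K)
    {x : Fin 4 → K} (hx : x (τ 3) = -∑ i : Fin 3, x (τ i.castSucc) * r i) :
    contract A x = ∑ i : Fin 3, x (τ i.castSucc) • redSlice A τ r i := by
  rw [contract, ← Equiv.sum_comp τ, Fin.sum_univ_castSucc]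
  have h3 : Fin.last 3 = 3 := rfl
  simp only [redSlice, smul_sub, Finset.sum_sub_distrib, smul_smul, ← Finset.sum_smul]
  rw [h3, hx, neg_smul, ← sub_eq_add_neg]

variable {A : Tensor K} {p q : Fin 5 → K} {a b : Fin 5} {σ : Equiv.Perm (Fin 5)}
  {τ : Equiv.Perm (Fin 4)} {r : Fin 3 → K}

theorem IsPairFrame.dotProduct_polar_eq_zero_iff (hF : IsPairFrame A p q a b σ τ r)
    (hτ : polar A p q (τ 3) ≠ 0) (x : Fin 4 → K) :
    polar A p q ⬝ᵥ x = 0 ↔ x (τ 3) = -∑ i : Fin 3, x (τ i.castSucc) * r i := by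
  have h : polar A p q ⬝ᵥ x =
      polar A p q (τ 3) * (x (τ 3) + ∑ i : Fin 3, x (τ i.castSucc) * r i) := by
    rw [dotProduct, ← Equiv.sum_comp τ, Fin.sum_univ_castSucc, mul_add, Finset.mul_sum, add_comm]
    congr 1
    exact Finset.sum_congr rfl fun i _ => by rw [← hF.ratio]; ring
  rw [h, mul_eq_zero, or_iff_right hτ, add_eq_zero_iff_eq_neg]

/-- The generators of the net are combinations of slices whose coefficients annihilate A(·,p,q), so
a point mapped by ψ to the plane of the secant is a base point of the net. -/
theorem IsPairFrame.mulVec_redSlice_eq_zero (hF : IsPairFrame A p q a b σ τ r)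
    {y : Fin 5 → K} {c : K} (h : quadrics A y = c • polar A p q) (i : Fin 3) :
    y ⬝ᵥ (redSlice A τ r i).mulVec y = 0 := by
  rw [redSlice, Matrix.sub_mulVec, Matrix.smul_mulVec, dotProduct_sub, dotProduct_smul]
  change quadrics A y _ - r i • quadrics A y _ = 0
  rw [h, Pi.smul_apply, Pi.smul_apply, ← hF.ratio]
  simp only [smul_eq_mul]
  ring

theorem exists_extension_of_hyperplane (τ : Equiv.Perm (Fin 4)) (r t : Fin 3 → K) :
    ∃ x : Fin 4 → K, (∀ i : Fin 3, x (τ i.castSucc) = t i) ∧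
      x (τ 3) = -∑ i : Fin 3, x (τ i.castSucc) * r i := by
  have h (i : Fin 3) : (Fin.snoc t (-∑ i, t i * r i) : Fin 4 → K) i.castSucc = t i :=
    Fin.snoc_castSucc (α := fun _ => K) _ _ _
  have h3 : (Fin.snoc t (-∑ i, t i * r i) : Fin 4 → K) 3 = -∑ i, t i * r i :=
    Fin.snoc_last (α := fun _ => K) _ _
  refine ⟨fun s => (Fin.snoc t (-∑ i, t i * r i) : Fin 4 → K) (τ.symm s), fun i => ?_, ?_⟩
  · simp
  · simpa only [Equiv.symm_apply_apply, h] using h3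

theorem eq_of_forall_castSucc (τ : Equiv.Perm (Fin 4)) (r : Fin 3 → K) {x x' : Fin 4 → K}
    (hx : x (τ 3) = -∑ i : Fin 3, x (τ i.castSucc) * r i)
    (hx' : x' (τ 3) = -∑ i : Fin 3, x' (τ i.castSucc) * r i)
    (h : ∀ i : Fin 3, x (τ i.castSucc) = x' (τ i.castSucc)) : x = x' := by
  funext s
  obtain ⟨s, rfl⟩ := τ.surjective s
  induction s using Fin.lastCases with
  | last =>
    change x (τ 3) = x' (τ 3)
    rw [hx, hx']
    simp only [h]
  | cast i => exact h i

/-- The singular members of the hyperplane of quadrics through the line joining `p` and `q`: three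
of them are singular on the line; the others do not lie over a point of contact. -/
theorem IsPairFrame.exists_contact [IsAlgClosed K]
    (hred : ∀ (y : Fin 5 → K) (x : Fin 4 → K), y ≠ 0 → quadrics A y = 0 →
      (contract A x).mulVec y = 0 → x = 0)
    (hF : IsPairFrame A p q a b σ τ r) (hτ : polar A p q (τ 3) ≠ 0)
    (hT : IsTameNet (netN A p q σ τ r) (netS A σ τ r)) :
    ∃ (x : Fin 3 → Fin 4 → K) (ρ : Fin 3 → K), (∀ m, x m ≠ 0) ∧
      (∀ m m' (c : K), c • x m = x m' → m = m') ∧ (∀ m, ρ m ≠ 0) ∧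
      (∀ m, polar A p q ⬝ᵥ x m = 0) ∧
      (∀ m, (contract A (x m)).mulVec (ρ m • p + q) = 0) ∧
      (∀ m y', (contract A (x m)).mulVec y' = 0 → ∃ c : K, c • (ρ m • p + q) = y') ∧
      ∀ x', x' ≠ 0 → polar A p q ⬝ᵥ x' = 0 → ∀ y, y ≠ 0 → (contract A x').mulVec y = 0 →
        (∃ (m : Fin 3) (c : K), c • x m = x') ∨
          (∀ y', (contract A x').mulVec y' = 0 → ∃ c : K, c • y = y') ∧
            ∀ c : K, quadrics A y ≠ c • polar A p q := by
  have hdet := frame_det_ne_zero hF.minor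
  obtain ⟨ρ, t, ht, hprop, hker, huniq⟩ := exists_three_singular_members hT.disc_ne_zero
  choose x hxt hx3 using fun m => exists_extension_of_hyperplane τ r (t m)
  have hcon (m : Fin 3) : contract A (x m) = ∑ i : Fin 3, t m i • redSlice A τ r i := by
    rw [contract_eq_sum_redSlice A τ r (hx3 m)]
    simp only [hxt]
  have hfr (m : Fin 3) : (frame p q σ).mulVec (Fin.append ![ρ m, 1] (0 : Fin 3 → K)) =
      ρ m • p + q := by
    rw [frame_mulVec_append]
    simp
  have hxne (m : Fin 3) : x m ≠ 0 := fun h => ht m (funext fun i => by rw [← hxt, h]; rfl)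
  have hkerx (m : Fin 3) : (contract A (x m)).mulVec (ρ m • p + q) = 0 := by
    rw [hcon, ← hfr, hF.mulVec_eq_zero_iff]
    exact ⟨fun γ => by simp, fun j => by simpa using hker m j⟩
  have hw (m : Fin 3) : (![ρ m, 1] : Fin 2 → K) ≠ 0 := fun h => by simpa using congrFun h 1
  have hq : q ≠ 0 := fun h => by simpa [h] using hF.right_coord
  refine ⟨x, ρ, hxne, fun m m' c h => hprop m m' c ?_, fun m h0 => ?_, fun m => ?_, hkerx, ?_, ?_⟩
  · funext i
    rw [← hxt m', ← h, Pi.smul_apply, Pi.smul_apply, hxt]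
  -- If ρ m = 0, a member of the web would be singular at the Cayley point q.
  · refine hxne m (hred q _ hq hF.right ?_)
    have := hkerx m
    rwa [h0, zero_smul, zero_add] at this
  · rw [hF.dotProduct_polar_eq_zero_iff hτ, hx3]
  · intro m y' hy'
    obtain ⟨w, v, rfl⟩ := exists_frame_coords hdet y'
    rw [hcon, hF.mulVec_eq_zero_iff] at hy'
    -- Tameness places the whole kernel on the secant, where the root ρ m determines it up to a
    -- scalar.
    obtain rfl := hT.eq_zero_of_singular_on_line (t m) v ![ρ m, 1] w (ht m) (hw m) (hker m)
      hy'.1 hy'.2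
    by_cases hw0 : w = 0
    · refine ⟨0, ?_⟩
      rw [frame_mulVec_append, hw0]
      simp
    obtain ⟨m', ⟨c, hc⟩, d, rfl⟩ := huniq (t m) w (ht m) hw0 fun j => by simpa using hy'.2 j
    obtain rfl := hprop _ _ _ hc
    refine ⟨d, ?_⟩
    rw [← hfr, ← Matrix.mulVec_smul, smul_append, smul_zero]
  · intro x' hx' hpl y hy hxy
    rw [hF.dotProduct_polar_eq_zero_iff hτ] at hpl
    have ht' : (fun i : Fin 3 => x' (τ i.castSucc)) ≠ 0 := fun h => hx' (eq_of_forall_castSucc τ r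
      hpl (by simp) (fun i => congrFun h i))
    have hcon' := contract_eq_sum_redSlice A τ r hpl
    -- Either the member is singular at a point of the secant and is one of the three, or N(x') has
    -- rank two.
    by_cases hsing : ∃ w : Fin 2 → K, w ≠ 0 ∧
        ∀ j, ∑ γ, w γ * ∑ i : Fin 3, x' (τ i.castSucc) * netN A p q σ τ r i γ j = 0
    · left
      obtain ⟨w, hw0, hwN⟩ := hsing
      obtain ⟨m, ⟨c, hc⟩, -⟩ := huniq _ w ht' hw0 hwN
      refine ⟨m, c, eq_of_forall_castSucc τ r ?_ hpl fun i => ?_⟩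
      · simp only [Pi.smul_apply, smul_eq_mul, hx3, Finset.mul_sum, mul_neg, mul_assoc]
      · rw [Pi.smul_apply, hxt]
        exact congrFun hc i
    · right
      push Not at hsing
      have hsing' (w : Fin 2 → K) (h : ∀ j, ∑ γ, w γ * ∑ i : Fin 3, x' (τ i.castSucc) *
          netN A p q σ τ r i γ j = 0) : w = 0 := by
        by_contra hw0
        obtain ⟨j, hj⟩ := hsing w hw0
        exact hj (h j)
      obtain ⟨w, v, rfl⟩ := exists_frame_coords hdet y
      rw [hcon', hF.mulVec_eq_zero_iff] at hxy
      have hv : v ≠ 0 := by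
        rintro rfl
        have hw0 := hsing' w fun j => by simpa using hxy.2 j
        refine hy ?_
        rw [frame_mulVec_append, hw0]
        simp
      refine ⟨fun y' hy' => ?_, fun c hc => ?_⟩
      · obtain ⟨w', v', rfl⟩ := exists_frame_coords hdet y'
        rw [hcon', hF.mulVec_eq_zero_iff] at hy'
        obtain ⟨c, rfl⟩ := exists_smul_eq_of_mulVec_injective
          (Matrix.of fun (j : Fin 3) (γ : Fin 2) =>
            ∑ i : Fin 3, x' (τ i.castSucc) * netN A p q σ τ r i γ j) (by simp)
          (fun w h => hsing' w fun j => by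
            simpa [Matrix.mulVec, dotProduct, mul_comm] using congrFun h j)
          hv (funext fun γ => hxy.1 γ) (funext fun γ => hy'.1 γ)
        have hw' : w' - c • w = 0 := hsing' _ fun j => by
          have h1 := hxy.2 j
          have h2 := hy'.2 j
          simp only [Fin.sum_univ_two, Fin.sum_univ_three, Pi.smul_apply, Pi.sub_apply,
            smul_eq_mul] at h1 h2 ⊢
          linear_combination h2 - c * h1
        rw [sub_eq_zero] at hw'
        refine ⟨c, ?_⟩
        rw [hw', ← Matrix.mulVec_smul, smul_append]
      -- Proportionality would make y a base point of the net at which the member x' is singular.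
      · refine hv (hT.eq_zero_of_singular _ v w ht' hxy.1 hxy.2 fun i => ?_)
        rw [← hF.dotProduct_redSlice]
        exact hF.mulVec_redSlice_eq_zero hc i

end PairFrame

/-! ### From secant lines to tritangent planes -/

section Secant

variable {K : Type*} [Field K]

/-- The open conditions under which secant lines of the Cayley variety and distinguished tritangent
planes correspond to each other. -/
structure IsGeneral (A : Tensor K) : Prop where
  reduced : ∀ (y : Fin 5 → K) (x : Fin 4 → K), y ≠ 0 → quadrics A y = 0 →
    (contract A x).mulVec y = 0 → x = 0
  tame : ∀ (a b : Fin 5) (σ : Equiv.Perm (Fin 5)) (τ : Equiv.Perm (Fin 4)) (p q : Fin 5 → K)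
    (r : Fin 3 → K), IsPairFrame A p q a b σ τ r → IsTameNet (netN A p q σ τ r) (netS A σ τ r)

variable {A : Tensor K}

theorem polar_add_right (A : Tensor K) (y u v : Fin 5 → K) :
    polar A y (u + v) = polar A y u + polar A y v := by
  ext i
  simp [polar, Matrix.mulVec_add, dotProduct_add]

theorem polar_smul_right (A : Tensor K) (c : K) (y u : Fin 5 → K) :
    polar A y (c • u) = c • polar A y u := by
  simpa using polar_smul_smul A 1 c y u

theorem quadrics_add (A : Tensor K) (s t : K) (u v : Fin 5 → K) :
    quadrics A (s • u + t • v) =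
      s ^ 2 • quadrics A u + (2 * s * t) • polar A u v + t ^ 2 • quadrics A v := by
  change polar A _ _ = _ • polar A u u + _ + _ • polar A v v
  rw [polar_add_right, polar_comm A _ (s • u), polar_comm A _ (t • v), polar_add_right,
    polar_add_right, polar_smul_smul, polar_smul_smul, polar_smul_smul, polar_smul_smul,
    polar_comm A v u]
  ext i
  simp only [Pi.add_apply, Pi.smul_apply, smul_eq_mul]
  ring

theorem quadrics_smul (A : Tensor K) (c : K) (y : Fin 5 → K) :
    quadrics A (c • y) = c ^ 2 • quadrics A y := by
  rw [pow_two]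
  exact polar_smul_smul A c c y y

/-- The tangent lines of the Cayley variety at its points are trivial. -/
theorem IsGeneral.polar_ne_zero (hA : IsGeneral A) {p y : Fin 5 → K} (hp : p ≠ 0)
    (hq : quadrics A p = 0) (hy : ∀ c : K, c • p ≠ y) : polar A p y ≠ 0 := by
  intro h
  -- Reducedness says that the 5×4 matrix with columns A_i p is injective. Its left kernel is a line
  -- containing both p and y.
  obtain ⟨c, hc⟩ := exists_smul_eq_of_mulVec_injective
    (Matrix.of fun (l : Fin 5) (i : Fin 4) => (slice A i).mulVec p l) (by simp)
    (fun x hx => hA.reduced p x hp hq (by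
      rw [← hx]
      ext l
      rw [contract, Matrix.sum_mulVec, Finset.sum_apply]
      simp only [Matrix.smul_mulVec, Pi.smul_apply, smul_eq_mul, mul_comm (x _)]
      rfl))
    hp (funext fun i => congrFun hq i)
    (v' := y) (funext fun i => by
      rw [polar_comm] at h
      exact congrFun h i)
  exact hy c hc

theorem exists_perm_apply_zero_one {i j : Fin 5} (h : i ≠ j) :
    ∃ σ : Equiv.Perm (Fin 5), σ 0 = i ∧ σ 1 = j := by
  have hk : Equiv.swap 0 i j ≠ 0 := fun h0 => h (by
    have := congrArg (Equiv.swap 0 i) h0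
    rw [Equiv.swap_apply_self, Equiv.swap_apply_left] at this
    exact this.symm)
  refine ⟨(Equiv.swap 1 (Equiv.swap 0 i j)).trans (Equiv.swap 0 i), ?_, ?_⟩
  · rw [Equiv.trans_apply, Equiv.swap_apply_of_ne_of_ne (by decide) hk.symm, Equiv.swap_apply_left]
  · rw [Equiv.trans_apply, Equiv.swap_apply_left, Equiv.swap_apply_self]

/-- The permutation σ moves a nonzero minor of (p, q) to the first two places, and τ moves a nonzero
coordinate of A(·,p,q) to the last, so that the ratios r exist. -/
theorem IsGeneral.exists_isPairFrame (hA : IsGeneral A) {P Q : P4 K} (hP : P ∈ cayleyVariety A)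
    (hQ : Q ∈ cayleyVariety A) (hPQ : P ≠ Q) :
    ∃ (p q : Fin 5 → K) (a b : Fin 5) (σ : Equiv.Perm (Fin 5)) (τ : Equiv.Perm (Fin 4))
      (r : Fin 3 → K), P.submodule = K ∙ p ∧ Q.submodule = K ∙ q ∧
        (∀ s t : K, s • p + t • q = 0 → s = 0 ∧ t = 0) ∧
        IsPairFrame A p q a b σ τ r ∧ polar A p q (τ 3) ≠ 0 := by
  have hli := LinearIndependent.pair_iff.1 (Projectivization.linearIndependent_pair_iff_ne.2 hPQ)
  obtain ⟨a, ha⟩ := Function.ne_iff.1 P.rep_nonzero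
  obtain ⟨b, hb⟩ := Function.ne_iff.1 Q.rep_nonzero
  have ha' : P.rep a ≠ 0 := ha
  have hb' : Q.rep b ≠ 0 := hb
  set p := (P.rep a)⁻¹ • P.rep with hp
  set q := (Q.rep b)⁻¹ • Q.rep with hq
  have hpa : p a = 1 := inv_mul_cancel₀ ha'
  have hqb : q b = 1 := inv_mul_cancel₀ hb'
  have hli' (s t : K) (h : s • p + t • q = 0) : s = 0 ∧ t = 0 := by
    rw [hp, hq, smul_smul, smul_smul] at h
    simpa [ha', hb'] using hli _ _ h
  have hpC : quadrics A p = 0 := by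
    rw [hp, quadrics_smul, hP, smul_zero]
  have hqC : quadrics A q = 0 := by
    rw [hq, quadrics_smul, hQ, smul_zero]
  have hp0 : p ≠ 0 := fun h => by simp [h] at hpa
  have hne (c : K) : c • p ≠ q := fun h => by
    simpa using (hli' c (-1) (by rw [h]; simp)).2
  have hpol := hA.polar_ne_zero hp0 hpC hne
  have hj : ∃ j, p a * q j - p j * q a ≠ 0 := by
    by_contra! h
    refine hne (q a) (funext fun j => ?_)
    have := h j
    rw [hpa] at this
    rw [Pi.smul_apply, smul_eq_mul]
    linear_combination -this
  obtain ⟨j, hj⟩ := hj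
  obtain ⟨σ, h0, h1⟩ := exists_perm_apply_zero_one (i := a) (j := j) (by
    rintro rfl
    exact hj (by ring))
  obtain ⟨s, hs⟩ := Function.ne_iff.1 hpol
  have hs' : polar A p q s ≠ 0 := hs
  have h3 : polar A p q (Equiv.swap 3 s 3) ≠ 0 := by rwa [Equiv.swap_apply_left]
  refine ⟨p, q, a, b, σ, Equiv.swap 3 s,
    fun i => polar A p q (Equiv.swap 3 s i.castSucc) / polar A p q (Equiv.swap 3 s 3), ?_, ?_, hli',
    ⟨hpC, hqC, hpa, hqb, by rwa [h0, h1], fun i => div_mul_cancel₀ _ h3⟩, h3⟩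
  · rw [Projectivization.submodule_eq, hp,
      Submodule.span_singleton_smul_eq (isUnit_iff_ne_zero.2 (inv_ne_zero ha'))]
  · rw [Projectivization.submodule_eq, hq,
      Submodule.span_singleton_smul_eq (isUnit_iff_ne_zero.2 (inv_ne_zero hb'))]

theorem exists_smul_of_submodule_le {P Q y : P4 K} {p q : Fin 5 → K} (hP : P.submodule = K ∙ p)
    (hQ : Q.submodule = K ∙ q) (h : y.submodule ≤ P.submodule ⊔ Q.submodule) :
    ∃ s t : K, s • p + t • q = y.rep := by
  have hy : y.rep ∈ P.submodule ⊔ Q.submodule := h (by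
    rw [Projectivization.submodule_eq]
    exact Submodule.mem_span_singleton_self _)
  rw [hP, hQ, ← Submodule.span_insert] at hy
  exact Submodule.mem_span_pair.1 hy

theorem submodule_mk_le {P Q : P4 K} {p q : Fin 5 → K} (hP : P.submodule = K ∙ p)
    (hQ : Q.submodule = K ∙ q) (s t : K) (h : s • p + t • q ≠ 0) :
    (Projectivization.mk K (s • p + t • q) h).submodule ≤ P.submodule ⊔ Q.submodule := by
  rw [Projectivization.submodule_mk, Submodule.span_singleton_le_iff_mem, hP, hQ,
    ← Submodule.span_insert]
  exact Submodule.mem_span_pair.2 ⟨s, t, rfl⟩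

/-- On the line only the mixed term 2st·A(·,p,q) survives. The point p + q, with value 2·A(·,p,q) ≠
0, shows that the image is nonempty. -/
theorem psiImage_eq_singleton (h2 : (2 : K) ≠ 0) {P Q : P4 K} {p q : Fin 5 → K}
    (hP : P.submodule = K ∙ p) (hQ : Q.submodule = K ∙ q) (hp : quadrics A p = 0)
    (hq : quadrics A q = 0) (hli : ∀ s t : K, s • p + t • q = 0 → s = 0 ∧ t = 0)
    (hpol : polar A p q ≠ 0) :
    psiImage A (P.submodule ⊔ Q.submodule) = {Projectivization.mk K (polar A p q) hpol} := by
  have hquad (s t : K) : quadrics A (s • p + t • q) = (2 * s * t) • polar A p q := by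
    rw [quadrics_add, hp, hq, smul_zero, smul_zero, zero_add, add_zero]
  ext h
  constructor
  · rintro ⟨y, hy, hq0, rfl⟩
    obtain ⟨s, t, hst⟩ := exists_smul_of_submodule_le hP hQ hy
    rw [Set.mem_singleton_iff, Projectivization.mk_eq_mk_iff']
    exact ⟨2 * s * t, by rw [← hst, hquad]⟩
  · rintro rfl
    have h1 : (1 : K) • p + (1 : K) • q ≠ 0 := fun h => one_ne_zero (hli 1 1 h).1
    obtain ⟨c, hc⟩ := Projectivization.exists_smul_eq_mk_rep K _ h1
    have hc' : quadrics A (Projectivization.mk K _ h1).rep =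
        ((c : K) ^ 2 * 2) • polar A p q := by
      rw [← hc, Units.smul_def, quadrics_smul, hquad, smul_smul]
      congr 1
      ring
    have hc2 : (c : K) ^ 2 * 2 ≠ 0 := mul_ne_zero (pow_ne_zero _ c.ne_zero) h2
    refine ⟨Projectivization.mk K _ h1, submodule_mk_le hP hQ 1 1 h1, ?_, ?_⟩
    · rw [hc']
      exact smul_ne_zero hc2 hpol
    · rw [Projectivization.mk_eq_mk_iff']
      exact ⟨((c : K) ^ 2 * 2)⁻¹, by rw [hc', smul_smul, inv_mul_cancel₀ hc2, one_smul]⟩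

theorem ker_eq_span {x : P3 K} {y : Fin 5 → K} (hy : y ≠ 0) (h : (contract A x.rep).mulVec y = 0)
    (h' : ∀ y', (contract A x.rep).mulVec y' = 0 → ∃ c : K, c • y = y') :
    IsKernelImage A x (Projectivization.mk K y hy) := by
  rw [IsKernelImage, Projectivization.submodule_mk]
  ext z
  rw [LinearMap.mem_ker, Matrix.mulVecLin_apply, Submodule.mem_span_singleton]
  refine ⟨h' z, ?_⟩
  rintro ⟨c, rfl⟩
  rw [Matrix.mulVec_smul, h, smul_zero]

/-- A secant line of the Cayley variety is contracted to a plane whose points of contact are three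
smooth points of the symmetroid, with kernels on the line. -/
theorem IsGeneral.exists_plane_of_secant [IsAlgClosed K] (hA : IsGeneral A) (h2 : (2 : K) ≠ 0)
    {P Q : P4 K} (hP : P ∈ cayleyVariety A) (hQ : Q ∈ cayleyVariety A) (hPQ : P ≠ Q) :
    ∃ h : DualP3 K, psiImage A (P.submodule ⊔ Q.submodule) = {h} ∧
      (contactPoints A h).ncard = 3 ∧ ∀ x ∈ contactPoints A h, IsSmoothPoint A x ∧
        ∃ y : P4 K, IsKernelImage A x y ∧ y.submodule ≤ P.submodule ⊔ Q.submodule := by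
  obtain ⟨p, q, a, b, σ, τ, r, hPp, hQq, hli, hF, hτ⟩ := hA.exists_isPairFrame hP hQ hPQ
  have hpol : polar A p q ≠ 0 := fun h => hτ (by rw [h]; rfl)
  obtain ⟨x, ρ, hx0, hxinj, hρ, hxpl, hker, huniq, hother⟩ :=
    hF.exists_contact hA.reduced hτ (hA.tame _ _ _ _ _ _ _ hF)
  refine ⟨_, psiImage_eq_singleton h2 hPp hQq hF.left hF.right hli hpol, ?_⟩
  set h : DualP3 K := Projectivization.mk K (polar A p q) hpol with hh
  obtain ⟨α, hα⟩ := Projectivization.exists_smul_eq_mk_rep K _ hpol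
  rw [← hh, Units.smul_def] at hα
  have hdot (v : Fin 4 → K) : h.rep ⬝ᵥ v = 0 ↔ polar A p q ⬝ᵥ v = 0 := by
    rw [← hα, smul_dotProduct, smul_eq_mul, mul_eq_zero, or_iff_right α.ne_zero]
  let X (m : Fin 3) : P3 K := Projectivization.mk K (x m) (hx0 m)
  have hy0 (m : Fin 3) : ρ m • p + (1 : K) • q ≠ 0 := fun h => one_ne_zero (hli _ _ h).2
  have hX (m : Fin 3) : ∃ c : K, c ≠ 0 ∧ c • x m = (X m).rep := by
    obtain ⟨c, hc⟩ := Projectivization.exists_smul_eq_mk_rep K _ (hx0 m)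
    exact ⟨c, c.ne_zero, hc⟩
  have hkerX (m : Fin 3) : (contract A (X m).rep).mulVec (ρ m • p + (1 : K) • q) = 0 := by
    obtain ⟨c, -, hc⟩ := hX m
    rw [← hc, contract_smul, Matrix.smul_mulVec, one_smul, hker, smul_zero]
  have huniqX (m : Fin 3) (y' : Fin 5 → K) (h : (contract A (X m).rep).mulVec y' = 0) :
      ∃ c : K, c • (ρ m • p + (1 : K) • q) = y' := by
    obtain ⟨c, hc0, hc⟩ := hX m
    rw [← hc, contract_smul, Matrix.smul_mulVec] at h
    rw [one_smul]
    exact huniq m y' ((smul_eq_zero.1 h).resolve_left hc0)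
  have hgrad (m : Fin 3) : ∃ κ : K, κ ≠ 0 ∧ gradient A (X m) = κ • polar A p q := by
    obtain ⟨κ, hκ, hκ0⟩ := exists_gradient_eq_smul_quadrics (hy0 m) (hkerX m)
    refine ⟨κ * (2 * ρ m * 1), mul_ne_zero (hκ0 (huniqX m))
      (mul_ne_zero (mul_ne_zero h2 (hρ m)) one_ne_zero), ?_⟩
    rw [hκ, quadrics_add, hF.left, hF.right, smul_zero, smul_zero, zero_add, add_zero, smul_smul]
  have hsymm (m : Fin 3) : X m ∈ symmetroid A := mem_symmetroid_iff.2 ⟨_, hy0 m, hkerX m⟩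
  have hcontact : contactPoints A h = Set.range X := by
    ext x'
    constructor
    · rintro ⟨h1, h3, h4⟩
      obtain ⟨y, hy, hxy⟩ := mem_symmetroid_iff.1 h1
      rcases hother x'.rep x'.rep_nonzero ((hdot _).1 h3) y hy hxy with ⟨m, c, hc⟩ | ⟨h5, h6⟩
      · refine ⟨m, ?_⟩
        rw [← x'.mk_rep, eq_comm, Projectivization.mk_eq_mk_iff']
        exact ⟨c, hc⟩
      -- The corank is one here, so the gradient is a nonzero multiple of the quadrics at y;
      -- tangency along h would make these proportional to A(·,p,q).
      · exfalso
        obtain ⟨κ, hκ, hκ0⟩ := exists_gradient_eq_smul_quadrics hy hxy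
        obtain ⟨c, hc⟩ := exists_eq_smul_of_forall_dotProduct hpol fun v hv =>
          h4 v ((hdot v).2 hv)
        refine h6 (κ⁻¹ * c) ?_
        rw [← smul_smul, ← hc, hκ, smul_smul, inv_mul_cancel₀ (hκ0 h5), one_smul]
    · rintro ⟨m, rfl⟩
      refine ⟨hsymm m, (hdot _).2 ?_, fun v hv => ?_⟩
      · obtain ⟨c, -, hc⟩ := hX m
        rw [← hc, dotProduct_smul, hxpl, smul_zero]
      · obtain ⟨κ, -, hκ⟩ := hgrad m
        rw [hκ, smul_dotProduct, (hdot v).1 hv, smul_zero]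
  have hXinj : Function.Injective X := fun m m' h => by
    obtain ⟨c, hc⟩ := (Projectivization.mk_eq_mk_iff' K _ _ _ _).1 h
    exact (hxinj m' m c hc).symm
  rw [hcontact]
  refine ⟨?_, ?_⟩
  · rw [← Set.image_univ, Set.ncard_image_of_injective _ hXinj, Set.ncard_univ]
    simp
  · rintro _ ⟨m, rfl⟩
    refine ⟨⟨hsymm m, ?_⟩, _, ker_eq_span (hy0 m) (hkerX m) (huniqX m),
      submodule_mk_le hPp hQq _ _ (hy0 m)⟩
    obtain ⟨κ, hκ0, hκ⟩ := hgrad m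
    rw [hκ]
    exact smul_ne_zero hκ0 hpol

end Secant

/-! ### From tritangent planes to secant lines, and the counts -/

section Tritangent

variable {K : Type*} [Field K]

theorem finrank_sup_submodule {P Q : P4 K} (h : P ≠ Q) :
    Module.finrank K (P.submodule ⊔ Q.submodule : Submodule K (Fin 5 → K)) = 2 := by
  have h1 := Submodule.finrank_sup_add_finrank_inf_eq P.submodule Q.submodule
  rw [P.finrank_submodule, Q.finrank_submodule] at h1
  have h2 : Module.finrank K (P.submodule ⊓ Q.submodule : Submodule K (Fin 5 → K)) = 0 := by
    by_contra h0
    have hP := Submodule.eq_of_le_of_finrank_le (inf_le_left : P.submodule ⊓ Q.submodule ≤ _)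
      (by rw [P.finrank_submodule]; omega)
    have hQ := Submodule.eq_of_le_of_finrank_le (inf_le_right : P.submodule ⊓ Q.submodule ≤ _)
      (by rw [Q.finrank_submodule]; omega)
    exact h (Projectivization.submodule_injective (hP.symm.trans hQ))
  omega

theorem sup_submodule_eq {L : Submodule K (Fin 5 → K)} (hL : IsLine L) {P Q : P4 K} (h : P ≠ Q)
    (hP : P.submodule ≤ L) (hQ : Q.submodule ≤ L) : P.submodule ⊔ Q.submodule = L :=
  Submodule.eq_of_le_of_finrank_le (sup_le hP hQ) (by rw [finrank_sup_submodule h, hL])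

variable {A : Tensor K}

theorem IsKernelImage.mulVec_rep {x : P3 K} {y : P4 K} (h : IsKernelImage A x y) :
    (contract A x.rep).mulVec y.rep = 0 := by
  have : y.rep ∈ LinearMap.ker (contract A x.rep).mulVecLin := by
    rw [h, Projectivization.submodule_eq]
    exact Submodule.mem_span_singleton_self _
  exact this

theorem contract_add (A : Tensor K) (x x' : Fin 4 → K) :
    contract A (x + x') = contract A x + contract A x' := by
  simp [contract, add_smul, Finset.sum_add_distrib]

/-- If two smooth points of contact had the same kernel, all points of the line joining them would
be points of contact. -/
theorem kernelImage_ne [Infinite K] {h : DualP3 K} (hfin : (contactPoints A h).Finite)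
    {x x' : P3 K} (hx : x ∈ contactPoints A h) (hx' : x' ∈ contactPoints A h)
    (hs : IsSmoothPoint A x) (hne : x ≠ x') {y y' : P4 K} (hy : IsKernelImage A x y)
    (hy' : IsKernelImage A x' y') : y ≠ y' := by
  rintro rfl
  have hli := LinearIndependent.pair_iff.1 (Projectivization.linearIndependent_pair_iff_ne.2 hne)
  have h0 (s : K) : x.rep + s • x'.rep ≠ 0 := fun h0 =>
    one_ne_zero (hli 1 s (by rwa [one_smul])).1
  refine Set.infinite_of_injective_forall_mem
    (f := fun s : K => (Projectivization.mk K _ (h0 s) : P3 K)) ?_ ?_ hfin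
  · intro s s' hss
    obtain ⟨c, hc⟩ := (Projectivization.mk_eq_mk_iff' K _ _ _ _).1 hss
    obtain ⟨h1, h2⟩ := hli (c - 1) (c * s' - s) (by
      rw [sub_smul, sub_smul, ← smul_smul, one_smul, ← sub_eq_zero.2 hc, smul_add]
      abel)
    rw [sub_eq_zero.1 h1, one_mul] at h2
    exact (sub_eq_zero.1 h2).symm
  · intro s
    obtain ⟨c, hc⟩ := Projectivization.exists_smul_eq_mk_rep K _ (h0 s)
    have hker : (contract A (Projectivization.mk K _ (h0 s)).rep).mulVec y.rep = 0 := by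
      rw [← hc, Units.smul_def, contract_smul, contract_add, contract_smul, Matrix.smul_mulVec,
        Matrix.add_mulVec, Matrix.smul_mulVec, hy.mulVec_rep, hy'.mulVec_rep]
      simp
    refine ⟨mem_symmetroid_iff.2 ⟨_, y.rep_nonzero, hker⟩, ?_, fun v hv => ?_⟩
    · change h.rep ⬝ᵥ _ = 0
      have h1 : h.rep ⬝ᵥ x.rep = 0 := hx.2.1
      have h2 : h.rep ⬝ᵥ x'.rep = 0 := hx'.2.1
      rw [← hc, Units.smul_def, dotProduct_smul, dotProduct_add, dotProduct_smul, h1, h2]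
      simp
    -- Both gradients are multiples of the quadrics at the common kernel vector. At x the multiple
    -- is nonzero by smoothness, so that vector vanishes along h.
    · obtain ⟨κ, hκ, -⟩ := exists_gradient_eq_smul_quadrics y.rep_nonzero hker
      obtain ⟨κ', hκ', -⟩ := exists_gradient_eq_smul_quadrics y.rep_nonzero hy.mulVec_rep
      have hκ0 : κ' ≠ 0 := by
        rintro rfl
        exact hs.2 (by rw [hκ', zero_smul])
      have h3 := hx.2.2 v hv
      rw [hκ', smul_dotProduct, smul_eq_mul, mul_eq_zero, or_iff_right hκ0] at h3
      rw [hκ, smul_dotProduct, h3, smul_zero]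

/-- At a smooth contact point the nonzero gradient is proportional both to the quadrics at the
kernel and to the equation of the plane. -/
theorem exists_quadrics_eq_smul {h : DualP3 K} {x : P3 K} (hx : x ∈ contactPoints A h)
    (hs : IsSmoothPoint A x) {y : P4 K} (hy : IsKernelImage A x y) :
    ∃ c : K, c ≠ 0 ∧ quadrics A y.rep = c • h.rep := by
  obtain ⟨κ, hκ, -⟩ := exists_gradient_eq_smul_quadrics y.rep_nonzero hy.mulVec_rep
  obtain ⟨c, hc⟩ := exists_eq_smul_of_forall_dotProduct h.rep_nonzero hx.2.2
  have hκ0 : κ ≠ 0 := by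
    rintro rfl
    exact hs.2 (by rw [hκ, zero_smul])
  have hc0 : c ≠ 0 := by
    rintro rfl
    exact hs.2 (by rw [hc, zero_smul])
  refine ⟨κ⁻¹ * c, mul_ne_zero (inv_ne_zero hκ0) hc0, ?_⟩
  rw [← smul_smul, ← hc, hκ, smul_smul, inv_mul_cancel₀ hκ0, one_smul]

/-- A line on which the four quadrics are the multiples of a fixed vector by a binary quadratic form
is a secant line of the Cayley variety. -/
theorem IsGeneral.exists_pair_of_proportional [IsAlgClosed K] (hA : IsGeneral A)
    (h2 : (2 : K) ≠ 0) {u v : Fin 5 → K} (hli : ∀ s t : K, s • u + t • v = 0 → s = 0 ∧ t = 0)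
    {H : Fin 4 → K} {a b c : K} (ha : a ≠ 0) (hu : quadrics A u = a • H)
    (hv : quadrics A v = b • H) (huv : polar A u v = c • H) :
    ∃ s t : K, s ≠ t ∧ quadrics A (s • u + a • v) = 0 ∧ quadrics A (t • u + a • v) = 0 := by
  -- At su + av the form is a(s² + 2cs + ab), with roots s = -c ± δ where δ² = c² - ab.
  obtain ⟨δ, hδ⟩ := IsAlgClosed.exists_pow_nat_eq (c ^ 2 - a * b) (n := 2) (by norm_num)
  have hroot (δ : K) (hδ : δ ^ 2 = c ^ 2 - a * b) : quadrics A ((δ - c) • u + a • v) = 0 := by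
    rw [quadrics_add, hu, hv, huv, smul_smul, smul_smul, smul_smul, ← add_smul, ← add_smul]
    convert zero_smul K H using 2
    linear_combination a * hδ
  refine ⟨δ - c, -δ - c, fun h => ?_, hroot δ hδ, hroot (-δ) (by rw [neg_sq, hδ])⟩
  have h0 : δ = 0 := by
    have : 2 * δ = 0 := by linear_combination h
    exact (mul_eq_zero.1 this).resolve_left h2
  -- A double root would be a Cayley point polar to u, that is, the line would be tangent there to
  -- all four quadrics.
  refine hA.polar_ne_zero (p := (δ - c) • u + a • v) (y := u) ?_ (hroot δ hδ) ?_ ?_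
  · exact fun h => ha (hli _ _ h).2
  · intro e he
    obtain ⟨h3, h4⟩ := hli (e * (δ - c) - 1) (e * a) (by
      rw [← sub_eq_zero.2 he]
      module)
    rw [(mul_eq_zero.1 h4).resolve_right ha] at h3
    simp at h3
  · rw [polar_comm, polar_add_right, polar_smul_right, polar_smul_right, huv]
    change _ • quadrics A u + _ = 0
    rw [hu, smul_smul, smul_smul, ← add_smul, h0]
    convert zero_smul K H using 2
    ring

/-- The line through the kernels of the contact points of a distinguished tritangent plane is a
secant line of the Cayley variety. -/
theorem IsGeneral.mem_secantLines [IsAlgClosed K] (hA : IsGeneral A) (h2 : (2 : K) ≠ 0)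
    {h : DualP3 K} (htri : IsTritangent A h) (hs : ∀ x ∈ contactPoints A h, IsSmoothPoint A x)
    {L : Submodule K (Fin 5 → K)} (hL : IsLine L)
    (hcol : ∀ x ∈ contactPoints A h, ∃ y : P4 K, IsKernelImage A x y ∧ y.submodule ≤ L) :
    L ∈ secantLines A ∧ psiImage A L = {h} := by
  obtain ⟨x₁, x₂, x₃, h12, h13, h23, hset⟩ := Set.ncard_eq_three.1 htri
  have hfin : (contactPoints A h).Finite := Set.finite_of_ncard_ne_zero (by rw [htri]; norm_num)
  have hx₁ : x₁ ∈ contactPoints A h := by simp [hset]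
  have hx₂ : x₂ ∈ contactPoints A h := by simp [hset]
  have hx₃ : x₃ ∈ contactPoints A h := by simp [hset]
  obtain ⟨y₁, hy₁, hl₁⟩ := hcol _ hx₁
  obtain ⟨y₂, hy₂, hl₂⟩ := hcol _ hx₂
  obtain ⟨y₃, hy₃, hl₃⟩ := hcol _ hx₃
  have n12 := kernelImage_ne hfin hx₁ hx₂ (hs _ hx₁) h12 hy₁ hy₂
  have n13 := kernelImage_ne hfin hx₁ hx₃ (hs _ hx₁) h13 hy₁ hy₃
  have n23 := kernelImage_ne hfin hx₂ hx₃ (hs _ hx₂) h23 hy₂ hy₃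
  obtain ⟨a, ha, hqa⟩ := exists_quadrics_eq_smul hx₁ (hs _ hx₁) hy₁
  obtain ⟨b, -, hqb⟩ := exists_quadrics_eq_smul hx₂ (hs _ hx₂) hy₂
  obtain ⟨d, -, hqd⟩ := exists_quadrics_eq_smul hx₃ (hs _ hx₃) hy₃
  have hli := LinearIndependent.pair_iff.1 (Projectivization.linearIndependent_pair_iff_ne.2 n12)
  have hLeq := sup_submodule_eq hL n12 hl₁ hl₂
  obtain ⟨s, t, hst⟩ := exists_smul_of_submodule_le y₁.submodule_eq y₂.submodule_eq
    (hl₃.trans hLeq.ge)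
  have hs0 : s ≠ 0 := by
    rintro rfl
    refine n23 ?_
    rw [← y₂.mk_rep, ← y₃.mk_rep, eq_comm, Projectivization.mk_eq_mk_iff']
    exact ⟨t, by rw [← hst, zero_smul, zero_add]⟩
  have ht0 : t ≠ 0 := by
    rintro rfl
    refine n13 ?_
    rw [← y₁.mk_rep, ← y₃.mk_rep, eq_comm, Projectivization.mk_eq_mk_iff']
    exact ⟨s, by rw [← hst, zero_smul, add_zero]⟩
  -- Expanding the quadrics at the third kernel sy₁ + ty₂, with s and t nonzero, shows that the
  -- mixed term is a multiple of h as well.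
  have hpolar : polar A y₁.rep y₂.rep =
      ((2 * s * t)⁻¹ * (d - s ^ 2 * a - t ^ 2 * b)) • h.rep := by
    rw [← hst, quadrics_add, hqa, hqb] at hqd
    have hst0 : 2 * s * t ≠ 0 := mul_ne_zero (mul_ne_zero h2 hs0) ht0
    rw [← smul_smul, sub_smul, sub_smul, ← hqd, eq_inv_smul_iff₀ hst0]
    module
  obtain ⟨α, β, hαβ, hα, hβ⟩ := hA.exists_pair_of_proportional h2 hli ha hqa hqb hpolar
  have hp0 (γ : K) : γ • y₁.rep + a • y₂.rep ≠ 0 := fun h => ha (hli _ _ h).2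
  have hmem (γ : K) (hγ : quadrics A (γ • y₁.rep + a • y₂.rep) = 0) :
      Projectivization.mk K _ (hp0 γ) ∈ cayleyVariety A := by
    obtain ⟨c, hc⟩ := Projectivization.exists_smul_eq_mk_rep K _ (hp0 γ)
    change quadrics A _ = 0
    rw [← hc, Units.smul_def, quadrics_smul, hγ, smul_zero]
  have hne : Projectivization.mk K _ (hp0 α) ≠ Projectivization.mk K _ (hp0 β) := by
    intro heq
    obtain ⟨c, hc⟩ := (Projectivization.mk_eq_mk_iff' K _ _ _ _).1 heq
    obtain ⟨h3, h4⟩ := hli (c * β - α) (c * a - a) (by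
      rw [← sub_eq_zero.2 hc]
      module)
    have hc1 : c = 1 := mul_right_cancel₀ ha (by rw [one_mul]; exact sub_eq_zero.1 h4)
    rw [hc1, one_mul] at h3
    exact hαβ (sub_eq_zero.1 h3).symm
  have hle (γ : K) : (Projectivization.mk K _ (hp0 γ)).submodule ≤ L :=
    (submodule_mk_le y₁.submodule_eq y₂.submodule_eq _ _ _).trans hLeq.le
  have hsup := sup_submodule_eq hL hne (hle α) (hle β)
  refine ⟨⟨_, hmem α hα, _, hmem β hβ, hne, hsup.symm⟩, ?_⟩
  obtain ⟨h', hpsi, -⟩ := hA.exists_plane_of_secant h2 (hmem α hα) (hmem β hβ) hne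
  rw [hsup] at hpsi
  rw [hpsi, Set.singleton_eq_singleton_iff, eq_comm]
  -- The point to which the secant is contracted is found by evaluating ψ at y₁, where it is h.
  have hq0 : quadrics A y₁.rep ≠ 0 := by
    rw [hqa]
    exact smul_ne_zero ha h.rep_nonzero
  have hin : Projectivization.mk K _ hq0 ∈ psiImage A L := ⟨y₁, hl₁, hq0, rfl⟩
  rw [hpsi, Set.mem_singleton_iff] at hin
  rw [← hin, ← h.mk_rep, eq_comm, Projectivization.mk_eq_mk_iff']
  exact ⟨a, hqa.symm⟩

theorem IsGeneral.isDistinguishedTritangent_iff [IsAlgClosed K] (hA : IsGeneral A)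
    (h2 : (2 : K) ≠ 0) (h : DualP3 K) :
    IsDistinguishedTritangent A h ↔ ∃ L ∈ secantLines A, psiImage A L = {h} := by
  constructor
  · rintro ⟨htri, hs, L, hL, hcol⟩
    exact ⟨L, hA.mem_secantLines h2 htri hs hL hcol⟩
  · rintro ⟨L, ⟨P, hP, Q, hQ, hPQ, rfl⟩, hpsi⟩
    obtain ⟨h', hpsi', h3, hc⟩ := hA.exists_plane_of_secant h2 hP hQ hPQ
    obtain rfl := Set.singleton_eq_singleton_iff.1 (hpsi.symm.trans hpsi')
    exact ⟨h3, fun x hx => (hc x hx).1, _, finrank_sup_submodule hPQ, fun x hx => (hc x hx).2⟩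

/-- The map from secants to planes is injective because the kernels at two contact points are
distinct points of the secant, so the plane recovers it. -/
theorem IsGeneral.ncard_distinguished [IsAlgClosed K] (hA : IsGeneral A) (h2 : (2 : K) ≠ 0) :
    {h : DualP3 K | IsDistinguishedTritangent A h}.ncard = (secantLines A).ncard := by
  have hex (L : Submodule K (Fin 5 → K)) (hL : L ∈ secantLines A) : ∃ h : DualP3 K,
      psiImage A L = {h} ∧ (contactPoints A h).ncard = 3 ∧ IsLine L ∧
        ∀ x ∈ contactPoints A h, IsSmoothPoint A x ∧
          ∃ y : P4 K, IsKernelImage A x y ∧ y.submodule ≤ L := by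
    obtain ⟨P, hP, Q, hQ, hPQ, rfl⟩ := hL
    obtain ⟨h, h1, h3, h4⟩ := hA.exists_plane_of_secant h2 hP hQ hPQ
    exact ⟨h, h1, h3, finrank_sup_submodule hPQ, h4⟩
  choose f hpsi hcard hline hcon using hex
  refine (Set.ncard_congr f (fun L hL => ?_) (fun L L' hL hL' heq => ?_) fun h hh => ?_).symm
  · exact (hA.isDistinguishedTritangent_iff h2 _).2 ⟨L, hL, hpsi L hL⟩
  · obtain ⟨x₁, x₂, x₃, h12, -, -, hset⟩ := Set.ncard_eq_three.1 (hcard L hL)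
    have hfin : (contactPoints A (f L hL)).Finite :=
      Set.finite_of_ncard_ne_zero (by rw [hcard L hL]; norm_num)
    have hx₁ : x₁ ∈ contactPoints A (f L hL) := by simp [hset]
    have hx₂ : x₂ ∈ contactPoints A (f L hL) := by simp [hset]
    obtain ⟨hs₁, y₁, hy₁, hl₁⟩ := hcon L hL x₁ hx₁
    obtain ⟨-, y₂, hy₂, hl₂⟩ := hcon L hL x₂ hx₂
    obtain ⟨-, z₁, hz₁, hm₁⟩ := hcon L' hL' x₁ (heq ▸ hx₁)
    obtain ⟨-, z₂, hz₂, hm₂⟩ := hcon L' hL' x₂ (heq ▸ hx₂)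
    have hne := kernelImage_ne hfin hx₁ hx₂ hs₁ h12 hy₁ hy₂
    rw [← sup_submodule_eq (hline L hL) hne hl₁ hl₂]
    exact sup_submodule_eq (hline L' hL') hne ((hy₁.symm.trans hz₁).trans_le hm₁)
      ((hy₂.symm.trans hz₂).trans_le hm₂)
  · obtain ⟨L, hL, hLh⟩ := (hA.isDistinguishedTritangent_iff h2 h).1 hh
    exact ⟨L, hL, Set.singleton_eq_singleton_iff.1 ((hpsi L hL).symm.trans hLh)⟩

/-- No three Cayley points are collinear: 2st·A(·,p,q) vanishes only for s = 0 or t = 0. -/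
theorem IsGeneral.eq_or_eq_of_submodule_le (hA : IsGeneral A) (h2 : (2 : K) ≠ 0) {P Q y : P4 K}
    (hP : P ∈ cayleyVariety A) (hQ : Q ∈ cayleyVariety A) (hPQ : P ≠ Q) (hy : y ∈ cayleyVariety A)
    (h : y.submodule ≤ P.submodule ⊔ Q.submodule) : y = P ∨ y = Q := by
  obtain ⟨s, t, hst⟩ := exists_smul_of_submodule_le P.submodule_eq Q.submodule_eq h
  have hli := LinearIndependent.pair_iff.1 (Projectivization.linearIndependent_pair_iff_ne.2 hPQ)
  have hpol : polar A P.rep Q.rep ≠ 0 := hA.polar_ne_zero P.rep_nonzero hP fun c hc => by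
    simpa using (hli c (-1) (by rw [hc]; simp)).2
  have hq : quadrics A y.rep = 0 := hy
  have hP' : quadrics A P.rep = 0 := hP
  have hQ' : quadrics A Q.rep = 0 := hQ
  rw [← hst, quadrics_add, hP', hQ', smul_zero, smul_zero, zero_add, add_zero, smul_eq_zero,
    or_iff_left hpol, mul_eq_zero, mul_eq_zero, or_iff_right h2] at hq
  rcases hq with rfl | rfl
  · right
    rw [← y.mk_rep, ← Q.mk_rep, Projectivization.mk_eq_mk_iff']
    exact ⟨t, by rw [← hst, zero_smul, zero_add]⟩
  · left
    rw [← y.mk_rep, ← P.mk_rep, Projectivization.mk_eq_mk_iff']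
    exact ⟨s, by rw [← hst, zero_smul, add_zero]⟩

/-- A secant recovers its pair of points as the Cayley points lying on it, so secants correspond to
two-element subsets. -/
theorem IsGeneral.ncard_secantLines (hA : IsGeneral A) (h2 : (2 : K) ≠ 0)
    (hfin : (cayleyVariety A).Finite) :
    (secantLines A).ncard = (cayleyVariety A).ncard.choose 2 := by
  classical
  have himage : secantLines A = (fun s : Finset (P4 K) => s.sup Projectivization.submodule) ''
      ((hfin.toFinset.powersetCard 2 : Finset (Finset (P4 K))) : Set (Finset (P4 K))) := by
    ext L
    constructor
    · rintro ⟨P, hP, Q, hQ, hPQ, rfl⟩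
      refine ⟨{P, Q}, ?_, by simp⟩
      rw [Finset.mem_coe, Finset.mem_powersetCard, Finset.card_pair hPQ]
      refine ⟨fun y hy => ?_, rfl⟩
      rw [Finset.mem_insert, Finset.mem_singleton] at hy
      rcases hy with rfl | rfl <;> simpa
    · rintro ⟨s, hs, rfl⟩
      rw [Finset.mem_coe, Finset.mem_powersetCard, Finset.card_eq_two] at hs
      obtain ⟨hs, P, Q, hPQ, rfl⟩ := hs
      refine ⟨P, ?_, Q, ?_, hPQ, by simp⟩
      · exact hfin.mem_toFinset.1 (hs (by simp))
      · exact hfin.mem_toFinset.1 (hs (by simp))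
  have hrec (s : Finset (P4 K)) (hs : s ∈ hfin.toFinset.powersetCard 2) :
      hfin.toFinset.filter (fun y => y.submodule ≤ s.sup Projectivization.submodule) = s := by
    rw [Finset.mem_powersetCard, Finset.card_eq_two] at hs
    obtain ⟨hs, P, Q, hPQ, rfl⟩ := hs
    have hP := hfin.mem_toFinset.1 (hs (by simp : P ∈ _))
    have hQ := hfin.mem_toFinset.1 (hs (by simp : Q ∈ _))
    ext y
    rw [Finset.mem_filter, hfin.mem_toFinset]
    constructor
    · rintro ⟨hy, hle⟩
      rw [Finset.sup_insert, Finset.sup_singleton] at hle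
      simpa using hA.eq_or_eq_of_submodule_le h2 hP hQ hPQ hy hle
    · intro hy
      exact ⟨hfin.mem_toFinset.1 (hs hy), Finset.le_sup hy⟩
  rw [himage, Set.InjOn.ncard_image, Set.ncard_coe_finset, Finset.card_powersetCard,
    Set.ncard_eq_toFinset_card _ hfin]
  intro s hs s' hs' heq
  rw [← hrec s hs, ← hrec s' hs']
  simp only at heq
  rw [heq]

/-- The exclusion of 17 pairwise non-proportional zeros also gives finiteness, and the normalisation
y_4 = 1 makes distinct vectors distinct points. -/
theorem ncard_cayleyVariety {y : (Fin 4 → Bool) → Fin 5 → K} (hinj : Function.Injective y)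
    (hy : ∀ e, y e 4 = 1 ∧ quadrics A (y e) = 0)
    (hle : ∀ p : Fin 17 → Fin 5 → K, (∀ j, p j ≠ 0) → (∀ j, quadrics A (p j) = 0) →
      ∃ j l, j ≠ l ∧ ∃ c : K, c • p j = p l) :
    (cayleyVariety A).Finite ∧ (cayleyVariety A).ncard = 16 := by
  have hupper (s : Finset (P4 K)) (hs : (s : Set (P4 K)) ⊆ cayleyVariety A) : s.card ≤ 16 := by
    by_contra! h
    obtain ⟨t, hts, ht⟩ := Finset.exists_subset_card_eq h
    let e := t.equivFinOfCardEq ht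
    obtain ⟨j, l, hjl, c, hc⟩ := hle (fun j => (e.symm j : P4 K).rep)
      (fun j => Projectivization.rep_nonzero _) fun j => hs (hts (e.symm j).2)
    refine hjl (e.symm.injective (Subtype.ext ?_))
    rw [← (e.symm j : P4 K).mk_rep, ← (e.symm l : P4 K).mk_rep, eq_comm,
      Projectivization.mk_eq_mk_iff']
    exact ⟨c, hc⟩
  have hfin : (cayleyVariety A).Finite := by
    by_contra hinf
    obtain ⟨s, hs, hcard⟩ := Set.Infinite.exists_subset_card_eq hinf 17
    have := hupper s hs
    omega
  refine ⟨hfin, le_antisymm ?_ ?_⟩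
  · rw [Set.ncard_eq_toFinset_card _ hfin]
    exact hupper _ (by simp)
  · have h0 (e : Fin 4 → Bool) : y e ≠ 0 := fun h => by simpa [h] using (hy e).1
    have hinj' : Function.Injective fun e => (Projectivization.mk K (y e) (h0 e) : P4 K) := by
      intro e e' h
      obtain ⟨c, hc⟩ := (Projectivization.mk_eq_mk_iff' K _ _ _ _).1 h
      have hc4 := congrFun hc 4
      rw [Pi.smul_apply, (hy e).1, (hy e').1, smul_eq_mul, mul_one] at hc4
      rw [hc4, one_smul] at hc
      exact hinj hc.symm
    have hsub : Set.range (fun e => (Projectivization.mk K (y e) (h0 e) : P4 K)) ⊆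
        cayleyVariety A := by
      rintro _ ⟨e, rfl⟩
      obtain ⟨c, hc⟩ := Projectivization.exists_smul_eq_mk_rep K _ (h0 e)
      change quadrics A _ = 0
      rw [← hc, Units.smul_def, quadrics_smul, (hy e).2, smul_zero]
    have := Set.ncard_le_ncard hsub hfin
    rw [← Set.image_univ, Set.ncard_image_of_injective _ hinj', Set.ncard_univ] at this
    simpa using this

end Tritangent

end QuinticSymmetroid

theorem mainTheorem9 (k : Type*) [Field k] (h2 : (2 : k) ≠ 0) (h3 : (3 : k) ≠ 0) :
    ∃ P : MvPolynomial (Fin 4 × Sym2 (Fin 5)) k, P ≠ 0 ∧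
      ∀ (K : Type*) [Field K] [IsAlgClosed K] [Algebra k K] (A : QuinticSymmetroid.Tensor K),
        MvPolynomial.aeval (fun s : Fin 4 × Sym2 (Fin 5) => A s.1 s.2) P ≠ 0 →
          (QuinticSymmetroid.cayleyVariety A).ncard = 16 ∧
          (QuinticSymmetroid.secantLines A).ncard = 120 ∧
          {h : QuinticSymmetroid.DualP3 K |
            QuinticSymmetroid.IsDistinguishedTritangent A h}.ncard = 120 ∧
          ∀ h : QuinticSymmetroid.DualP3 K,
            QuinticSymmetroid.IsDistinguishedTritangent A h ↔
              ∃ L ∈ QuinticSymmetroid.secantLines A, QuinticSymmetroid.psiImage A L = {h} := by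
  obtain ⟨P₁, hP₁, h₁⟩ := QuinticSymmetroid.exists_sixteen_points k h2
  obtain ⟨P₂, hP₂, h₂⟩ := QuinticSymmetroid.exists_forall_reduced k
  obtain ⟨P₃, hP₃, h₃⟩ := QuinticSymmetroid.exists_forall_not_seventeen k h2
  obtain ⟨P₄, hP₄, h₄⟩ := QuinticSymmetroid.exists_forall_isTameNet k h2
  refine ⟨P₁ * P₂ * P₃ * P₄, mul_ne_zero (mul_ne_zero (mul_ne_zero hP₁ hP₂) hP₃) hP₄, ?_⟩
  intro K _ _ _ A hA
  rw [map_mul, map_mul, map_mul] at hA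
  have hA₄ := right_ne_zero_of_mul hA
  have hA₃ := right_ne_zero_of_mul (left_ne_zero_of_mul hA)
  have hA₂ := right_ne_zero_of_mul (left_ne_zero_of_mul (left_ne_zero_of_mul hA))
  have hA₁ := left_ne_zero_of_mul (left_ne_zero_of_mul (left_ne_zero_of_mul hA))
  have hK : (2 : K) ≠ 0 := by
    rw [← map_ofNat (algebraMap k K) 2]
    exact (map_ne_zero _).2 h2
  have hgen : QuinticSymmetroid.IsGeneral A :=
    ⟨fun y x hy hq => h₂ K A hA₂ y hy hq x, h₄ K A hA₄⟩
  obtain ⟨y, hinj, hy⟩ := h₁ K A hA₁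
  obtain ⟨hfin, h16⟩ := QuinticSymmetroid.ncard_cayleyVariety hinj hy (h₃ K A hA₃)
  have h120 : (QuinticSymmetroid.secantLines A).ncard = 120 := by
    rw [hgen.ncard_secantLines hK hfin, h16]
    rfl
  exact ⟨h16, h120, by rw [hgen.ncard_distinguished hK, h120],
    hgen.isDistinguishedTritangent_iff hK⟩
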